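/- Work over $\mathbb{C}$. Let $R=\mathbb{C}\langle x,y\rangle/(x^5=yxy,\ y^2=xyx)$, graded by $\deg x=1$, $\deg y=2$. Let $p_1,p_2,p_3\in\mathbb{P}^2$ be three non-collinear points and let $\mathbb{B}_3$ be the blow-up of $\mathbb{P}^2$ at $p_1,p_2,p_3$. Its six $(-1)$-curves are the exceptional curves $E_i$ over $p_i$ and the strict transforms $L_i$ of the lines through the two points $p_j$, $j\ne i$. Fix a choice of vectors $v_i\in\mathbb{C}^3$ representing the $p_i$. Let $X,Y,Z,s,t,u$ be the coordinates on $\mathbb{C}^6$ (Cox coordinates of $\mathbb{B}_3$), let $W\subset\mathbb{C}^6$ be the union of the nine subspaces $X=t=0$, $Y=s=0$, $Z=u=0$, $X=Y=0$, $Y=Z=0$, $Z=X=0$, $s=t=0$, $u=t=0$, $s=u=0$, and let $q:\mathbb{C}^6\setminus W\to\mathbb{B}_3$ be the morphism lifting $$(X,Y,Z,s,t,u)\mapsto [\,Xsu\,v_1+Ytu\,v_2+Zst\,v_3\,]\in\mathbb{P}^2 ,$$ so that $L_1,L_2,L_3,E_2,E_1,E_3$ are the images of $X=0$, $Y=0$,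 $Z=0$, $s=0$, $t=0$, $u=0$. Let $\tilde\sigma(X,Y,Z,s,t,u)=(u,t,s,X,Z,Y)$ on $\mathbb{C}^6\setminus W$. Then there are an automorphism $\sigma$ of $\mathbb{B}_3$ of order six with $\sigma\circ q=q\circ\tilde\sigma$, which permutes the $(-1)$-curves cyclically, $$\sigma^{-1}(L_1)=E_3,\quad \sigma^{-1}(E_3)=L_2,\quad \sigma^{-1}(L_2)=E_1,\quad \sigma^{-1}(E_1)=L_3,\quad \sigma^{-1}(L_3)=E_2,\quad \sigma^{-1}(E_2)=L_1,$$ and a line bundle $\mathcal{L}\cong\mathcal{O}(L_1)$ on $\mathbb{B}_3$ such that $R$ is isomorphic, as a graded $\mathbb{C}$-algebra, to the twisted homogeneous coordinate ring $$B(\mathbb{B}_3,\mathcal{L},\sigma)=\bigoplus_{n\ge 0}H^0(\mathbb{B}_3,\mathcal{L}_n),\qquad \mathcal{L}_n=\mathcal{L}\otimes\sigma^*\mathcal{L}\otimes\cdots\otimes(\sigma^*)^{n-1}\mathcal{L},$$ whose product is $a\cdot b=a\otimes(\sigma^*)^m b$ for $a\in H^0(\mathcal{L}_m)$, $b\in H^0(\mathcal{L}_n)$.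 Moreover, for a suitable trivialization of $q^*\mathcal{L}$ (and the trivializations of $q^*\mathcal{L}_n$ that it induces through $\tilde\sigma$), the isomorphism sends $x$ to the section of $\mathcal{L}_1$ whose pull-back to $\mathbb{C}^6\setminus W$ is $X$, and $y$ to the section of $\mathcal{L}_2$ whose pull-back is $Zt$. -/

import Mathlib

open TopologicalSpace
open scoped LinearAlgebra.Projectivization

noncomputable section

namespace DelPezzo

/-! ### Varieties over `ℂ` as spaces with a sheaf of regular `ℂ`-valued functions -/

/-- A sheaf of `ℂ`-algebras of `ℂ`-valued functions, the regular functions, on a topological space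
(the closed points of a variety over `ℂ` with the Zariski topology). -/
class Variety (X : Type) [TopologicalSpace X] where
  reg (U : Opens X) : Subalgebra ℂ (U → ℂ)
  res {U V : Opens X} (h : U ≤ V) {f : V → ℂ} :
    f ∈ reg V → (fun x : U => f ⟨x, h x.2⟩) ∈ reg U
  glue {U : Opens X} {f : U → ℂ} :
    (∀ x : U, ∃ V : Opens X, ∃ h : V ≤ U, (x : X) ∈ V ∧
      (fun y : V => f ⟨y, h y.2⟩) ∈ reg V) → f ∈ reg U

/-- Morphisms are the continuous maps that pull regular functions back to regular functions. -/
def IsMorphism {X Y : Type} [TopologicalSpace X] [Variety X] [TopologicalSpace Y] [Variety Y]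
    (φ : X → Y) : Prop :=
  ∃ hφ : Continuous φ, ∀ (U : Opens Y) (f : U → ℂ), f ∈ Variety.reg U →
    (fun x : Opens.comap ⟨φ, hφ⟩ U => f ⟨φ x, x.2⟩) ∈ Variety.reg (Opens.comap ⟨φ, hφ⟩ U)

/-- The automorphism group of a variety. -/
def VAut (X : Type) [TopologicalSpace X] [Variety X] : Subgroup (Equiv.Perm X) where
  carrier := {σ | IsMorphism σ ∧ IsMorphism σ.symm}
  mul_mem' := by
    rintro σ τ ⟨⟨c1, h1⟩, ⟨c2, h2⟩⟩ ⟨⟨c3, h3⟩, ⟨c4, h4⟩⟩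
    exact ⟨⟨c1.comp c3, fun U f hf => h3 _ _ (h1 U f hf)⟩,
      ⟨c4.comp c2, fun U f hf => h2 _ _ (h4 U f hf)⟩⟩
  one_mem' := ⟨⟨continuous_id, fun _ _ hf => hf⟩, ⟨continuous_id, fun _ _ hf => hf⟩⟩
  inv_mem' := by
    rintro σ ⟨h1, h2⟩
    exact ⟨h2, h1⟩

/-! ### Quasi-projective coordinates

`𝒜 d` is the space of forms of degree `d`, viewed as functions on the set `X` (for projective
varieties after a choice of representatives of the points, which affects neither zero sets nor
quotients of forms of the same degree). -/

section Coordinates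

variable {X D : Type} [AddCommMonoid D] (𝒜 : D → Submodule ℂ (X → ℂ))

/-- The Zariski topology: the non-vanishing sets of forms are a basis of the open sets. -/
@[reducible]
def zariski : TopologicalSpace X :=
  generateFrom {O | ∃ d, ∃ G ∈ 𝒜 d, O = {x | G x ≠ 0}}

/-- The regular functions are those that are, locally, quotients of two forms of the same degree. -/
@[reducible]
def zariskiVariety [SetLike.GradedMonoid 𝒜] : @Variety X (zariski 𝒜) :=
  letI := zariski 𝒜
  { reg := fun U =>
      { carrier := {f | ∀ x : U, ∃ V : Opens X, (x : X) ∈ V ∧ ∃ d, ∃ F ∈ 𝒜 d, ∃ G ∈ 𝒜 d,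
          ∀ y : U, (y : X) ∈ V → G y ≠ 0 ∧ f y = F y / G y}
        mul_mem' := by
          intro f g hf hg x
          obtain ⟨V, hV, d, F, hF, G, hG, h⟩ := hf x
          obtain ⟨V', hV', d', F', hF', G', hG', h'⟩ := hg x
          refine ⟨V ⊓ V', ⟨hV, hV'⟩, d + d', F * F', SetLike.mul_mem_graded hF hF',
            G * G', SetLike.mul_mem_graded hG hG', fun y hy => ?_⟩
          obtain ⟨a, b⟩ := h y hy.1
          obtain ⟨a', b'⟩ := h' y hy.2
          refine ⟨mul_ne_zero a a', ?_⟩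
          simp only [Pi.mul_apply, b, b']
          field_simp
        add_mem' := by
          intro f g hf hg x
          obtain ⟨V, hV, d, F, hF, G, hG, h⟩ := hf x
          obtain ⟨V', hV', d', F', hF', G', hG', h'⟩ := hg x
          refine ⟨V ⊓ V', ⟨hV, hV'⟩, d + d', F * G' + G * F',
            add_mem (SetLike.mul_mem_graded hF hG') (SetLike.mul_mem_graded hG hF'),
            G * G', SetLike.mul_mem_graded hG hG', fun y hy => ?_⟩
          obtain ⟨a, b⟩ := h y hy.1
          obtain ⟨a', b'⟩ := h' y hy.2
          refine ⟨mul_ne_zero a a', ?_⟩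
          simp only [Pi.mul_apply, Pi.add_apply, b, b']
          field_simp
        algebraMap_mem' := by
          intro r x
          refine ⟨⊤, trivial, 0, r • 1, Submodule.smul_mem _ _ (SetLike.one_mem_graded 𝒜), 1,
            SetLike.one_mem_graded 𝒜, fun y _ => ⟨one_ne_zero, ?_⟩⟩
          simp [Pi.algebraMap_apply] }
    res := by
      intro U V h f hf x
      obtain ⟨W, hW, d, F, hF, G, hG, h'⟩ := hf ⟨x, h x.2⟩
      exact ⟨W, hW, d, F, hF, G, hG, fun y hy => h' ⟨y, h y.2⟩ hy⟩
    glue := by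
      intro U f hf x
      obtain ⟨V, hVU, hxV, hV⟩ := hf x
      obtain ⟨W, hW, d, F, hF, G, hG, h'⟩ := hV ⟨x, hxV⟩
      exact ⟨W ⊓ V, ⟨hW, hxV⟩, d, F, hF, G, hG, fun y hy => h' ⟨y, hy.2⟩ hy.1⟩ }

end Coordinates

/-! ### Line bundles and their global sections -/

/-- A line bundle, given by an open cover and transition functions `g i j` on `U i ∩ U j`. -/
structure LineBundle (X : Type) [TopologicalSpace X] [Variety X] where
  ι : Type
  U : ι → Opens X
  cover : ∀ x, ∃ i, x ∈ U i
  g : ∀ i j, (U i ⊓ U j : Opens X) → ℂ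
  g_reg : ∀ i j, g i j ∈ Variety.reg (U i ⊓ U j)
  g_self : ∀ i x, g i i x = 1
  g_mul : ∀ i j k (x : X) (hi : x ∈ U i) (hj : x ∈ U j) (hk : x ∈ U k),
    g i j ⟨x, Opens.mem_inf.2 ⟨hi, hj⟩⟩ * g j k ⟨x, Opens.mem_inf.2 ⟨hj, hk⟩⟩ = g i k ⟨x, Opens.mem_inf.2 ⟨hi, hk⟩⟩

/-- The intersection of finitely many open sets. -/
def finInter {X : Type} [TopologicalSpace X] {n : ℕ} (U : Fin n → Opens X) : Opens X :=
  ⟨⋂ k, (U k : Set X), isOpen_iInter_of_finite fun k => (U k).2⟩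

theorem mem_finInter {X : Type} [TopologicalSpace X] {n : ℕ} {U : Fin n → Opens X} {x : X} :
    x ∈ finInter U ↔ ∀ k, x ∈ U k :=
  Set.mem_iInter

variable {X : Type} [TopologicalSpace X] [Variety X]

/-- `H⁰(X, L)`: families of regular functions `s i` on `U i` with `s i = g i j * s j`. -/
def H0 (L : LineBundle X) : Submodule ℂ (∀ i, L.U i → ℂ) where
  carrier := {s | (∀ i, s i ∈ Variety.reg (L.U i)) ∧
    ∀ i j (x : X) (hi : x ∈ L.U i) (hj : x ∈ L.U j),
      s i ⟨x, hi⟩ = L.g i j ⟨x, Opens.mem_inf.2 ⟨hi, hj⟩⟩ * s j ⟨x, hj⟩}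
  add_mem' := by
    rintro s t ⟨hs, hs'⟩ ⟨ht, ht'⟩
    refine ⟨fun i => add_mem (hs i) (ht i), fun i j x hi hj => ?_⟩
    simp only [Pi.add_apply, hs' i j x hi hj, ht' i j x hi hj, mul_add]
  zero_mem' := ⟨fun i => zero_mem _, fun i j x hi hj => by simp⟩
  smul_mem' := by
    rintro c s ⟨hs, hs'⟩
    refine ⟨fun i => Subalgebra.smul_mem _ (hs i) c, fun i j x hi hj => ?_⟩
    simp only [Pi.smul_apply, smul_eq_mul, hs' i j x hi hj]
    ring

/-- `L ≅ 𝒪(C)` for a closed subset `C` that is an effective Cartier divisor: `L` has a section `s`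
such that multiplication by `s i` is a bijection from the regular functions on `V` onto those that
vanish on `C ∩ V`, for all open `V ⊆ U i`. -/
def LineBundle.IsOfDivisor (L : LineBundle X) (C : Set X) : Prop :=
  ∃ s : H0 L, ∀ (i : L.ι) (V : Opens X) (hV : V ≤ L.U i),
    (∀ x : V, (x : X) ∈ C → s.1 i ⟨x, hV x.2⟩ = 0) ∧
    ∀ f ∈ Variety.reg V, (∀ x : V, (x : X) ∈ C → f x = 0) →
      ∃! h : V → ℂ, h ∈ Variety.reg V ∧ ∀ x : V, f x = h x * s.1 i ⟨x, hV x.2⟩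

theorem VAut.continuous (σ : VAut X) : Continuous (σ : Equiv.Perm X) := σ.2.1.1

/-- The pull-back `σ^* L`. -/
def LineBundle.pullback (σ : VAut X) (L : LineBundle X) : LineBundle X where
  ι := L.ι
  U i := Opens.comap ⟨(σ : Equiv.Perm X), VAut.continuous σ⟩ (L.U i)
  cover x := L.cover ((σ : Equiv.Perm X) x)
  g i j x := L.g i j ⟨(σ : Equiv.Perm X) x, x.2⟩
  g_reg i j := σ.2.1.2 _ _ (L.g_reg i j)
  g_self i _ := L.g_self i _
  g_mul i j k _ hi hj hk := L.g_mul i j k _ hi hj hk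

/-- The tensor product of finitely many line bundles (the trivial one if there are none). -/
def LineBundle.tensor {n : ℕ} (L : Fin n → LineBundle X) : LineBundle X where
  ι := ∀ k, (L k).ι
  U I := finInter fun k => (L k).U (I k)
  cover x := ⟨fun k => ((L k).cover x).choose,
    mem_finInter.2 fun k => ((L k).cover x).choose_spec⟩
  g I J x := ∏ k, (L k).g (I k) (J k) ⟨x, Opens.mem_inf.2
    ⟨mem_finInter.1 (Opens.mem_inf.1 x.2).1 k, mem_finInter.1 (Opens.mem_inf.1 x.2).2 k⟩⟩
  g_reg I J := by
    have : ∀ k ∈ (Finset.univ : Finset (Fin n)), _ := fun k _ =>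
      Variety.res (U := finInter (fun k => (L k).U (I k)) ⊓ finInter fun k => (L k).U (J k))
        (V := (L k).U (I k) ⊓ (L k).U (J k)) (fun x hx => Opens.mem_inf.2
          ⟨mem_finInter.1 (Opens.mem_inf.1 hx).1 k, mem_finInter.1 (Opens.mem_inf.1 hx).2 k⟩)
        ((L k).g_reg (I k) (J k))
    convert prod_mem this using 1
    funext x
    simp only [Finset.prod_apply]
  g_self I x := by simp only [(L _).g_self, Finset.prod_const_one]
  g_mul I J K x hI hJ hK := by
    rw [← Finset.prod_mul_distrib]
    exact Finset.prod_congr rfl fun k _ => (L k).g_mul _ _ _ x (mem_finInter.1 hI k) (mem_finInter.1 hJ k)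
      (mem_finInter.1 hK k)

/-- `L_n = L ⊗ σ^* L ⊗ ⋯ ⊗ (σ^*)^(n-1) L`. -/
def LineBundle.twist (L : LineBundle X) (σ : VAut X) (n : ℕ) : LineBundle X :=
  LineBundle.tensor fun k : Fin n => L.pullback (σ ^ (k : ℕ))

/-! ### Twisted homogeneous coordinate rings -/

/-- The homogeneous component `B_n = H⁰(X, L_n)`. -/
abbrev TwistedPiece (L : LineBundle X) (σ : VAut X) (n : ℕ) : Type := H0 (L.twist σ n)

variable {L : LineBundle X} {σ : VAut X}

theorem act_add (σ : VAut X) (m k : ℕ) (x : X) :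
    ((σ ^ (m + k) : VAut X) : Equiv.Perm X) x =
      ((σ ^ k : VAut X) : Equiv.Perm X) (((σ ^ m : VAut X) : Equiv.Perm X) x) := by
  rw [add_comm, pow_add]
  rfl

theorem mem_twist {n : ℕ} {I : Fin n → L.ι} {x : X} :
    x ∈ (L.twist σ n).U I ↔ ∀ k, ((σ ^ (k : ℕ) : VAut X) : Equiv.Perm X) x ∈ L.U (I k) :=
  mem_finInter

theorem twist_left {m n : ℕ} {I : Fin (m + n) → L.ι} {x : X}
    (hx : x ∈ (L.twist σ (m + n)).U I) :
    x ∈ (L.twist σ m).U (fun k => I (Fin.castAdd n k)) :=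
  mem_twist.2 fun k => mem_twist.1 hx (Fin.castAdd n k)

theorem twist_right {m n : ℕ} {I : Fin (m + n) → L.ι} {x : X}
    (hx : x ∈ (L.twist σ (m + n)).U I) :
    ((σ ^ m : VAut X) : Equiv.Perm X) x ∈ (L.twist σ n).U (fun k => I (Fin.natAdd m k)) := by
  refine mem_twist.2 fun k => ?_
  rw [← act_add]
  exact mem_twist.1 hx (Fin.natAdd m k)

theorem twist_g {n : ℕ} (I J : Fin n → L.ι) (x : X) (hI : x ∈ (L.twist σ n).U I)
    (hJ : x ∈ (L.twist σ n).U J) :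
    (L.twist σ n).g I J ⟨x, Opens.mem_inf.2 ⟨hI, hJ⟩⟩ =
      ∏ k, L.g (I k) (J k) ⟨((σ ^ (k : ℕ) : VAut X) : Equiv.Perm X) x,
        Opens.mem_inf.2 ⟨mem_twist.1 hI k, mem_twist.1 hJ k⟩⟩ := rfl

theorem twist_g_add {m n : ℕ} (I J : Fin (m + n) → L.ι) (x : X)
    (hI : x ∈ (L.twist σ (m + n)).U I) (hJ : x ∈ (L.twist σ (m + n)).U J) :
    (L.twist σ (m + n)).g I J ⟨x, Opens.mem_inf.2 ⟨hI, hJ⟩⟩ =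
      (L.twist σ m).g (fun k => I (Fin.castAdd n k)) (fun k => J (Fin.castAdd n k))
        ⟨x, Opens.mem_inf.2 ⟨twist_left hI, twist_left hJ⟩⟩ *
      (L.twist σ n).g (fun k => I (Fin.natAdd m k)) (fun k => J (Fin.natAdd m k))
        ⟨((σ ^ m : VAut X) : Equiv.Perm X) x,
          Opens.mem_inf.2 ⟨twist_right hI, twist_right hJ⟩⟩ := by
  rw [twist_g I J x hI hJ, twist_g _ _ x (twist_left hI) (twist_left hJ),
    twist_g _ _ _ (twist_right hI) (twist_right hJ), Fin.prod_univ_add]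
  congr 1
  refine Finset.prod_congr rfl fun k _ => ?_
  congr 1
  exact Subtype.ext (act_add σ m k x)

/-- The multiplication `s * t = s ⊗ (σ^*)^m t` from `B_m × B_n` to `B_{m+n}`. -/
def twistedMul {m n : ℕ} (s : TwistedPiece L σ m) (t : TwistedPiece L σ n) :
    TwistedPiece L σ (m + n) :=
  ⟨fun I x =>
    s.1 (fun k => I (Fin.castAdd n k)) ⟨x, twist_left x.2⟩ *
    t.1 (fun k => I (Fin.natAdd m k))
      ⟨((σ ^ m : VAut X) : Equiv.Perm X) x, twist_right x.2⟩, by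
    refine ⟨fun I => mul_mem ?_ ?_, fun I J x hI hJ => ?_⟩
    · exact Variety.res (fun x hx => twist_left hx) (s.2.1 (fun k => I (Fin.castAdd n k)))
    · exact Variety.res (fun x hx => twist_right hx)
        ((σ ^ m).2.1.2 _ _ (t.2.1 (fun k => I (Fin.natAdd m k))))
    · have h1 := s.2.2 _ _ x (twist_left hI) (twist_left hJ)
      have h2 := t.2.2 _ _ _ (twist_right hI) (twist_right hJ)
      have h3 := twist_g_add I J x hI hJ
      exact (congrArg₂ (· * ·) h1 h2).trans ((mul_mul_mul_comm _ _ _ _).trans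
        (congrArg (· * _) h3.symm))⟩

theorem twistedMul_apply {m n : ℕ} (s : TwistedPiece L σ m) (t : TwistedPiece L σ n)
    (I : Fin (m + n) → L.ι) (x : X) (hx : x ∈ (L.twist σ (m + n)).U I) :
    (twistedMul s t).1 I ⟨x, hx⟩ =
      s.1 (fun k => I (Fin.castAdd n k)) ⟨x, twist_left hx⟩ *
      t.1 (fun k => I (Fin.natAdd m k))
        ⟨((σ ^ m : VAut X) : Equiv.Perm X) x, twist_right hx⟩ := rfl

/-- The scalars in `B_0 = H⁰(X, 𝒪)`. -/
def twistedScalar : ℂ →+ TwistedPiece L σ 0 where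
  toFun c := ⟨fun _ _ => c, fun I => Subalgebra.algebraMap_mem _ c, fun I J x hI hJ => by
    have h := twist_g (L := L) (σ := σ) I J x hI hJ
    rw [Fin.prod_univ_zero] at h
    exact ((congrArg (· * c) h).trans (one_mul c)).symm⟩
  map_zero' := rfl
  map_add' _ _ := rfl

theorem twistedScalar_apply (c : ℂ) (I : Fin 0 → L.ι) (x : X) (hx : x ∈ (L.twist σ 0).U I) :
    (twistedScalar (L := L) (σ := σ) c).1 I ⟨x, hx⟩ = c := rfl

theorem twisted_ext {m n : ℕ} (h : m = n) (s : TwistedPiece L σ m) (t : TwistedPiece L σ n)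
    (H : ∀ (I : Fin n → L.ι) (x : X) (hm : x ∈ (L.twist σ m).U (fun k => I (Fin.cast h k)))
      (hn : x ∈ (L.twist σ n).U I),
      s.1 (fun k => I (Fin.cast h k)) ⟨x, hm⟩ = t.1 I ⟨x, hn⟩) :
    GradedMonoid.mk (A := TwistedPiece L σ) m s = GradedMonoid.mk n t := by
  subst h
  congr 1
  apply Subtype.ext
  funext I x
  exact H I x x.2 x.2

theorem H0_congr {L : LineBundle X} (s : H0 L) {I J : L.ι} (h : I = J) {x y : X} (hxy : x = y)
    (hx : x ∈ L.U I) (hy : y ∈ L.U J) : s.1 I ⟨x, hx⟩ = s.1 J ⟨y, hy⟩ := by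
  subst h hxy
  rfl

instance : GradedMonoid.GMul (TwistedPiece L σ) where
  mul := twistedMul

instance : GradedMonoid.GOne (TwistedPiece L σ) where
  one := twistedScalar 1

instance : DirectSum.GSemiring (TwistedPiece L σ) where
  mul := twistedMul
  one := twistedScalar 1
  mul_zero s := Subtype.ext (by funext I x; exact mul_zero _)
  zero_mul s := Subtype.ext (by funext I x; exact zero_mul _)
  mul_add s t t' := Subtype.ext (by funext I x; exact mul_add _ _ _)
  add_mul s t t' := Subtype.ext (by funext I x; exact add_mul _ _ _)
  one_mul := by
    rintro ⟨n, t⟩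
    refine twisted_ext (zero_add n) (twistedMul (twistedScalar 1) t) t fun I x hm hn => ?_
    rw [twistedMul_apply, twistedScalar_apply, one_mul]
    refine H0_congr t (funext fun k => congrArg I (Fin.ext ?_)) rfl _ _
    simp
  mul_one := by
    rintro ⟨n, t⟩
    refine twisted_ext (add_zero n) (twistedMul t (twistedScalar 1)) t fun I x hm hn => ?_
    rw [twistedMul_apply, twistedScalar_apply, mul_one]
    exact H0_congr t (funext fun k => congrArg I (Fin.ext rfl)) rfl _ _
  mul_assoc := by
    rintro ⟨a, s⟩ ⟨b, t⟩ ⟨c, r⟩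
    refine twisted_ext (add_assoc a b c) (twistedMul (twistedMul s t) r)
      (twistedMul s (twistedMul t r)) fun I x hm hn => ?_
    simp only [twistedMul_apply, mul_assoc]
    congr 1
    congr 1
    refine H0_congr r (funext fun k => congrArg I (Fin.ext ?_)) (act_add σ a b x) _ _
    simp [add_assoc]
  natCast n := twistedScalar n
  natCast_zero := by
    rw [Nat.cast_zero, map_zero]
  natCast_succ n := by
    rw [Nat.cast_succ, map_add]

instance : DirectSum.GAlgebra ℂ (TwistedPiece L σ) where
  toFun := twistedScalar
  map_one := rfl
  map_mul c d := by
    refine twisted_ext (add_zero 0).symm (twistedScalar (c * d))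
      (twistedMul (twistedScalar c) (twistedScalar d)) fun I x hm hn => ?_
    rfl
  commutes := by
    rintro c ⟨n, t⟩
    refine twisted_ext (by rw [zero_add, add_zero]) (twistedMul (twistedScalar c) t)
      (twistedMul t (twistedScalar c)) fun I x hm hn => ?_
    rw [twistedMul_apply, twistedScalar_apply, twistedMul_apply, twistedScalar_apply, mul_comm]
    congr 1
    refine H0_congr t (funext fun k => congrArg I (Fin.ext ?_)) rfl _ _
    simp
  smul_def := by
    rintro c ⟨n, t⟩
    refine twisted_ext (zero_add n).symm (c • t) (twistedMul (twistedScalar c) t)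
      fun I x hm hn => ?_
    rw [twistedMul_apply, twistedScalar_apply]
    change c * _ = _
    congr 1
    refine H0_congr t (funext fun k => congrArg I (Fin.ext ?_)) rfl _ _
    simp

/-- The twisted homogeneous coordinate ring `B(X, L, σ) = ⨁ H⁰(X, L_n)`. -/
abbrev TwistedRing (L : LineBundle X) (σ : VAut X) : Type :=
  DirectSum ℕ (TwistedPiece L σ)

/-! ### The blow-up of the projective plane at three points -/

/-- The projective plane; its points also stand for the lines `{x | ∑ aⱼ xⱼ = 0}`, so that `x` lies
on the line `a` if and only if `x.orthogonal a`. -/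
abbrev Plane : Type := ℙ ℂ (Fin 3 → ℂ)

/-- The blow-up of the plane at `p 0`, `p 1`, `p 2`: the fibre product over the plane of the blow-ups
at the three points. The blow-up of the plane at a point `q` is the variety of pairs `(x, ℓ)` of a
point `x` and a line `ℓ` through `q` and `x`. The entry `b 0` is the point and `b 1`, `b 2`, `b 3`
are the lines. -/
def BlowUp (p : Fin 3 → Plane) : Type :=
  {b : Fin 4 → Plane // ∀ i : Fin 3, (p i).orthogonal (b i.succ) ∧ (b 0).orthogonal (b i.succ)}

/-- The multidegree of the `j`-th homogeneous coordinate of the `a`-th factor of `(ℙ²)⁴`. -/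
def multiWeight (aj : Fin 4 × Fin 3) : Fin 4 → ℕ := Pi.single aj.1 1

/-- Multihomogeneous forms of multidegree `d` on the blow-up, embedded in `(ℙ²)⁴`. -/
def blowUpForms (p : Fin 3 → Plane) (d : Fin 4 → ℕ) : Submodule ℂ (BlowUp p → ℂ) :=
  (MvPolynomial.weightedHomogeneousSubmodule ℂ multiWeight d).map
    (LinearMap.pi fun b : BlowUp p =>
      (MvPolynomial.aeval fun aj : Fin 4 × Fin 3 => (b.1 aj.1).rep aj.2).toLinearMap)

instance (p : Fin 3 → Plane) : SetLike.GradedMonoid (blowUpForms p) where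
  one_mem := ⟨1, MvPolynomial.isWeightedHomogeneous_one ℂ multiWeight, by
    funext b; simp⟩
  mul_mem := by
    rintro d e _ _ ⟨F, hF, rfl⟩ ⟨G, hG, rfl⟩
    exact ⟨F * G, MvPolynomial.IsWeightedHomogeneous.mul hF hG, by funext b; simp⟩

instance (p : Fin 3 → Plane) : TopologicalSpace (BlowUp p) := zariski (blowUpForms p)

instance (p : Fin 3 → Plane) : Variety (BlowUp p) := zariskiVariety (blowUpForms p)

/-- The exceptional curve over `p i`. -/
def exceptionalCurve (p : Fin 3 → Plane) (i : Fin 3) : Set (BlowUp p) := {b | b.1 0 = p i}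

/-- The strict transform of the line spanned by the two points `p j` with `j ≠ i`. -/
def lineCurve (p : Fin 3 → Plane) (i : Fin 3) : Set (BlowUp p) :=
  closure {b | ((b.1 0).submodule ≤ ⨆ j ∈ ({i}ᶜ : Set (Fin 3)), (p j).submodule) ∧
    ∀ j, b.1 0 ≠ p j}

/-- The hexagon `L₁, E₃, L₂, E₁, L₃, E₂` of `(-1)`-curves. -/
def hexagon (p : Fin 3 → Plane) : Fin 6 → Set (BlowUp p) :=
  ![lineCurve p 0, exceptionalCurve p 2, lineCurve p 1, exceptionalCurve p 0, lineCurve p 2,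
    exceptionalCurve p 1]

/-! ### Cox coordinates

The coordinates `X, Y, Z, s, t, u` are the entries `0, 1, 2, 3, 4, 5`. -/

/-- Points of `ℂ⁶` off the irrelevant locus: no two coordinates that belong to disjoint curves
vanish simultaneously. -/
def CoxSpace : Type :=
  {c : Fin 6 → ℂ //
    ¬ (c 0 = 0 ∧ c 4 = 0) ∧ ¬ (c 1 = 0 ∧ c 3 = 0) ∧ ¬ (c 2 = 0 ∧ c 5 = 0) ∧
    ¬ (c 0 = 0 ∧ c 1 = 0) ∧ ¬ (c 1 = 0 ∧ c 2 = 0) ∧ ¬ (c 2 = 0 ∧ c 0 = 0) ∧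
    ¬ (c 3 = 0 ∧ c 4 = 0) ∧ ¬ (c 5 = 0 ∧ c 4 = 0) ∧ ¬ (c 3 = 0 ∧ c 5 = 0)}

/-- Polynomial functions on `CoxSpace` (graded by the trivial monoid). -/
def coxForms (_ : PUnit) : Submodule ℂ (CoxSpace → ℂ) :=
  LinearMap.range (LinearMap.pi fun c : CoxSpace =>
    (MvPolynomial.aeval (R := ℂ) c.1).toLinearMap)

instance : SetLike.GradedMonoid coxForms where
  one_mem := ⟨1, by funext b; simp⟩
  mul_mem := by
    rintro d e _ _ ⟨F, rfl⟩ ⟨G, rfl⟩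
    exact ⟨F * G, by funext b; simp⟩

instance : TopologicalSpace CoxSpace := zariski coxForms

instance : Variety CoxSpace := zariskiVariety coxForms

/-- The map of `ℂ⁶ ∖ W` induced by the ring automorphism `X ↦ u ↦ Y ↦ t ↦ Z ↦ s ↦ X`, that is,
the value of a coordinate at `coxShift c` is the value of its image at `c`. -/
def coxShift (c : CoxSpace) : CoxSpace :=
  ⟨![c.1 5, c.1 4, c.1 3, c.1 0, c.1 2, c.1 1], by
    obtain ⟨c, h1, h2, h3, h4, h5, h6, h7, h8, h9⟩ := c
    exact ⟨fun h => h3 h.symm, fun h => h1 h.symm, fun h => h2 h.symm, fun h => h8 h,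
      fun h => h7 h.symm, fun h => h9 h, fun h => h6 h.symm, fun h => h5 h, fun h => h4 h⟩⟩

section CoxMap

variable {p : Fin 3 → Plane}

theorem comb_zero (hp : Projectivization.Independent p) {a b c : ℂ}
    (h : a • (p 0).rep + b • (p 1).rep + c • (p 2).rep = 0) : a = 0 ∧ b = 0 ∧ c = 0 := by
  have h1 := Fintype.linearIndependent_iff.1 (Projectivization.independent_iff.1 hp) ![a, b, c]
    (by simpa [Fin.sum_univ_three] using h)
  exact ⟨h1 0, h1 1, h1 2⟩

theorem cross_ne {v w : Fin 3 → ℂ} (h : ∀ a b : ℂ, a • v + b • w = 0 → a = 0 ∧ b = 0) :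
    crossProduct v w ≠ 0 :=
  crossProduct_ne_zero_iff_linearIndependent.2 (LinearIndependent.pair_iff.2 h)

/-- The image of `(X, Y, Z, s, t, u)` in the plane, in the frame given by `p`: `(Xsu, Ytu, Zst)`. -/
def coxPoint (p : Fin 3 → Plane) (c : CoxSpace) : Fin 3 → ℂ :=
  (c.1 0 * c.1 3 * c.1 5) • (p 0).rep + (c.1 1 * c.1 4 * c.1 5) • (p 1).rep +
    (c.1 2 * c.1 3 * c.1 4) • (p 2).rep

/-- The lines through `p i` and the point `coxPoint p c`, after removal of the common factors
`t`, `s`, `u` that vanish along the exceptional curves. -/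
def coxLine (p : Fin 3 → Plane) (c : CoxSpace) : Fin 3 → Fin 3 → ℂ :=
  ![crossProduct (p 0).rep ((c.1 1 * c.1 5) • (p 1).rep + (c.1 2 * c.1 3) • (p 2).rep),
    crossProduct (p 1).rep ((c.1 0 * c.1 5) • (p 0).rep + (c.1 2 * c.1 4) • (p 2).rep),
    crossProduct (p 2).rep ((c.1 0 * c.1 3) • (p 0).rep + (c.1 1 * c.1 4) • (p 1).rep)]

theorem coxPoint_ne (hp : Projectivization.Independent p) (c : CoxSpace) : coxPoint p c ≠ 0 := by
  intro h
  obtain ⟨h1, h2, h3⟩ := comb_zero hp h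
  obtain ⟨c, hc⟩ := c
  simp only [mul_eq_zero] at h1 h2 h3
  tauto

theorem coxLine_ne (hp : Projectivization.Independent p) (c : CoxSpace) (i : Fin 3) :
    coxLine p c i ≠ 0 := by
  obtain ⟨c, hc⟩ := c
  fin_cases i
  · refine cross_ne fun a b h => ?_
    obtain ⟨h1, h2, h3⟩ := comb_zero hp (a := a) (b := b * (c 1 * c 5)) (c := b * (c 2 * c 3))
      (by rw [← h]; module)
    simp only [mul_eq_zero] at h1 h2 h3
    tauto
  · refine cross_ne fun a b h => ?_
    obtain ⟨h1, h2, h3⟩ := comb_zero hp (a := b * (c 0 * c 5)) (b := a) (c := b * (c 2 * c 4))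
      (by rw [← h]; module)
    simp only [mul_eq_zero] at h1 h2 h3
    tauto
  · refine cross_ne fun a b h => ?_
    obtain ⟨h1, h2, h3⟩ := comb_zero hp (a := b * (c 0 * c 3)) (b := b * (c 1 * c 4)) (c := a)
      (by rw [← h]; module)
    simp only [mul_eq_zero] at h1 h2 h3
    tauto

/-- The quotient map `ℂ⁶ ∖ W → B₃`. -/
def coxMap (hp : Projectivization.Independent p) (c : CoxSpace) : BlowUp p :=
  ⟨Fin.cons (Projectivization.mk ℂ (coxPoint p c) (coxPoint_ne hp c))
    fun i => Projectivization.mk ℂ (coxLine p c i) (coxLine_ne hp c i), fun i => by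
    rw [Fin.cons_zero, Fin.cons_succ]
    constructor
    · rw [← Projectivization.mk_rep (p i), Projectivization.orthogonal_mk]
      fin_cases i <;> simp [coxLine, dotProduct, crossProduct, Fin.sum_univ_three] <;> ring
    · rw [Projectivization.orthogonal_mk]
      fin_cases i <;>
        simp [coxPoint, coxLine, dotProduct, crossProduct, Fin.sum_univ_three] <;> ring⟩

/-- A trivialization of the pull-back of `L` to `ℂ⁶ ∖ W`: nowhere vanishing regular functions `e i`
on the preimage of `U i` with `e j = g i j * e i`, so that the functions `s i * e i` of a section
`s` glue. The values of `e i` off the preimage of `U i` are irrelevant. -/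
structure CoxTrivialization (hp : Projectivization.Independent p) (L : LineBundle (BlowUp p)) where
  e : L.ι → CoxSpace → ℂ
  regular : ∀ i c, coxMap hp c ∈ L.U i → ∃ O : Opens CoxSpace, c ∈ O ∧
    (∀ c' ∈ O, coxMap hp c' ∈ L.U i) ∧ (fun c' : O => e i c') ∈ Variety.reg O
  ne_zero : ∀ i c, coxMap hp c ∈ L.U i → e i c ≠ 0
  compat : ∀ i j c (hi : coxMap hp c ∈ L.U i) (hj : coxMap hp c ∈ L.U j),
    e j c = L.g i j ⟨coxMap hp c, Opens.mem_inf.2 ⟨hi, hj⟩⟩ * e i c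

/-- The section `s` of `L ⊗ σ^* L ⊗ ⋯ ⊗ (σ^*)^(n-1) L`, pulled back to `ℂ⁶ ∖ W`, is the polynomial
`F` in the Cox coordinates. Here `(σ^*)^k L` is trivialized by the pull-back of the trivialization
of `L` under the `k`-th iterate of `coxShift`, which covers `σ ^ k`. -/
def CoxTrivialization.Represents {hp : Projectivization.Independent p} {L : LineBundle (BlowUp p)}
    (T : CoxTrivialization hp L) {σ : VAut (BlowUp p)} {n : ℕ} (s : TwistedPiece L σ n)
    (F : MvPolynomial (Fin 6) ℂ) : Prop :=
  ∀ (I : Fin n → L.ι) (c : CoxSpace) (h : coxMap hp c ∈ (L.twist σ n).U I),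
    s.1 I ⟨coxMap hp c, h⟩ * ∏ k : Fin n, T.e (I k) (coxShift^[(k : ℕ)] c) =
      MvPolynomial.eval c.1 F

end CoxMap

/-! ### The algebra `R` -/

/-- The relations `x⁵ = yxy` and `y² = xyx` between `x = ι 0` and `y = ι 1`. -/
inductive Rel : FreeAlgebra ℂ (Fin 2) → FreeAlgebra ℂ (Fin 2) → Prop
  | first : Rel (FreeAlgebra.ι ℂ 0 ^ 5)
      (FreeAlgebra.ι ℂ 1 * FreeAlgebra.ι ℂ 0 * FreeAlgebra.ι ℂ 1)
  | second : Rel (FreeAlgebra.ι ℂ 1 ^ 2)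
      (FreeAlgebra.ι ℂ 0 * FreeAlgebra.ι ℂ 1 * FreeAlgebra.ι ℂ 0)

/-- `R = ℂ⟨x, y⟩ / (x⁵ = yxy, y² = xyx)`. -/
abbrev AlgR : Type := RingQuot Rel

/-- The generators `x` (for `0`) and `y` (for `1`) of `R`. -/
def gen (i : Fin 2) : AlgR := RingQuot.mkAlgHom ℂ Rel (FreeAlgebra.ι ℂ i)

/-- The component of degree `n` of `R`, where `deg x = 1` and `deg y = 2`: the span of the words of
weight `n`. -/
def component (n : ℕ) : Submodule ℂ AlgR :=
  Submodule.span ℂ {r | ∃ w : List (Fin 2), (w.map ![1, 2]).sum = n ∧ r = (w.map gen).prod}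

end DelPezzo

end

open DelPezzo

noncomputable section

namespace DelPezzo

section

open scoped Topology

/-! ### Open sets and regular functions in terms of forms -/

section Zariski

variable {X D : Type} {𝒜 : D → Submodule ℂ (X → ℂ)}

/-! `coxMap` presents the blow-up as the quotient of `CoxSpace` by a four-dimensional torus: its
fibres are the torus orbits (`exists_torus_of_coxMap_eq`), and it has regular local sections
(`exists_local_section`), so openness and regularity on the blow-up can be tested upstairs
(`isOpen_of_eval`, `reg_of_regAt`). The map `coxShift` normalises the torus and therefore descends
to an automorphism that rotates the hexagon. The line bundle is built from the frames `coxFrame`,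
which all have the torus weight of `X`; its section with pull-back `X` cuts out L₁.

Since W has codimension two, functions regular on all of `CoxSpace` are polynomials
(`exists_polynomial_of_regAt`). Hence every section in degree `n` is a polynomial on which the torus
acts by the character `twistChar n` (`exists_represents`), and conversely (`polySection`). Only
monomials whose exponents satisfy the linear conditions `IsTwistExponent` can occur. In these terms
the twisted product of F and G is F times G with its variables rotated as often as the degree of F
says (`represents_mul`), so left multiplication by `X` or by `Zt` carries monomials to monomials, as
recorded by `xMul` and `yMul`.

It remains to compare words in x and y with monomials. The relations hold in the twisted ring
because both sides give the same monomial. A monomial of positive degree arises from a smaller one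
by `xMul` if X divides it, and by `yMul` otherwise, so every monomial comes from a word
(`exists_word`) and the map from R is onto. For injectivity, the relations of R suffice to rewrite
each word into the one with the same monomial that starts with x whenever possible
(`prod_gen_eq_normalWord`). Sending a monomial to that word is thus a linear left inverse
(`ofTwisted_toTwisted`). -/

theorem isOpen_nonvanishing {d : D} {G : X → ℂ} (hG : G ∈ 𝒜 d) :
    IsOpen[zariski 𝒜] {x | G x ≠ 0} :=
  TopologicalSpace.GenerateOpen.basic _ ⟨d, G, hG, rfl⟩

variable [AddCommMonoid D]

/-- Non-vanishing sets of forms are a basis of the Zariski topology. -/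
theorem exists_form_of_mem_open [SetLike.GradedMonoid 𝒜] {O : Set X} (hO : IsOpen[zariski 𝒜] O)
    {x : X} (hx : x ∈ O) : ∃ d, ∃ G ∈ 𝒜 d, G x ≠ 0 ∧ ∀ y, G y ≠ 0 → y ∈ O := by
  induction hO with
  | basic s hs =>
    obtain ⟨d, G, hG, rfl⟩ := hs
    exact ⟨d, G, hG, hx, fun y hy => hy⟩
  | univ => exact ⟨0, 1, SetLike.one_mem_graded 𝒜, one_ne_zero, fun _ _ => trivial⟩
  | inter s t _ _ hs ht =>
    obtain ⟨d, G, hG, hGx, hGs⟩ := hs hx.1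
    obtain ⟨e, H, hH, hHx, hHt⟩ := ht hx.2
    exact ⟨d + e, G * H, SetLike.mul_mem_graded hG hH, mul_ne_zero hGx hHx, fun y hy =>
      ⟨hGs y (left_ne_zero_of_mul hy), hHt y (right_ne_zero_of_mul hy)⟩⟩
  | sUnion S _ hS =>
    obtain ⟨s, hs, hxs⟩ := hx
    obtain ⟨d, G, hG, hGx, hGs⟩ := hS s hs hxs
    exact ⟨d, G, hG, hGx, fun y hy => ⟨s, hs, hGs y hy⟩⟩

/-- A regular function is near each point a quotient of forms, on the non-vanishing set of a form. -/
theorem exists_forms_of_reg [SetLike.GradedMonoid 𝒜] :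
    letI := zariski 𝒜
    letI := zariskiVariety 𝒜
    ∀ {U : Opens X} {f : U → ℂ}, f ∈ Variety.reg U → ∀ {x : X}, x ∈ U →
      ∃ d, ∃ F ∈ 𝒜 d, ∃ G ∈ 𝒜 d, ∃ e, ∃ H ∈ 𝒜 e, H x ≠ 0 ∧ ∀ y, H y ≠ 0 →
        G y ≠ 0 ∧ ∃ h : y ∈ U, f ⟨y, h⟩ = F y / G y := by
  let := zariski 𝒜
  let := zariskiVariety 𝒜
  intro U f hf x hx
  obtain ⟨V, hxV, d, F, hF, G, hG, hV⟩ := hf ⟨x, hx⟩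
  obtain ⟨e, H, hH, hHx, hHV⟩ := exists_form_of_mem_open (𝒜 := 𝒜) (U ⊓ V).2
    (show x ∈ (U ⊓ V : Opens X) from ⟨hx, hxV⟩)
  refine ⟨d, F, hF, G, hG, e, H, hH, hHx, fun y hy => ?_⟩
  have h := hHV y hy
  exact ⟨(hV ⟨y, h.1⟩ h.2).1, h.1, (hV ⟨y, h.1⟩ h.2).2⟩

theorem div_mem_reg [SetLike.GradedMonoid 𝒜] :
    letI := zariski 𝒜
    letI := zariskiVariety 𝒜
    ∀ {U : Opens X} {d : D} {F G : X → ℂ}, F ∈ 𝒜 d → G ∈ 𝒜 d → (∀ x ∈ U, G x ≠ 0) →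
      (fun x : U => F x / G x) ∈ Variety.reg U := by
  let := zariski 𝒜
  let := zariskiVariety 𝒜
  intro U d F G hF hG h x
  exact ⟨⊤, trivial, d, F, hF, G, hG, fun y _ => ⟨h y y.2, rfl⟩⟩

theorem inv_mem_reg [SetLike.GradedMonoid 𝒜] :
    letI := zariski 𝒜
    letI := zariskiVariety 𝒜
    ∀ {U : Opens X} {f : U → ℂ}, f ∈ Variety.reg U → (∀ x, f x ≠ 0) → f⁻¹ ∈ Variety.reg U := by
  let := zariski 𝒜
  let := zariskiVariety 𝒜
  intro U f hf h0 x
  obtain ⟨V, hxV, d, F, hF, G, hG, hV⟩ := hf x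
  refine ⟨V, hxV, d, G, hG, F, hF, fun y hy => ?_⟩
  obtain ⟨hGy, hfy⟩ := hV y hy
  refine ⟨fun h => h0 y (by rw [hfy, h, zero_div]), ?_⟩
  rw [Pi.inv_apply, hfy, inv_div]

theorem isOpen_ne_zero_of_reg [SetLike.GradedMonoid 𝒜] :
    letI := zariski 𝒜
    letI := zariskiVariety 𝒜
    ∀ {U : Opens X} {f : U → ℂ}, f ∈ Variety.reg U → IsOpen {x | ∃ h : x ∈ U, f ⟨x, h⟩ ≠ 0} := by
  let := zariski 𝒜
  let := zariskiVariety 𝒜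
  intro U f hf
  refine isOpen_iff_forall_mem_open.2 ?_
  rintro x ⟨hx, hfx⟩
  obtain ⟨d, F, hF, G, hG, e, H, hH, hHx, h⟩ := exists_forms_of_reg (𝒜 := 𝒜) hf hx
  refine ⟨{y | (F * H) y ≠ 0}, fun y hy => ?_,
    isOpen_nonvanishing (𝒜 := 𝒜) (SetLike.mul_mem_graded hF hH), ?_⟩
  · obtain ⟨hG, hU, hfy⟩ := h y (right_ne_zero_of_mul hy)
    exact ⟨hU, by rw [hfy]; exact div_ne_zero (left_ne_zero_of_mul hy) hG⟩
  · obtain ⟨hG, hU, hfx'⟩ := h x hHx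
    refine mul_ne_zero (fun hF0 => hfx ?_) hHx
    rw [hfx', hF0, zero_div]

end Zariski

end

section

open MvPolynomial (eval)

/-! ### Rational functions on `ℂ⁶ ∖ W` -/

/-- `φ` agrees near `c` with a quotient of two polynomials. -/
def RegAt (φ : CoxSpace → ℂ) (c : CoxSpace) : Prop :=
  ∃ F G : MvPolynomial (Fin 6) ℂ, eval c.1 G ≠ 0 ∧
    ∀ c' : CoxSpace, eval c'.1 G ≠ 0 → φ c' = eval c'.1 F / eval c'.1 G

/-- Multiplying numerator and denominator by `K` shrinks the domain of the fraction to `K ≠ 0`, so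
agreement there is enough. -/
theorem RegAt.congr {φ ψ : CoxSpace → ℂ} {c : CoxSpace} (h : RegAt φ c)
    (K : MvPolynomial (Fin 6) ℂ) (hK : eval c.1 K ≠ 0)
    (hφ : ∀ c' : CoxSpace, eval c'.1 K ≠ 0 → ψ c' = φ c') : RegAt ψ c := by
  obtain ⟨F, G, hG, h⟩ := h
  refine ⟨F * K, G * K, by simpa using ⟨hG, hK⟩, fun c' hc' => ?_⟩
  rw [map_mul] at hc'
  rw [hφ c' (right_ne_zero_of_mul hc'), h c' (left_ne_zero_of_mul hc'), map_mul, map_mul,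
    mul_div_mul_right _ _ (right_ne_zero_of_mul hc')]

theorem RegAt.mul {φ ψ : CoxSpace → ℂ} {c : CoxSpace} (hφ : RegAt φ c) (hψ : RegAt ψ c) :
    RegAt (fun c => φ c * ψ c) c := by
  obtain ⟨F, G, hG, h⟩ := hφ
  obtain ⟨F', G', hG', h'⟩ := hψ
  refine ⟨F * F', G * G', by simpa using ⟨hG, hG'⟩, fun c' hc' => ?_⟩
  rw [map_mul] at hc'
  beta_reduce
  rw [h c' (left_ne_zero_of_mul hc'), h' c' (right_ne_zero_of_mul hc'), map_mul, map_mul,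
    div_mul_div_comm]

theorem regAt_eval (F : MvPolynomial (Fin 6) ℂ) (c : CoxSpace) :
    RegAt (fun c => eval c.1 F) c :=
  ⟨F, 1, by simp, fun c' _ => by simp⟩

theorem RegAt.prod {n : ℕ} {φ : Fin n → CoxSpace → ℂ} {c : CoxSpace} (h : ∀ k, RegAt (φ k) c) :
    RegAt (fun c => ∏ k, φ k c) c := by
  induction n with
  | zero => exact ⟨1, 1, by simp, fun c' _ => by simp⟩
  | succ n ih =>
    refine ((h 0).mul (ih fun k => h k.succ)).congr 1 (by simp) fun c' _ => ?_
    rw [Fin.prod_univ_succ]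

theorem RegAt.inv {φ : CoxSpace → ℂ} {c : CoxSpace} (hφ : RegAt φ c) (h0 : φ c ≠ 0) :
    RegAt (fun c => (φ c)⁻¹) c := by
  obtain ⟨F, G, hG, h⟩ := hφ
  have hF : eval c.1 F ≠ 0 := fun hF => h0 (by rw [h c hG, hF, zero_div])
  refine RegAt.congr (φ := fun c => eval c.1 G / eval c.1 F) ⟨G, F, hF, fun _ _ => rfl⟩ G hG
    fun c' hc' => ?_
  simp only [h c' hc', inv_div]

theorem RegAt.div {φ ψ : CoxSpace → ℂ} {c : CoxSpace} (hφ : RegAt φ c) (hψ : RegAt ψ c)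
    (h0 : ψ c ≠ 0) : RegAt (fun c => φ c / ψ c) c := by
  simpa only [div_eq_mul_inv] using hφ.mul (hψ.inv h0)

/-! ### Homogeneous coordinates on the blow-up -/

/-- Each monomial of multidegree `d` picks up the same factor. Quotients of forms of equal degree
therefore do not depend on the representatives chosen by `rep`. -/
theorem eval_smul_of_isWeightedHomogeneous {P : MvPolynomial (Fin 4 × Fin 3) ℂ} {d : Fin 4 → ℕ}
    (hP : MvPolynomial.IsWeightedHomogeneous multiWeight P d) (κ : Fin 4 → ℂ)
    (z : Fin 4 × Fin 3 → ℂ) :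
    eval (fun aj => κ aj.1 * z aj) P = (∏ a, κ a ^ d a) * eval z P := by
  rw [MvPolynomial.eval_eq, MvPolynomial.eval_eq, Finset.mul_sum]
  refine Finset.sum_congr rfl fun m hm => ?_
  have hd := hP (MvPolynomial.mem_support_iff.1 hm)
  have key : ∏ a, κ a ^ d a = ∏ i ∈ m.support, κ i.1 ^ m i := by
    rw [← hd]
    rw [Finsupp.weight_apply, Finsupp.sum]
    simp only [Finset.sum_apply, ← Finset.prod_pow_eq_pow_sum]
    rw [Finset.prod_comm]
    refine Finset.prod_congr rfl fun i _ => ?_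
    rw [Finset.prod_eq_single i.1]
    · simp [multiWeight]
    · intro a _ ha
      simp [multiWeight, Pi.single_eq_of_ne ha]
    · simp
  rw [key]
  simp only [mul_pow, Finset.prod_mul_distrib]
  ring

/-- The linear form with coefficients `α` on the `a`-th factor. -/
def linForm (p : Fin 3 → Plane) (a : Fin 4) (α : Fin 3 → ℂ) (b : BlowUp p) : ℂ :=
  α ⬝ᵥ (b.1 a).rep

theorem linForm_mem (p : Fin 3 → Plane) (a : Fin 4) (α : Fin 3 → ℂ) :
    linForm p a α ∈ blowUpForms p (Pi.single a 1) := by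
  refine ⟨∑ j, MvPolynomial.C (α j) * MvPolynomial.X (a, j), ?_, ?_⟩
  · exact MvPolynomial.IsWeightedHomogeneous.sum _ _ _ fun j _ =>
      (MvPolynomial.isWeightedHomogeneous_X ℂ multiWeight (a, j)).C_mul (α j)
  · funext b
    simp [linForm, dotProduct]

variable {p : Fin 3 → Plane}

/-- The determinant of the frame given by `p`. -/
def frameDet (p : Fin 3 → Plane) : ℂ :=
  (p 0).rep ⬝ᵥ crossProduct (p 1).rep (p 2).rep

theorem frameDet_ne_zero (hp : Projectivization.Independent p) : frameDet p ≠ 0 := by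
  have h := Projectivization.independent_iff.1 hp
  have h2 := (Matrix.linearIndependent_rows_iff_isUnit (A := Matrix.of fun i => (p i).rep)).1 h
  have h3 := ((Matrix.isUnit_iff_isUnit_det _).1 h2).ne_zero
  rw [Matrix.det_fin_three] at h3
  intro h0
  apply h3
  rw [← h0]
  simp [frameDet, dotProduct, crossProduct, Fin.sum_univ_three]
  ring

/-- The linear forms that vanish on two of the three points. -/
def coframe (p : Fin 3 → Plane) : Fin 3 → Fin 3 → ℂ :=
  ![crossProduct (p 1).rep (p 2).rep, crossProduct (p 2).rep (p 0).rep,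
    crossProduct (p 0).rep (p 1).rep]

theorem eq_zero_of_coframe (hp : Projectivization.Independent p) {z : Fin 3 → ℂ}
    (h : ∀ j, coframe p j ⬝ᵥ z = 0) : z = 0 := by
  -- Cramer's rule: the forms `coframe` are, up to the determinant, the basis dual to the frame.
  have key : frameDet p • z = (coframe p 0 ⬝ᵥ z) • (p 0).rep + (coframe p 1 ⬝ᵥ z) • (p 1).rep +
      (coframe p 2 ⬝ᵥ z) • (p 2).rep := by
    funext k
    fin_cases k <;>
      simp [coframe, frameDet, dotProduct, crossProduct, Fin.sum_univ_three] <;> ring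
  rw [h 0, h 1, h 2] at key
  simpa [frameDet_ne_zero hp] using key

theorem eq_zero_of_frame (hp : Projectivization.Independent p) {z : Fin 3 → ℂ}
    (h : ∀ j, (p j).rep ⬝ᵥ z = 0) : z = 0 := by
  have key : frameDet p • z = ((p 0).rep ⬝ᵥ z) • coframe p 0 + ((p 1).rep ⬝ᵥ z) • coframe p 1 +
      ((p 2).rep ⬝ᵥ z) • coframe p 2 := by
    funext k
    fin_cases k <;>
      simp [coframe, frameDet, dotProduct, crossProduct, Fin.sum_univ_three] <;> ring
  rw [h 0, h 1, h 2] at key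
  simpa [frameDet_ne_zero hp] using key

/-- Equality of points is the vanishing of the 2×2 minors, and these may be taken in any linear
forms without common zero. The scalar is the ratio at a form that does not vanish on `w`. -/
theorem mk_eq_mk_of_forms {α : Fin 3 → Fin 3 → ℂ} (hα : ∀ z, (∀ j, α j ⬝ᵥ z = 0) → z = 0)
    {v w : Fin 3 → ℂ} (hv : v ≠ 0) (hw : w ≠ 0)
    (h : ∀ i j, (α i ⬝ᵥ v) * (α j ⬝ᵥ w) = (α j ⬝ᵥ v) * (α i ⬝ᵥ w)) :
    Projectivization.mk ℂ v hv = Projectivization.mk ℂ w hw := by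
  rw [Projectivization.mk_eq_mk_iff']
  obtain ⟨i, hi⟩ : ∃ i, α i ⬝ᵥ w ≠ 0 := by
    by_contra! h0
    exact hw (hα w h0)
  refine ⟨(α i ⬝ᵥ v) / (α i ⬝ᵥ w), (sub_eq_zero.1 (hα _ fun j => ?_)).symm⟩
  rw [dotProduct_sub, dotProduct_smul, smul_eq_mul, div_mul_eq_mul_div, h i j]
  field_simp
  simp

/-- The coordinates of the point of the plane under `b`, in the frame given by `p`. -/
def ptForm (p : Fin 3 → Plane) (i : Fin 3) : BlowUp p → ℂ := linForm p 0 (coframe p i)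

/-- The first coordinates of the three lines of `b` in the pencils of lines through the `p i`. -/
def numForm (p : Fin 3 → Plane) : Fin 3 → BlowUp p → ℂ :=
  ![linForm p 1 (p 2).rep, linForm p 2 (-(p 2).rep), linForm p 3 (p 1).rep]

/-- The second coordinates of the three lines of `b` in the pencils of lines through the `p i`. -/
def denForm (p : Fin 3 → Plane) : Fin 3 → BlowUp p → ℂ :=
  ![linForm p 1 (-(p 1).rep), linForm p 2 (p 0).rep, linForm p 3 (-(p 0).rep)]

theorem ptForm_mem (i : Fin 3) : ptForm p i ∈ blowUpForms p (Pi.single 0 1) := linForm_mem _ _ _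

theorem numForm_mem (i : Fin 3) : numForm p i ∈ blowUpForms p (Pi.single i.succ 1) := by
  fin_cases i <;> exact linForm_mem _ _ _

theorem denForm_mem (i : Fin 3) : denForm p i ∈ blowUpForms p (Pi.single i.succ 1) := by
  fin_cases i <;> exact linForm_mem _ _ _

theorem orthogonal_rep {v w : Plane} (h : v.orthogonal w) : v.rep ⬝ᵥ w.rep = 0 := by
  rw [← Projectivization.mk_rep v, ← Projectivization.mk_rep w,
    Projectivization.orthogonal_mk] at h
  exact h

theorem frame_line (b : BlowUp p) (i : Fin 3) : (p i).rep ⬝ᵥ (b.1 i.succ).rep = 0 :=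
  orthogonal_rep (b.2 i).1

/-- Incidence of the point and the `i`-th line, with the point expanded in the frame; the
determinant is cleared. -/
theorem sum_ptForm_mul (b : BlowUp p) (i : Fin 3) :
    ptForm p 0 b * ((p 0).rep ⬝ᵥ (b.1 i.succ).rep) +
      ptForm p 1 b * ((p 1).rep ⬝ᵥ (b.1 i.succ).rep) +
      ptForm p 2 b * ((p 2).rep ⬝ᵥ (b.1 i.succ).rep) = 0 := by
  have h := orthogonal_rep (b.2 i).2
  have key : ptForm p 0 b * ((p 0).rep ⬝ᵥ (b.1 i.succ).rep) +
      ptForm p 1 b * ((p 1).rep ⬝ᵥ (b.1 i.succ).rep) +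
      ptForm p 2 b * ((p 2).rep ⬝ᵥ (b.1 i.succ).rep) =
      frameDet p * ((b.1 0).rep ⬝ᵥ (b.1 i.succ).rep) := by
    simp [ptForm, linForm, coframe, frameDet, dotProduct, crossProduct, Fin.sum_univ_three]
    ring
  rw [key, h, mul_zero]

/-- In the incidence relation one term drops out because the line passes through `p i`. What remains
are the equations of the blow-up in ℙ² × ℙ¹ × ℙ¹ × ℙ¹; the signs in `numForm` and `denForm` are
chosen to make them sign-free. -/
theorem ptForm_rel (b : BlowUp p) :
    ptForm p 1 b * denForm p 0 b = ptForm p 2 b * numForm p 0 b ∧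
    ptForm p 0 b * denForm p 1 b = ptForm p 2 b * numForm p 1 b ∧
    ptForm p 0 b * denForm p 2 b = ptForm p 1 b * numForm p 2 b := by
  have h0 := sum_ptForm_mul b 0
  have h1 := sum_ptForm_mul b 1
  have h2 := sum_ptForm_mul b 2
  rw [frame_line] at h0 h1 h2
  rw [show Fin.succ (0 : Fin 3) = 1 from rfl] at h0
  rw [show Fin.succ (1 : Fin 3) = 2 from rfl] at h1
  rw [show Fin.succ (2 : Fin 3) = 3 from rfl] at h2
  refine ⟨?_, ?_, ?_⟩
  · simp only [denForm, numForm, linForm, Matrix.cons_val_zero, neg_dotProduct]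
    linear_combination -h0
  · simp only [denForm, numForm, linForm, Matrix.cons_val_one, Matrix.cons_val_zero, neg_dotProduct]
    linear_combination h1
  · simp only [denForm, numForm, linForm, Matrix.cons_val, neg_dotProduct]
    linear_combination -h2

theorem ptForm_ne (hp : Projectivization.Independent p) (b : BlowUp p) :
    ∃ i, ptForm p i b ≠ 0 := by
  by_contra! h
  exact Projectivization.rep_nonzero _ (eq_zero_of_coframe hp (z := (b.1 0).rep) h)

theorem numForm_ne_or (hp : Projectivization.Independent p) (b : BlowUp p) (i : Fin 3) :
    numForm p i b ≠ 0 ∨ denForm p i b ≠ 0 := by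
  by_contra! h
  refine Projectivization.rep_nonzero _ (eq_zero_of_frame hp (z := (b.1 i.succ).rep) fun j => ?_)
  have h3 := frame_line b i
  fin_cases i <;>
    simp [numForm, denForm, linForm] at h <;> fin_cases j <;> simp_all

/-! ### The quotient map in coordinates -/

/-- Representatives of the components of `coxMap`. -/
def coxVec (p : Fin 3 → Plane) (c : CoxSpace) : Fin 4 → Fin 3 → ℂ :=
  ![coxPoint p c, coxLine p c 0, coxLine p c 1, coxLine p c 2]

/-- `rep` chooses an unspecified representative; the scalars `κ` measure its difference from the
explicit vectors. -/
theorem coxMap_rep (hp : Projectivization.Independent p) (c : CoxSpace) :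
    ∃ κ : Fin 4 → ℂ, (∀ a, κ a ≠ 0) ∧
      ∀ a, ((coxMap hp c).1 a).rep = κ a • coxVec p c a := by
  have h : ∀ a, ∃ k : ℂ, k ≠ 0 ∧ ((coxMap hp c).1 a).rep = k • coxVec p c a := by
    intro a
    refine Fin.cases ?_ (fun i => ?_) a
    · obtain ⟨k, hk⟩ := Projectivization.exists_smul_eq_mk_rep ℂ _ (coxPoint_ne hp c)
      exact ⟨k, k.ne_zero, hk.symm⟩
    · obtain ⟨k, hk⟩ := Projectivization.exists_smul_eq_mk_rep ℂ _ (coxLine_ne hp c i)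
      refine ⟨k, k.ne_zero, hk.symm.trans ?_⟩
      fin_cases i <;> rfl
  choose κ h1 h2 using h
  exact ⟨κ, h1, h2⟩

theorem coxVec_polynomial (p : Fin 3 → Plane) : ∃ P : Fin 4 × Fin 3 → MvPolynomial (Fin 6) ℂ,
    ∀ (c : CoxSpace) aj, eval c.1 (P aj) = coxVec p c aj.1 aj.2 := by
  let v : Fin 3 → Fin 3 → MvPolynomial (Fin 6) ℂ := fun i j => MvPolynomial.C ((p i).rep j)
  let x : Fin 6 → MvPolynomial (Fin 6) ℂ := MvPolynomial.X
  let P : Fin 4 → Fin 3 → MvPolynomial (Fin 6) ℂ :=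
    ![(x 0 * x 3 * x 5) • v 0 + (x 1 * x 4 * x 5) • v 1 + (x 2 * x 3 * x 4) • v 2,
      crossProduct (v 0) ((x 1 * x 5) • v 1 + (x 2 * x 3) • v 2),
      crossProduct (v 1) ((x 0 * x 5) • v 0 + (x 2 * x 4) • v 2),
      crossProduct (v 2) ((x 0 * x 3) • v 0 + (x 1 * x 4) • v 1)]
  refine ⟨fun aj => P aj.1 aj.2, fun c aj => ?_⟩
  obtain ⟨a, j⟩ := aj
  fin_cases a <;> fin_cases j <;>
    simp [P, v, x, coxVec, coxPoint, coxLine, crossProduct]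

/-- The pull-back of a form is a polynomial, up to a non-vanishing factor that depends only on the
degree. -/
theorem exists_scale (hp : Projectivization.Independent p) :
    ∃ m : CoxSpace → (Fin 4 → ℕ) → ℂ, (∀ c d, m c d ≠ 0) ∧
      ∀ d, ∀ H ∈ blowUpForms p d, ∃ P : MvPolynomial (Fin 6) ℂ, ∀ c,
        H (coxMap hp c) = m c d * eval c.1 P := by
  choose κ hκ hrep using coxMap_rep hp
  obtain ⟨Q, hQ⟩ := coxVec_polynomial p
  refine ⟨fun c d => ∏ a, κ c a ^ d a,
    fun c d => Finset.prod_ne_zero_iff.2 fun a _ => pow_ne_zero _ (hκ c a), ?_⟩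
  rintro d _ ⟨P, hP, rfl⟩
  refine ⟨MvPolynomial.bind₁ Q P, fun c => ?_⟩
  have h2 := eval_smul_of_isWeightedHomogeneous hP (κ c) (fun aj => coxVec p c aj.1 aj.2)
  have h3 : eval c.1 (MvPolynomial.bind₁ Q P) = eval (fun aj => coxVec p c aj.1 aj.2) P := by
    have := MvPolynomial.eval₂Hom_bind₁ (RingHom.id ℂ) c.1 Q P
    rw [MvPolynomial.eval, this]
    congr 2
    funext aj
    exact hQ c aj
  rw [h3, ← h2]
  simp only [LinearMap.pi_apply, AlgHom.toLinearMap_apply, hrep, Pi.smul_apply, smul_eq_mul]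
  rw [MvPolynomial.aeval_eq_eval]

/-- Continuity of the quotient map, phrased with basic open sets: the polynomial is the pull-back of
a form, up to a nowhere vanishing factor. -/
theorem exists_eval_of_mem_open (hp : Projectivization.Independent p) {O : Set (BlowUp p)}
    (hO : IsOpen O) {c : CoxSpace} (hc : coxMap hp c ∈ O) :
    ∃ K : MvPolynomial (Fin 6) ℂ, eval c.1 K ≠ 0 ∧
      ∀ c' : CoxSpace, eval c'.1 K ≠ 0 → coxMap hp c' ∈ O := by
  obtain ⟨m, hm, hP⟩ := exists_scale hp
  obtain ⟨d, G, hG, hGc, hGO⟩ := exists_form_of_mem_open (𝒜 := blowUpForms p) hO hc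
  obtain ⟨P, hP⟩ := hP d G hG
  refine ⟨P, right_ne_zero_of_mul ((hP c) ▸ hGc), fun c' hc' => hGO _ ?_⟩
  rw [hP]
  exact mul_ne_zero (hm _ _) hc'

/-- Regular functions on the blow-up pull back to regular functions. -/
theorem regAt_of_reg (hp : Projectivization.Independent p) {U : Opens (BlowUp p)} {f : U → ℂ}
    (hf : f ∈ Variety.reg U) {φ : CoxSpace → ℂ}
    (hφ : ∀ c (h : coxMap hp c ∈ U), f ⟨coxMap hp c, h⟩ = φ c) {c : CoxSpace}
    (hc : coxMap hp c ∈ U) : RegAt φ c := by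
  obtain ⟨m, hm, hP⟩ := exists_scale hp
  obtain ⟨d, F, hF, G, hG, e, H, hH, hHc, h⟩ := exists_forms_of_reg (𝒜 := blowUpForms p) hf hc
  obtain ⟨F', hF'⟩ := hP d F hF
  obtain ⟨G', hG'⟩ := hP d G hG
  obtain ⟨H', hH'⟩ := hP e H hH
  refine RegAt.congr (φ := fun c => eval c.1 F' / eval c.1 G')
    ⟨F', G', ?_, fun _ _ => rfl⟩ H' (right_ne_zero_of_mul ((hH' c) ▸ hHc)) fun c' hc' => ?_
  · exact right_ne_zero_of_mul ((hG' c) ▸ (h _ hHc).1)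
  · obtain ⟨h1, h2, h3⟩ := h (coxMap hp c') (by rw [hH']; exact mul_ne_zero (hm _ _) hc')
    rw [← hφ c' h2, h3, hF', hG', mul_div_mul_left _ _ (hm _ _)]

end

/-! ### The six affine charts and local sections of the quotient map -/

section

open MvPolynomial (eval)

variable {p : Fin 3 → Plane}

theorem cross_mul_comm {A B : Fin 3 → ℂ} (h01 : A 0 * B 1 = A 1 * B 0)
    (h02 : A 0 * B 2 = A 2 * B 0) (h12 : A 1 * B 2 = A 2 * B 1) (i j : Fin 3) :
    A i * B j = A j * B i := by
  fin_cases i <;> fin_cases j <;> first | rfl | assumption | exact Eq.symm (by assumption)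

theorem coframe_coxPoint (p : Fin 3 → Plane) (c : CoxSpace) :
    coframe p 0 ⬝ᵥ coxPoint p c = frameDet p * (c.1 0 * c.1 3 * c.1 5) ∧
    coframe p 1 ⬝ᵥ coxPoint p c = frameDet p * (c.1 1 * c.1 4 * c.1 5) ∧
    coframe p 2 ⬝ᵥ coxPoint p c = frameDet p * (c.1 2 * c.1 3 * c.1 4) := by
  refine ⟨?_, ?_, ?_⟩ <;>
  · simp [coframe, coxPoint, frameDet, dotProduct, crossProduct, Fin.sum_univ_three]
    ring

theorem frame_coxLine_zero (p : Fin 3 → Plane) (c : CoxSpace) :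
    (p 0).rep ⬝ᵥ coxLine p c 0 = 0 ∧
    (p 1).rep ⬝ᵥ coxLine p c 0 = -(frameDet p * (c.1 2 * c.1 3)) ∧
    (p 2).rep ⬝ᵥ coxLine p c 0 = frameDet p * (c.1 1 * c.1 5) := by
  refine ⟨?_, ?_, ?_⟩ <;>
  · simp [coxLine, frameDet, dotProduct, crossProduct, Fin.sum_univ_three]
    ring

theorem frame_coxLine_one (p : Fin 3 → Plane) (c : CoxSpace) :
    (p 0).rep ⬝ᵥ coxLine p c 1 = frameDet p * (c.1 2 * c.1 4) ∧
    (p 1).rep ⬝ᵥ coxLine p c 1 = 0 ∧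
    (p 2).rep ⬝ᵥ coxLine p c 1 = -(frameDet p * (c.1 0 * c.1 5)) := by
  refine ⟨?_, ?_, ?_⟩ <;>
  · simp [coxLine, frameDet, dotProduct, crossProduct, Fin.sum_univ_three]
    ring

theorem frame_coxLine_two (p : Fin 3 → Plane) (c : CoxSpace) :
    (p 0).rep ⬝ᵥ coxLine p c 2 = -(frameDet p * (c.1 1 * c.1 4)) ∧
    (p 1).rep ⬝ᵥ coxLine p c 2 = frameDet p * (c.1 0 * c.1 3) ∧
    (p 2).rep ⬝ᵥ coxLine p c 2 = 0 := by
  refine ⟨?_, ?_, ?_⟩ <;>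
  · simp [coxLine, frameDet, dotProduct, crossProduct, Fin.sum_univ_three]
    ring

/-- A point of `ℂ⁶ ∖ W` lies over `b` if its monomials are proportional to the coordinates of `b`. -/
theorem coxMap_eq_of_forms (hp : Projectivization.Independent p) {c : CoxSpace} {b : BlowUp p}
    (h01 : c.1 0 * c.1 3 * c.1 5 * ptForm p 1 b = c.1 1 * c.1 4 * c.1 5 * ptForm p 0 b)
    (h02 : c.1 0 * c.1 3 * c.1 5 * ptForm p 2 b = c.1 2 * c.1 3 * c.1 4 * ptForm p 0 b)
    (h12 : c.1 1 * c.1 4 * c.1 5 * ptForm p 2 b = c.1 2 * c.1 3 * c.1 4 * ptForm p 1 b)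
    (l0 : c.1 1 * c.1 5 * denForm p 0 b = c.1 2 * c.1 3 * numForm p 0 b)
    (l1 : c.1 0 * c.1 5 * denForm p 1 b = c.1 2 * c.1 4 * numForm p 1 b)
    (l2 : c.1 0 * c.1 3 * denForm p 2 b = c.1 1 * c.1 4 * numForm p 2 b) :
    coxMap hp c = b := by
  have e0 : Projectivization.mk ℂ (coxPoint p c) (coxPoint_ne hp c) = b.1 0 := by
    rw [← Projectivization.mk_rep (b.1 0)]
    simp only [ptForm, linForm] at h01 h02 h12
    refine mk_eq_mk_of_forms (fun z => eq_zero_of_coframe hp) _ _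
      (cross_mul_comm (A := fun i => coframe p i ⬝ᵥ coxPoint p c)
        (B := fun i => coframe p i ⬝ᵥ (b.1 0).rep) ?_ ?_ ?_) <;>
      simp only [coframe_coxPoint]
    · linear_combination frameDet p * h01
    · linear_combination frameDet p * h02
    · linear_combination frameDet p * h12
  have f0 := frame_line b 0
  have f1 := frame_line b 1
  have f2 := frame_line b 2
  have e1 : Projectivization.mk ℂ (coxLine p c 0) (coxLine_ne hp c 0) = b.1 1 := by
    rw [← Projectivization.mk_rep (b.1 1)]
    simp only [numForm, denForm, linForm, Matrix.cons_val, neg_dotProduct] at l0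
    rw [show Fin.succ (0 : Fin 3) = 1 from rfl] at f0
    refine mk_eq_mk_of_forms (fun z => eq_zero_of_frame hp) _ _
      (cross_mul_comm (A := fun i => (p i).rep ⬝ᵥ coxLine p c 0)
        (B := fun i => (p i).rep ⬝ᵥ (b.1 1).rep) ?_ ?_ ?_) <;>
      simp only [frame_coxLine_zero, f0]
    · ring
    · ring
    · linear_combination frameDet p * l0
  have e2 : Projectivization.mk ℂ (coxLine p c 1) (coxLine_ne hp c 1) = b.1 2 := by
    rw [← Projectivization.mk_rep (b.1 2)]
    simp only [numForm, denForm, linForm, Matrix.cons_val, neg_dotProduct] at l1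
    rw [show Fin.succ (1 : Fin 3) = 2 from rfl] at f1
    refine mk_eq_mk_of_forms (fun z => eq_zero_of_frame hp) _ _
      (cross_mul_comm (A := fun i => (p i).rep ⬝ᵥ coxLine p c 1)
        (B := fun i => (p i).rep ⬝ᵥ (b.1 2).rep) ?_ ?_ ?_) <;>
      simp only [frame_coxLine_one, f1]
    · ring
    · linear_combination frameDet p * l1
    · ring
  have e3 : Projectivization.mk ℂ (coxLine p c 2) (coxLine_ne hp c 2) = b.1 3 := by
    rw [← Projectivization.mk_rep (b.1 3)]
    simp only [numForm, denForm, linForm, Matrix.cons_val, neg_dotProduct] at l2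
    rw [show Fin.succ (2 : Fin 3) = 3 from rfl] at f2
    refine mk_eq_mk_of_forms (fun z => eq_zero_of_frame hp) _ _
      (cross_mul_comm (A := fun i => (p i).rep ⬝ᵥ coxLine p c 2)
        (B := fun i => (p i).rep ⬝ᵥ (b.1 3).rep) ?_ ?_ ?_) <;>
      simp only [frame_coxLine_two, f2]
    · linear_combination frameDet p * l2
    · ring
    · ring
  refine Subtype.ext (funext fun a => ?_)
  fin_cases a
  exacts [e0, e1, e2, e3]

/-- The defining condition of `CoxSpace`. -/
def IsCox (c : Fin 6 → ℂ) : Prop :=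
  ¬ (c 0 = 0 ∧ c 4 = 0) ∧ ¬ (c 1 = 0 ∧ c 3 = 0) ∧ ¬ (c 2 = 0 ∧ c 5 = 0) ∧
    ¬ (c 0 = 0 ∧ c 1 = 0) ∧ ¬ (c 1 = 0 ∧ c 2 = 0) ∧ ¬ (c 2 = 0 ∧ c 0 = 0) ∧
    ¬ (c 3 = 0 ∧ c 4 = 0) ∧ ¬ (c 5 = 0 ∧ c 4 = 0) ∧ ¬ (c 3 = 0 ∧ c 5 = 0)

/-- A chart is given by formulas `s` on the non-vanishing set of `G`. They are total functions, with
value 0 for division by 0; the Cox condition survives because in each chart only two coordinates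
differ from 1, and those two belong to curves that meet. -/
theorem exists_section_on (hp : Projectivization.Independent p) {d : Fin 4 → ℕ} {G : BlowUp p → ℂ}
    (hG : G ∈ blowUpForms p d) {b₀ : BlowUp p} (hb₀ : G b₀ ≠ 0) (s : BlowUp p → Fin 6 → ℂ)
    (hs : ∀ b, IsCox (s b))
    (hb : ∀ b, G b ≠ 0 →
      (s b 0 * s b 3 * s b 5 * ptForm p 1 b = s b 1 * s b 4 * s b 5 * ptForm p 0 b ∧
      s b 0 * s b 3 * s b 5 * ptForm p 2 b = s b 2 * s b 3 * s b 4 * ptForm p 0 b ∧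
      s b 1 * s b 4 * s b 5 * ptForm p 2 b = s b 2 * s b 3 * s b 4 * ptForm p 1 b) ∧
      s b 1 * s b 5 * denForm p 0 b = s b 2 * s b 3 * numForm p 0 b ∧
      s b 0 * s b 5 * denForm p 1 b = s b 2 * s b 4 * numForm p 1 b ∧
      s b 0 * s b 3 * denForm p 2 b = s b 1 * s b 4 * numForm p 2 b)
    (hreg : ∀ j, ∀ U : Opens (BlowUp p), (∀ b ∈ U, G b ≠ 0) →
      (fun b : U => s b j) ∈ Variety.reg U) :
    ∃ U : Opens (BlowUp p), b₀ ∈ U ∧ ∃ s : U → CoxSpace,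
      (∀ b, coxMap hp (s b) = b) ∧ ∀ j, (fun b => (s b).1 j) ∈ Variety.reg U := by
  refine ⟨⟨{b | G b ≠ 0}, isOpen_nonvanishing hG⟩, hb₀, fun b => ⟨s b, hs b⟩, fun b => ?_,
    fun j => hreg j _ fun b hb => hb⟩
  obtain ⟨⟨h1, h2, h3⟩, h4, h5, h6⟩ := hb b b.2
  exact coxMap_eq_of_forms hp h1 h2 h3 h4 h5 h6

theorem reg_one (U : Opens (BlowUp p)) : (fun _ : U => (1 : ℂ)) ∈ Variety.reg U := one_mem _

theorem reg_num_div_den {U : Opens (BlowUp p)} (i : Fin 3) (h : ∀ b ∈ U, denForm p i b ≠ 0) :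
    (fun b : U => numForm p i b / denForm p i b) ∈ Variety.reg U :=
  div_mem_reg (numForm_mem i) (denForm_mem i) h

theorem reg_den_div_num {U : Opens (BlowUp p)} (i : Fin 3) (h : ∀ b ∈ U, numForm p i b ≠ 0) :
    (fun b : U => denForm p i b / numForm p i b) ∈ Variety.reg U :=
  div_mem_reg (denForm_mem i) (numForm_mem i) h

/-- The non-vanishing of `Xsu` leaves the curves L₃, E₁, L₂, hence the two vertices L₃ ∩ E₁ and E₁ ∩
L₂ of the hexagon. Around a vertex the two Cox coordinates of its curves are affine coordinates,
read off from the pencils, and the other four are set to 1. -/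
theorem exists_section_of_ptForm_zero (hp : Projectivization.Independent p) {b₀ : BlowUp p}
    (hi : ptForm p 0 b₀ ≠ 0) :
    ∃ U : Opens (BlowUp p), b₀ ∈ U ∧ ∃ s : U → CoxSpace,
      (∀ b, coxMap hp (s b) = b) ∧ ∀ j, (fun b => (s b).1 j) ∈ Variety.reg U := by
  have rel := fun b : BlowUp p => ptForm_rel b
  have hl0 := fun b : BlowUp p => numForm_ne_or hp b 0
  have hl1 := fun b : BlowUp p => numForm_ne_or hp b 1
  have hl2 := fun b : BlowUp p => numForm_ne_or hp b 2
  have key : ∀ b, ptForm p 0 b ≠ 0 → numForm p 1 b ≠ 0 ∧ numForm p 2 b ≠ 0 := by grind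
  rcases hl0 b₀ with h | h
  · refine exists_section_on hp (SetLike.mul_mem_graded (ptForm_mem 0) (numForm_mem 0))
      (mul_ne_zero hi h) (fun b => ![1, 1, denForm p 0 b / numForm p 0 b, 1,
        denForm p 2 b / numForm p 2 b, 1]) (fun b => by simp [IsCox]) (fun b hb => ?_) ?_
    · simp only [Pi.mul_apply, mul_ne_zero_iff] at hb
      have := rel b; have := key b hb.1
      simp; grind
    · intro j U hU
      simp only [Pi.mul_apply, mul_ne_zero_iff] at hU
      fin_cases j <;> first
        | exact reg_one U
        | exact reg_den_div_num _ fun b hb => (hU b hb).2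
        | exact reg_den_div_num _ fun b hb => (key b (hU b hb).1).2
  · refine exists_section_on hp (SetLike.mul_mem_graded (ptForm_mem 0) (denForm_mem 0))
      (mul_ne_zero hi h) (fun b => ![1, numForm p 0 b / denForm p 0 b, 1, 1,
        denForm p 1 b / numForm p 1 b, 1]) (fun b => by simp [IsCox]) (fun b hb => ?_) ?_
    · simp only [Pi.mul_apply, mul_ne_zero_iff] at hb
      have := rel b; have := key b hb.1
      simp; grind
    · intro j U hU
      simp only [Pi.mul_apply, mul_ne_zero_iff] at hU
      fin_cases j <;> first
        | exact reg_one U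
        | exact reg_num_div_den _ fun b hb => (hU b hb).2
        | exact reg_den_div_num _ fun b hb => (key b (hU b hb).1).1

/-- The charts around L₃ ∩ E₂ and L₁ ∩ E₂, in the same way. -/
theorem exists_section_of_ptForm_one (hp : Projectivization.Independent p) {b₀ : BlowUp p}
    (hi : ptForm p 1 b₀ ≠ 0) :
    ∃ U : Opens (BlowUp p), b₀ ∈ U ∧ ∃ s : U → CoxSpace,
      (∀ b, coxMap hp (s b) = b) ∧ ∀ j, (fun b => (s b).1 j) ∈ Variety.reg U := by
  have rel := fun b : BlowUp p => ptForm_rel b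
  have hl0 := fun b : BlowUp p => numForm_ne_or hp b 0
  have hl1 := fun b : BlowUp p => numForm_ne_or hp b 1
  have hl2 := fun b : BlowUp p => numForm_ne_or hp b 2
  have key : ∀ b, ptForm p 1 b ≠ 0 → numForm p 0 b ≠ 0 ∧ denForm p 2 b ≠ 0 := by grind
  rcases hl1 b₀ with h | h
  · refine exists_section_on hp (SetLike.mul_mem_graded (ptForm_mem 1) (numForm_mem 1))
      (mul_ne_zero hi h) (fun b => ![1, 1, denForm p 1 b / numForm p 1 b,
        numForm p 2 b / denForm p 2 b, 1, 1]) (fun b => by simp [IsCox]) (fun b hb => ?_) ?_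
    · simp only [Pi.mul_apply, mul_ne_zero_iff] at hb
      have := rel b; have := key b hb.1
      simp; grind
    · intro j U hU
      simp only [Pi.mul_apply, mul_ne_zero_iff] at hU
      fin_cases j <;> first
        | exact reg_one U
        | exact reg_den_div_num _ fun b hb => (hU b hb).2
        | exact reg_num_div_den _ fun b hb => (key b (hU b hb).1).2
  · refine exists_section_on hp (SetLike.mul_mem_graded (ptForm_mem 1) (denForm_mem 1))
      (mul_ne_zero hi h) (fun b => ![numForm p 1 b / denForm p 1 b, 1, 1,
        denForm p 0 b / numForm p 0 b, 1, 1]) (fun b => by simp [IsCox]) (fun b hb => ?_) ?_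
    · simp only [Pi.mul_apply, mul_ne_zero_iff] at hb
      have := rel b; have := key b hb.1
      simp; grind
    · intro j U hU
      simp only [Pi.mul_apply, mul_ne_zero_iff] at hU
      fin_cases j <;> first
        | exact reg_one U
        | exact reg_num_div_den _ fun b hb => (hU b hb).2
        | exact reg_den_div_num _ fun b hb => (key b (hU b hb).1).1

/-- The charts around L₂ ∩ E₃ and L₁ ∩ E₃, in the same way. -/
theorem exists_section_of_ptForm_two (hp : Projectivization.Independent p) {b₀ : BlowUp p}
    (hi : ptForm p 2 b₀ ≠ 0) :
    ∃ U : Opens (BlowUp p), b₀ ∈ U ∧ ∃ s : U → CoxSpace,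
      (∀ b, coxMap hp (s b) = b) ∧ ∀ j, (fun b => (s b).1 j) ∈ Variety.reg U := by
  have rel := fun b : BlowUp p => ptForm_rel b
  have hl0 := fun b : BlowUp p => numForm_ne_or hp b 0
  have hl1 := fun b : BlowUp p => numForm_ne_or hp b 1
  have hl2 := fun b : BlowUp p => numForm_ne_or hp b 2
  have key : ∀ b, ptForm p 2 b ≠ 0 → denForm p 0 b ≠ 0 ∧ denForm p 1 b ≠ 0 := by grind
  rcases hl2 b₀ with h | h
  · refine exists_section_on hp (SetLike.mul_mem_graded (ptForm_mem 2) (numForm_mem 2))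
      (mul_ne_zero hi h) (fun b => ![1, denForm p 2 b / numForm p 2 b, 1, 1, 1,
        numForm p 1 b / denForm p 1 b]) (fun b => by simp [IsCox]) (fun b hb => ?_) ?_
    · simp only [Pi.mul_apply, mul_ne_zero_iff] at hb
      have := rel b; have := key b hb.1
      simp; grind
    · intro j U hU
      simp only [Pi.mul_apply, mul_ne_zero_iff] at hU
      fin_cases j <;> first
        | exact reg_one U
        | exact reg_den_div_num _ fun b hb => (hU b hb).2
        | exact reg_num_div_den _ fun b hb => (key b (hU b hb).1).2
  · refine exists_section_on hp (SetLike.mul_mem_graded (ptForm_mem 2) (denForm_mem 2))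
      (mul_ne_zero hi h) (fun b => ![numForm p 2 b / denForm p 2 b, 1, 1, 1, 1,
        numForm p 0 b / denForm p 0 b]) (fun b => by simp [IsCox]) (fun b hb => ?_) ?_
    · simp only [Pi.mul_apply, mul_ne_zero_iff] at hb
      have := rel b; have := key b hb.1
      simp; grind
    · intro j U hU
      simp only [Pi.mul_apply, mul_ne_zero_iff] at hU
      fin_cases j <;> first
        | exact reg_one U
        | exact reg_num_div_den _ fun b hb => (hU b hb).2
        | exact reg_num_div_den _ fun b hb => (key b (hU b hb).1).1

/-- The quotient map `ℂ⁶ ∖ W → B₃` has local sections. -/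
theorem exists_local_section (hp : Projectivization.Independent p) (b₀ : BlowUp p) :
    ∃ U : Opens (BlowUp p), b₀ ∈ U ∧ ∃ s : U → CoxSpace,
      (∀ b, coxMap hp (s b) = b) ∧ ∀ j, (fun b => (s b).1 j) ∈ Variety.reg U := by
  obtain ⟨i, hi⟩ := ptForm_ne hp b₀
  fin_cases i
  exacts [exists_section_of_ptForm_zero hp hi, exists_section_of_ptForm_one hp hi,
    exists_section_of_ptForm_two hp hi]

/-! ### Descent of topology and regularity along the quotient map -/

theorem coxMap_surjective (hp : Projectivization.Independent p) :
    Function.Surjective (coxMap hp) := fun b => by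
  obtain ⟨U, hb, s, hs, _⟩ := exists_local_section hp b
  exact ⟨s ⟨b, hb⟩, hs _⟩

theorem eval_section_mem_reg {U : Opens (BlowUp p)} {s : U → CoxSpace}
    (hs : ∀ j, (fun b => (s b).1 j) ∈ Variety.reg U) (F : MvPolynomial (Fin 6) ℂ) :
    (fun b => eval (s b).1 F) ∈ Variety.reg U := by
  induction F using MvPolynomial.induction_on with
  | C a =>
    simp only [MvPolynomial.eval_C]
    exact Subalgebra.algebraMap_mem (Variety.reg U) a
  | add F G hF hG =>
    simp only [map_add]
    exact add_mem hF hG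
  | mul_X F j hF =>
    simp only [map_mul, MvPolynomial.eval_X]
    exact mul_mem hF (hs j)

/-- The blow-up carries the quotient topology. -/
theorem isOpen_of_eval (hp : Projectivization.Independent p) {O : Set (BlowUp p)}
    (h : ∀ c, coxMap hp c ∈ O → ∃ K : MvPolynomial (Fin 6) ℂ, eval c.1 K ≠ 0 ∧
      ∀ c' : CoxSpace, eval c'.1 K ≠ 0 → coxMap hp c' ∈ O) : IsOpen O := by
  refine isOpen_iff_forall_mem_open.2 fun b hb => ?_
  obtain ⟨U, hbU, s, hs, hreg⟩ := exists_local_section hp b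
  obtain ⟨K, hK, hKO⟩ := h (s ⟨b, hbU⟩) (by rw [hs]; exact hb)
  refine ⟨_, ?_, isOpen_ne_zero_of_reg (𝒜 := blowUpForms p) (eval_section_mem_reg hreg K),
    ⟨hbU, hK⟩⟩
  rintro b' ⟨hb', hKb'⟩
  have := hKO _ hKb'
  rwa [hs] at this

/-- A function on the blow-up is regular if its pull-back is. -/
theorem reg_of_regAt (hp : Projectivization.Independent p) {U : Opens (BlowUp p)} {f : U → ℂ}
    {φ : CoxSpace → ℂ} (hφ : ∀ c (h : coxMap hp c ∈ U), f ⟨coxMap hp c, h⟩ = φ c)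
    (h : ∀ c, coxMap hp c ∈ U → RegAt φ c) : f ∈ Variety.reg U := by
  refine Variety.glue fun b => ?_
  obtain ⟨U', hbU, s, hs, hreg⟩ := exists_local_section hp (b : BlowUp p)
  obtain ⟨F, G, hG, hFG⟩ := h (s ⟨b, hbU⟩) (by rw [hs]; exact b.2)
  have hF := eval_section_mem_reg hreg F
  have hG' := eval_section_mem_reg hreg G
  let V : Opens (BlowUp p) := ⟨_, isOpen_ne_zero_of_reg (𝒜 := blowUpForms p) hG'⟩
  have hVU' : V ⊓ U ≤ U' := fun b' hb' => hb'.1.choose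
  refine ⟨V ⊓ U, inf_le_right, ⟨⟨hbU, hG⟩, b.2⟩, ?_⟩
  have h1 := Variety.res hVU' hF
  have h2 := inv_mem_reg (𝒜 := blowUpForms p) (Variety.res hVU' hG') fun b' =>
    (b'.2.1 : ∃ h : (b' : BlowUp p) ∈ U', _).choose_spec
  convert mul_mem h1 h2 using 1
  funext b'
  have hb' := hVU' b'.2
  have h3 := hφ (s ⟨b', hb'⟩) (by rw [hs]; exact b'.2.2)
  have h4 := hFG (s ⟨b', hb'⟩) (b'.2.1 : ∃ h : (b' : BlowUp p) ∈ U', _).choose_spec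
  rw [h4] at h3
  simp only [Pi.mul_apply, Pi.inv_apply, ← div_eq_mul_inv]
  rw [← h3]
  congr 1
  exact Subtype.ext (hs ⟨b', hb'⟩).symm

end

section

open MvPolynomial (eval)

/-! ### Polynomials on `ℂ⁶ ∖ W` -/

/-- W has codimension two: leaving `CoxSpace` takes two vanishing coordinates. -/
theorem isCox_of_ne_zero {k : Fin 6} {c : Fin 6 → ℂ} (h : ∀ j, j ≠ k → c j ≠ 0) : IsCox c := by
  have h' : ∀ i j, i ≠ j → ¬ (c i = 0 ∧ c j = 0) := by
    rintro i j hij ⟨hi, hj⟩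
    by_cases hik : i = k
    · exact h j (fun hjk => hij (hik.trans hjk.symm)) hj
    · exact h i hik hi
  refine ⟨?_, ?_, ?_, ?_, ?_, ?_, ?_, ?_, ?_⟩ <;> exact h' _ _ (by decide)

/-- Otherwise the product of `F` with all six variables would vanish identically. -/
theorem exists_eval_ne_zero {F : MvPolynomial (Fin 6) ℂ} (hF : F ≠ 0) :
    ∃ c : Fin 6 → ℂ, (∀ j, c j ≠ 0) ∧ eval c F ≠ 0 := by
  by_contra! h
  have h0 : F * ∏ j, MvPolynomial.X j = 0 := by
    refine MvPolynomial.funext fun c => ?_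
    simp only [map_mul, map_prod, MvPolynomial.eval_X, map_zero]
    by_cases hc : ∀ j, c j ≠ 0
    · rw [h c hc, zero_mul]
    · push Not at hc
      obtain ⟨j, hj⟩ := hc
      rw [Finset.prod_eq_zero (Finset.mem_univ j) hj, mul_zero]
  rcases mul_eq_zero.1 h0 with h1 | h1
  · exact hF h1
  · obtain ⟨j, _, hj⟩ := Finset.prod_eq_zero_iff.1 h1
    exact MvPolynomial.X_ne_zero j hj

theorem eq_zero_of_eval_eq_zero {F K : MvPolynomial (Fin 6) ℂ} (hK : K ≠ 0)
    (h : ∀ c : CoxSpace, eval c.1 K ≠ 0 → eval c.1 F = 0) : F = 0 := by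
  by_contra hF
  obtain ⟨c, hc, hFK⟩ := exists_eval_ne_zero (mul_ne_zero hF hK)
  rw [map_mul] at hFK
  exact left_ne_zero_of_mul hFK
    (h ⟨c, isCox_of_ne_zero (k := 0) fun j _ => hc j⟩ (right_ne_zero_of_mul hFK))

/-- The restriction of a polynomial to the hyperplane where the `k`-th coordinate vanishes. -/
def restrictZero (k : Fin 6) : MvPolynomial (Fin 6) ℂ →ₐ[ℂ] MvPolynomial (Fin 6) ℂ :=
  MvPolynomial.bind₁ (Function.update MvPolynomial.X k 0)

theorem eval_restrictZero (k : Fin 6) (F : MvPolynomial (Fin 6) ℂ) (c : Fin 6 → ℂ) :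
    eval c (restrictZero k F) = eval (Function.update c k 0) F := by
  rw [restrictZero, MvPolynomial.eval,
    MvPolynomial.eval₂Hom_bind₁ (RingHom.id ℂ) c (Function.update MvPolynomial.X k 0) F]
  congr 2
  funext j
  by_cases hj : j = k
  · subst hj
    simp
  · simp [hj]

/-- Modulo the `k`-th variable, `restrictZero k` is the identity on the generators. -/
theorem X_dvd_sub_restrictZero (k : Fin 6) (F : MvPolynomial (Fin 6) ℂ) :
    MvPolynomial.X k ∣ F - restrictZero k F := by
  rw [← Ideal.mem_span_singleton, ← Ideal.Quotient.eq]
  have h : Ideal.Quotient.mkₐ ℂ (Ideal.span {MvPolynomial.X k}) =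
      (Ideal.Quotient.mkₐ ℂ (Ideal.span {MvPolynomial.X k})).comp (restrictZero k) := by
    refine MvPolynomial.algHom_ext fun j => ?_
    by_cases hj : j = k
    · subst hj
      simp [restrictZero]
    · simp [restrictZero, hj]
  exact DFunLike.congr_fun h F

theorem exists_cox_eval_ne_zero {k : Fin 6} {K : MvPolynomial (Fin 6) ℂ}
    (hK : restrictZero k K ≠ 0) :
    ∃ c : CoxSpace, c.1 k = 0 ∧ (∀ j, j ≠ k → c.1 j ≠ 0) ∧ eval c.1 K ≠ 0 := by
  obtain ⟨c, hc, hKc⟩ := exists_eval_ne_zero hK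
  rw [eval_restrictZero] at hKc
  have h : ∀ j, j ≠ k → Function.update c k 0 j ≠ 0 := fun j hj => by
    rw [Function.update_of_ne hj]
    exact hc j
  exact ⟨⟨Function.update c k 0, isCox_of_ne_zero h⟩, Function.update_self _ _ _, h, hKc⟩

theorem restrictZero_ne_zero {k : Fin 6} {K : MvPolynomial (Fin 6) ℂ} {c : Fin 6 → ℂ}
    (hc : c k = 0) (hK : eval c K ≠ 0) : restrictZero k K ≠ 0 := by
  intro h
  apply hK
  have := eval_restrictZero k K c
  rwa [h, map_zero, Function.update_eq_self_iff.2 hc.symm, eq_comm] at this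

/-- The point `c` shows that `K ≠ 0` meets the hyperplane, so it is dense there. Hence `F` restricts
to zero on the hyperplane. -/
theorem X_dvd_of_eval_eq_zero {k : Fin 6} {F K : MvPolynomial (Fin 6) ℂ} {c : Fin 6 → ℂ}
    (hc : c k = 0) (hK : eval c K ≠ 0)
    (h : ∀ c : CoxSpace, c.1 k = 0 → eval c.1 K ≠ 0 → eval c.1 F = 0) :
    MvPolynomial.X k ∣ F := by
  have h0 : restrictZero k F = 0 := by
    by_contra hF
    have h1 : restrictZero k (F * K) ≠ 0 := by
      rw [map_mul]
      exact mul_ne_zero hF (restrictZero_ne_zero hc hK)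
    obtain ⟨c', hc', _, hFK⟩ := exists_cox_eval_ne_zero h1
    rw [map_mul] at hFK
    exact left_ne_zero_of_mul hFK (h c' hc' (right_ne_zero_of_mul hFK))
  simpa [h0] using X_dvd_sub_restrictZero k F

/-! ### The torus of the quotient map -/

/-- The torus of Picard rank four that acts on the fibres of the quotient map. -/
structure IsTorus (μ : Fin 6 → ℂ) : Prop where
  ne_zero : ∀ k, μ k ≠ 0
  xu : μ 0 * μ 5 = μ 2 * μ 4
  uy : μ 1 * μ 5 = μ 2 * μ 3
  xs : μ 0 * μ 3 = μ 1 * μ 4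

/-- The action of the torus on `ℂ⁶ ∖ W`. -/
def torusAct {μ : Fin 6 → ℂ} (hμ : IsTorus μ) (c : CoxSpace) : CoxSpace :=
  ⟨fun k => μ k * c.1 k, by
    have h : ∀ k, μ k * c.1 k = 0 ↔ c.1 k = 0 := fun k => by simp [hμ.ne_zero k]
    simp only [h]
    exact c.2⟩

variable {p : Fin 3 → Plane} (hp : Projectivization.Independent p)

theorem forms_coxMap (c : CoxSpace) : ∃ κ : Fin 4 → ℂ, (∀ a, κ a ≠ 0) ∧
    (ptForm p 0 (coxMap hp c) = κ 0 * (c.1 0 * c.1 3 * c.1 5) ∧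
    ptForm p 1 (coxMap hp c) = κ 0 * (c.1 1 * c.1 4 * c.1 5) ∧
    ptForm p 2 (coxMap hp c) = κ 0 * (c.1 2 * c.1 3 * c.1 4)) ∧
    (numForm p 0 (coxMap hp c) = κ 1 * (c.1 1 * c.1 5) ∧
    denForm p 0 (coxMap hp c) = κ 1 * (c.1 2 * c.1 3)) ∧
    (numForm p 1 (coxMap hp c) = κ 2 * (c.1 0 * c.1 5) ∧
    denForm p 1 (coxMap hp c) = κ 2 * (c.1 2 * c.1 4)) ∧
    (numForm p 2 (coxMap hp c) = κ 3 * (c.1 0 * c.1 3) ∧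
    denForm p 2 (coxMap hp c) = κ 3 * (c.1 1 * c.1 4)) := by
  obtain ⟨κ, hκ, h⟩ := coxMap_rep hp c
  obtain ⟨a0, a1, a2⟩ := coframe_coxPoint p c
  obtain ⟨b0, b1, b2⟩ := frame_coxLine_zero p c
  obtain ⟨c0, c1, c2⟩ := frame_coxLine_one p c
  obtain ⟨d0, d1, d2⟩ := frame_coxLine_two p c
  refine ⟨fun a => κ a * frameDet p, fun a => mul_ne_zero (hκ a) (frameDet_ne_zero hp), ?_⟩
  simp only [ptForm, numForm, denForm, linForm, Matrix.cons_val, h, coxVec, dotProduct_smul,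
    neg_dotProduct, smul_eq_mul, a0, a1, a2, b1, b2, c0, c2, d0, d1]
  refine ⟨⟨?_, ?_, ?_⟩, ⟨?_, ?_⟩, ⟨?_, ?_⟩, ?_, ?_⟩ <;> ring

/-- The relations in `IsTorus` say that the two monomials of each pencil have the same weight; the
equality of the weights of `Xsu`, `Ytu`, `Zst` follows. -/
theorem coxMap_torusAct {μ : Fin 6 → ℂ} (hμ : IsTorus μ) (c : CoxSpace) :
    coxMap hp (torusAct hμ c) = coxMap hp c := by
  obtain ⟨κ, hκ, ⟨h0, h1, h2⟩, ⟨h3, h4⟩, ⟨h5, h6⟩, h7, h8⟩ := forms_coxMap hp c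
  obtain ⟨hne, hxu, huy, hxs⟩ := hμ
  apply coxMap_eq_of_forms <;> simp only [torusAct, h0, h1, h2, h3, h4, h5, h6, h7, h8] <;> grind

theorem cross_of_coxMap_eq {c c' : CoxSpace} (h : coxMap hp c = coxMap hp c') :
    (c.1 1 * c.1 5) * (c'.1 2 * c'.1 3) = (c.1 2 * c.1 3) * (c'.1 1 * c'.1 5) ∧
    (c.1 0 * c.1 5) * (c'.1 2 * c'.1 4) = (c.1 2 * c.1 4) * (c'.1 0 * c'.1 5) ∧
    (c.1 0 * c.1 3) * (c'.1 1 * c'.1 4) = (c.1 1 * c.1 4) * (c'.1 0 * c'.1 3) := by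
  obtain ⟨κ, hκ, -, ⟨h3, h4⟩, ⟨h5, h6⟩, h7, h8⟩ := forms_coxMap hp c
  obtain ⟨κ', hκ', -, ⟨h3', h4'⟩, ⟨h5', h6'⟩, h7', h8'⟩ := forms_coxMap hp c'
  rw [h] at h3 h4 h5 h6 h7 h8
  have e : ∀ {k k' n d n' d' N E : ℂ}, k ≠ 0 → k' ≠ 0 → N = k * n → E = k * d → N = k' * n' →
      E = k' * d' → n * d' = d * n' := by
    intro k k' n d n' d' N E hk hk' h1 h2 h3 h4
    refine mul_left_cancel₀ (mul_ne_zero hk hk') ?_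
    calc _ = (k * n) * (k' * d') := by ring
      _ = (k * d) * (k' * n') := by rw [← h1, ← h4, ← h2, ← h3]; ring
      _ = _ := by ring
  exact ⟨e (hκ 1) (hκ' 1) h3 h4 h3' h4', e (hκ 2) (hκ' 2) h5 h6 h5' h6',
    e (hκ 3) (hκ' 3) h7 h8 h7' h8'⟩

/-- For instance, X = 0 makes Y, Z, t non-zero, so the cross relations give X'u' = X's' = 0 at the
other point; since s' and u' are not both zero, X' = 0. -/
theorem eq_zero_of_coxMap_eq {c c' : CoxSpace} (h : coxMap hp c = coxMap hp c') (k : Fin 6)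
    (hk : c.1 k = 0) : c'.1 k = 0 := by
  obtain ⟨h1, h2, h3⟩ := cross_of_coxMap_eq hp h
  obtain ⟨c, hc⟩ := c
  obtain ⟨c', hc'⟩ := c'
  simp only at *
  clear h
  fin_cases k <;> simp only [Fin.reduceFinMk, Fin.zero_eta, Fin.mk_one] at hk ⊢ <;>
    simp only [hk, true_and, zero_mul, mul_zero, zero_eq_mul, mul_eq_zero] at * <;> grind

theorem eq_zero_iff_of_coxMap_eq {c c' : CoxSpace} (h : coxMap hp c = coxMap hp c') (k : Fin 6) :
    c.1 k = 0 ↔ c'.1 k = 0 :=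
  ⟨eq_zero_of_coxMap_eq hp h k, eq_zero_of_coxMap_eq hp h.symm k⟩

end

section

open MvPolynomial (eval)

variable {p : Fin 3 → Plane} (hp : Projectivization.Independent p)

/-! ### The automorphism -/

/-- `X ↦ u ↦ Y ↦ t ↦ Z ↦ s ↦ X` on the indices of the coordinates. -/
def shiftPerm : Equiv.Perm (Fin 6) where
  toFun := ![5, 4, 3, 0, 2, 1]
  invFun := ![3, 5, 4, 2, 1, 0]
  left_inv := by decide
  right_inv := by decide

theorem coxShift_apply (c : CoxSpace) (k : Fin 6) : (coxShift c).1 k = c.1 (shiftPerm k) := by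
  fin_cases k <;> rfl

theorem coxShift_iterate_apply (n : ℕ) (c : CoxSpace) (k : Fin 6) :
    (coxShift^[n] c).1 k = c.1 ((shiftPerm ^ n) k) := by
  induction n generalizing c k with
  | zero => rfl
  | succ n ih =>
    rw [Function.iterate_succ_apply, ih, coxShift_apply, pow_succ', Equiv.Perm.mul_apply]

theorem coxShift_iterate_six (c : CoxSpace) : coxShift^[6] c = c := by
  refine Subtype.ext (funext fun k => ?_)
  rw [coxShift_iterate_apply, show shiftPerm ^ 6 = 1 by decide, Equiv.Perm.one_apply]

theorem eval_coxShift_iterate (n : ℕ) (c : CoxSpace) (F : MvPolynomial (Fin 6) ℂ) :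
    eval (coxShift^[n] c).1 F = eval c.1 (MvPolynomial.rename (shiftPerm ^ n) F) := by
  rw [MvPolynomial.eval_rename]
  congr 1
  congr 1
  funext k
  exact coxShift_iterate_apply n c k

/-- The rotation permutes the three defining relations, so `coxShift` normalises the torus. -/
theorem IsTorus.shift {μ : Fin 6 → ℂ} (hμ : IsTorus μ) (n : ℕ) :
    IsTorus (μ ∘ (shiftPerm ^ n : Equiv.Perm (Fin 6))) := by
  induction n with
  | zero => exact hμ
  | succ n ih =>
    rw [pow_succ, Equiv.Perm.coe_mul, ← Function.comp_assoc]
    obtain ⟨h0, h1, h2, h3⟩ := ih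
    generalize μ ∘ (shiftPerm ^ n : Equiv.Perm (Fin 6)) = ν at h0 h1 h2 h3
    refine ⟨fun k => h0 _, ?_, ?_, ?_⟩
    · change ν 5 * ν 1 = ν 3 * ν 2
      linear_combination h2
    · change ν 4 * ν 1 = ν 3 * ν 0
      linear_combination -h3
    · change ν 5 * ν 0 = ν 4 * ν 2
      linear_combination h1

/-- Two proportional points are related by an element of the torus, if four coordinates do not
vanish. -/
theorem exists_torus_of_cross {c c' : Fin 6 → ℂ}
    (h1 : (c 1 * c 5) * (c' 2 * c' 3) = (c 2 * c 3) * (c' 1 * c' 5))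
    (h3 : (c 0 * c 3) * (c' 1 * c' 4) = (c 1 * c 4) * (c' 0 * c' 3))
    (hz : ∀ k, c k = 0 ↔ c' k = 0) (y : c 1 ≠ 0) (z : c 2 ≠ 0) (s : c 3 ≠ 0) (t : c 4 ≠ 0) :
    ∃ μ : Fin 6 → ℂ, IsTorus μ ∧ ∀ k, c' k = μ k * c k := by
  have y' := mt (hz 1).2 y
  have z' := mt (hz 2).2 z
  have s' := mt (hz 3).2 s
  have t' := mt (hz 4).2 t
  -- The entries 1 to 4 are the forced ratios. The coordinates X and u may vanish, so their weights
  -- are solved from the relations `xs` and `uy`.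
  refine ⟨![c' 1 / c 1 * (c' 4 / c 4) / (c' 3 / c 3), c' 1 / c 1, c' 2 / c 2, c' 3 / c 3,
    c' 4 / c 4, c' 2 / c 2 * (c' 3 / c 3) / (c' 1 / c 1)], ⟨fun k => ?_, ?_, ?_, ?_⟩, fun k => ?_⟩
  · fin_cases k <;> simp [y, z, s, t, y', z', s', t']
  · simp only [Matrix.cons_val]; field_simp
  · simp only [Matrix.cons_val]; field_simp
  · simp only [Matrix.cons_val]; field_simp
  · fin_cases k <;> simp only [Matrix.cons_val, Fin.reduceFinMk, Fin.zero_eta, Fin.mk_one] <;>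
      field_simp
    · linear_combination -h3
    · linear_combination -h1

/-- Rotation carries the three cross relations to one another, which reduces each of the six
adjacent pairs of possibly vanishing coordinates to the pair X, u. -/
theorem exists_torus_of_cross_shift (n : ℕ) {c c' : Fin 6 → ℂ}
    (h1 : (c 1 * c 5) * (c' 2 * c' 3) = (c 2 * c 3) * (c' 1 * c' 5))
    (h2 : (c 0 * c 5) * (c' 2 * c' 4) = (c 2 * c 4) * (c' 0 * c' 5))
    (h3 : (c 0 * c 3) * (c' 1 * c' 4) = (c 1 * c 4) * (c' 0 * c' 3))
    (hz : ∀ k, c k = 0 ↔ c' k = 0) (y : c (shiftPerm^[n] 1) ≠ 0) (z : c (shiftPerm^[n] 2) ≠ 0)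
    (s : c (shiftPerm^[n] 3) ≠ 0) (t : c (shiftPerm^[n] 4) ≠ 0) :
    ∃ μ : Fin 6 → ℂ, IsTorus μ ∧ ∀ k, c' k = μ k * c k := by
  induction n generalizing c c' with
  | zero => exact exists_torus_of_cross h1 h3 hz y z s t
  | succ n ih =>
    rw [Function.iterate_succ_apply'] at y z s t
    obtain ⟨μ, hμ, H⟩ := ih (c := c ∘ shiftPerm) (c' := c' ∘ shiftPerm)
      (by change (c 4 * c 1) * (c' 3 * c' 0) = (c 3 * c 0) * (c' 4 * c' 1)
          linear_combination -h3)
      (by change (c 5 * c 1) * (c' 3 * c' 2) = (c 3 * c 2) * (c' 5 * c' 1)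
          linear_combination h1)
      (by change (c 5 * c 0) * (c' 4 * c' 2) = (c 4 * c 2) * (c' 5 * c' 0)
          linear_combination h2) (fun k => hz _) y z s t
    -- The fifth power of the rotation is its inverse, which undoes the relabelling.
    refine ⟨_, hμ.shift 5, fun k => ?_⟩
    have hk : shiftPerm ((shiftPerm ^ 5) k) = k := by revert k; decide
    have := H ((shiftPerm ^ 5) k)
    simp only [Function.comp, hk] at this
    exact this

/-- The coordinates that vanish are among those of two adjacent sides of the hexagon; the cases list
the complements of the six adjacent pairs. -/
theorem IsCox.exists_four_ne_zero {c : Fin 6 → ℂ} (hc : IsCox c) :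
    (c 1 ≠ 0 ∧ c 2 ≠ 0 ∧ c 3 ≠ 0 ∧ c 4 ≠ 0) ∨ (c 0 ≠ 0 ∧ c 2 ≠ 0 ∧ c 3 ≠ 0 ∧ c 4 ≠ 0) ∨
      (c 0 ≠ 0 ∧ c 2 ≠ 0 ∧ c 3 ≠ 0 ∧ c 5 ≠ 0) ∨ (c 0 ≠ 0 ∧ c 1 ≠ 0 ∧ c 3 ≠ 0 ∧ c 5 ≠ 0) ∨
      (c 0 ≠ 0 ∧ c 1 ≠ 0 ∧ c 4 ≠ 0 ∧ c 5 ≠ 0) ∨ (c 1 ≠ 0 ∧ c 2 ≠ 0 ∧ c 4 ≠ 0 ∧ c 5 ≠ 0) := by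
  unfold IsCox at hc
  grind

/-- The fibres of the quotient map are the orbits of the torus. -/
theorem exists_torus_of_coxMap_eq {c c' : CoxSpace} (h : coxMap hp c = coxMap hp c') :
    ∃ (μ : Fin 6 → ℂ) (hμ : IsTorus μ), c' = torusAct hμ c := by
  obtain ⟨h1, h2, h3⟩ := cross_of_coxMap_eq hp h
  have H : ∃ μ : Fin 6 → ℂ, IsTorus μ ∧ ∀ k, c'.1 k = μ k * c.1 k := by
    have key := fun n => exists_torus_of_cross_shift n h1 h2 h3 (eq_zero_iff_of_coxMap_eq hp h)
    rcases IsCox.exists_four_ne_zero c.2 with ⟨a, b, d, e⟩ | ⟨a, b, d, e⟩ | ⟨a, b, d, e⟩ |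
      ⟨a, b, d, e⟩ | ⟨a, b, d, e⟩ | ⟨a, b, d, e⟩
    exacts [key 0 a b d e, key 1 e d a b, key 2 b a e d, key 3 d e b a, key 4 a b d e,
      key 5 e d b a]
  obtain ⟨μ, hμ, H⟩ := H
  exact ⟨μ, hμ, Subtype.ext (funext H)⟩

theorem coxShift_torusAct {μ : Fin 6 → ℂ} (hμ : IsTorus μ) (n : ℕ) (c : CoxSpace) :
    coxShift^[n] (torusAct hμ c) = torusAct (hμ.shift n) (coxShift^[n] c) := by
  refine Subtype.ext (funext fun k => ?_)
  change _ = (μ ∘ _) k * (coxShift^[n] c).1 k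
  rw [coxShift_iterate_apply, coxShift_iterate_apply]
  rfl

/-- A point of `ℂ⁶ ∖ W` over a point of the blow-up. -/
def coxLift (b : BlowUp p) : CoxSpace := Function.surjInv (coxMap_surjective hp) b

theorem coxMap_coxLift (b : BlowUp p) : coxMap hp (coxLift hp b) = b :=
  Function.surjInv_eq (coxMap_surjective hp) b

/-- The map of the blow-up induced by `coxShift`. -/
def blowUpShift (b : BlowUp p) : BlowUp p := coxMap hp (coxShift (coxLift hp b))

/-- Another lift differs by a torus element, and `coxShift` turns it into a torus element again, so
the choice made by `coxLift` does not matter. -/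
theorem blowUpShift_coxMap (c : CoxSpace) :
    blowUpShift hp (coxMap hp c) = coxMap hp (coxShift c) := by
  obtain ⟨μ, hμ, h⟩ := exists_torus_of_coxMap_eq hp (coxMap_coxLift hp (coxMap hp c)).symm
  rw [blowUpShift, h]
  have := coxShift_torusAct hμ 1 c
  rw [Function.iterate_one] at this
  rw [this, coxMap_torusAct]

theorem blowUpShift_iterate_coxMap (n : ℕ) (c : CoxSpace) :
    (blowUpShift hp)^[n] (coxMap hp c) = coxMap hp (coxShift^[n] c) := by
  induction n generalizing c with
  | zero => rfl
  | succ n ih => rw [Function.iterate_succ_apply, blowUpShift_coxMap, ih,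
      Function.iterate_succ_apply]

theorem blowUpShift_iterate_six (b : BlowUp p) : (blowUpShift hp)^[6] b = b := by
  obtain ⟨c, rfl⟩ := coxMap_surjective hp b
  rw [blowUpShift_iterate_coxMap, coxShift_iterate_six]

theorem eval_coxShift (c : CoxSpace) (F : MvPolynomial (Fin 6) ℂ) :
    eval (coxShift c).1 F = eval c.1 (MvPolynomial.rename shiftPerm F) := by
  rw [MvPolynomial.eval_rename]
  congr 2
  funext k
  exact coxShift_apply c k

theorem RegAt.shift {φ : CoxSpace → ℂ} {c : CoxSpace} (h : RegAt φ (coxShift c)) :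
    RegAt (fun c => φ (coxShift c)) c := by
  obtain ⟨F, G, hG, h⟩ := h
  refine ⟨MvPolynomial.rename shiftPerm F, MvPolynomial.rename shiftPerm G, ?_, fun c' hc' => ?_⟩
  · rwa [eval_coxShift] at hG
  · rw [← eval_coxShift] at hc' ⊢
    rw [← eval_coxShift]
    exact h _ hc'

theorem continuous_blowUpShift : Continuous (blowUpShift hp) := by
  refine continuous_def.2 fun O hO => isOpen_of_eval hp fun c hc => ?_
  rw [Set.mem_preimage, blowUpShift_coxMap] at hc
  obtain ⟨K, hK, hKO⟩ := exists_eval_of_mem_open hp hO hc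
  refine ⟨MvPolynomial.rename shiftPerm K, ?_, fun c' hc' => ?_⟩
  · rwa [eval_coxShift] at hK
  · rw [← eval_coxShift] at hc'
    rw [Set.mem_preimage, blowUpShift_coxMap]
    exact hKO _ hc'

theorem exists_extension {U : Opens (BlowUp p)} (f : U → ℂ) :
    ∃ φ : CoxSpace → ℂ, ∀ c (h : coxMap hp c ∈ U), f ⟨coxMap hp c, h⟩ = φ c := by
  classical
  exact ⟨fun c => if h : coxMap hp c ∈ U then f ⟨coxMap hp c, h⟩ else 0, fun c h => by
    simp only [dif_pos h]⟩

theorem isMorphism_of_coxShift {g : BlowUp p → BlowUp p} (hg : Continuous g)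
    (h : ∀ c, g (coxMap hp c) = coxMap hp (coxShift c)) : IsMorphism g := by
  refine ⟨hg, fun U f hf => ?_⟩
  obtain ⟨φ, hφ⟩ := exists_extension hp f
  have hU : ∀ c, g (coxMap hp c) ∈ U → coxMap hp (coxShift c) ∈ U := fun c hc => by
    rwa [h] at hc
  have hf' : ∀ b (h : b ∈ U) b' (h' : b' ∈ U), b = b' → f ⟨b, h⟩ = f ⟨b', h'⟩ := by
    rintro b h _ _ rfl
    rfl
  refine reg_of_regAt hp (φ := fun c => φ (coxShift c)) (fun c hc => ?_)
    fun c hc => (regAt_of_reg hp hf hφ (hU c (Opens.mem_comap.1 hc))).shift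
  exact (hf' _ (Opens.mem_comap.1 hc) _ (hU c (Opens.mem_comap.1 hc)) (h c)).trans (hφ _ _)

theorem isMorphism_blowUpShift : IsMorphism (blowUpShift hp) :=
  isMorphism_of_coxShift hp (continuous_blowUpShift hp) (blowUpShift_coxMap hp)

theorem IsMorphism.comp {X Y Z : Type} [TopologicalSpace X] [Variety X] [TopologicalSpace Y]
    [Variety Y] [TopologicalSpace Z] [Variety Z] {ψ : Y → Z} {φ : X → Y} (hψ : IsMorphism ψ)
    (hφ : IsMorphism φ) : IsMorphism (ψ ∘ φ) := by
  obtain ⟨c1, h1⟩ := hψ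
  obtain ⟨c2, h2⟩ := hφ
  exact ⟨c1.comp c2, fun U f hf => h2 _ _ (h1 U f hf)⟩

theorem IsMorphism.iterate {X : Type} [TopologicalSpace X] [Variety X] {φ : X → X}
    (hφ : IsMorphism φ) (n : ℕ) : IsMorphism φ^[n] := by
  induction n with
  | zero => exact ⟨continuous_id, fun _ _ hf => hf⟩
  | succ n ih => exact ih.comp hφ

/-- The automorphism of the blow-up induced by `coxShift`. -/
def shiftAut : VAut (BlowUp p) :=
  ⟨{ toFun := blowUpShift hp
     invFun := (blowUpShift hp)^[5]
     left_inv := fun b => blowUpShift_iterate_six hp b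
     right_inv := fun b => by
      rw [← Function.iterate_succ_apply' (blowUpShift hp)]
      exact blowUpShift_iterate_six hp b },
    isMorphism_blowUpShift hp, (isMorphism_blowUpShift hp).iterate 5⟩

theorem shiftAut_coxMap (c : CoxSpace) :
    (shiftAut hp : Equiv.Perm (BlowUp p)) (coxMap hp c) = coxMap hp (coxShift c) :=
  blowUpShift_coxMap hp c

theorem shiftAut_pow_coxMap (n : ℕ) (c : CoxSpace) :
    ((shiftAut hp ^ n : VAut (BlowUp p)) : Equiv.Perm (BlowUp p)) (coxMap hp c) =
      coxMap hp (coxShift^[n] c) := by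
  rw [Subgroup.coe_pow, Equiv.Perm.coe_pow]
  exact blowUpShift_iterate_coxMap hp n c

/-- The open set of the blow-up where the `k`-th Cox coordinate does not vanish. -/
def coordOpen (k : Fin 6) : Opens (BlowUp p) :=
  ⟨{b | (coxLift hp b).1 k ≠ 0}, isOpen_of_eval hp fun c hc => by
    have e : ∀ c, (coxLift hp (coxMap hp c)).1 k = 0 ↔ c.1 k = 0 := fun c =>
      eq_zero_iff_of_coxMap_eq hp (coxMap_coxLift hp _) k
    refine ⟨MvPolynomial.X k, ?_, fun c' hc' => ?_⟩
    · rw [MvPolynomial.eval_X]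
      exact fun h => hc ((e c).2 h)
    · rw [MvPolynomial.eval_X] at hc'
      exact fun h => hc' ((e c').1 h)⟩

theorem mem_coordOpen {k : Fin 6} {c : CoxSpace} :
    coxMap hp c ∈ coordOpen hp k ↔ c.1 k ≠ 0 :=
  not_congr (eq_zero_iff_of_coxMap_eq hp (coxMap_coxLift hp _) k)

theorem orderOf_shiftAut : orderOf (shiftAut hp) = 6 := by
  -- A point whose only zero is X is moved off X = 0, and the fibres of `coxMap` remember which
  -- coordinates vanish.
  have key : ∀ n : ℕ, (shiftPerm ^ n) 0 ≠ 0 → shiftAut hp ^ n ≠ 1 := by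
    intro n hn h
    let c : CoxSpace := ⟨Function.update 1 0 0, isCox_of_ne_zero (k := 0) fun j hj => by simp [hj]⟩
    have h1 := shiftAut_pow_coxMap hp n c
    rw [h] at h1
    have h2 := (eq_zero_iff_of_coxMap_eq hp h1 0).1 (by simp [c])
    rw [coxShift_iterate_apply] at h2
    simp [c, hn] at h2
  refine orderOf_eq_of_pow_and_pow_div_prime (by norm_num) ?_ ?_
  · refine Subtype.ext (Equiv.ext fun b => ?_)
    obtain ⟨c, rfl⟩ := coxMap_surjective hp b
    rw [shiftAut_pow_coxMap, coxShift_iterate_six]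
    rfl
  · intro q hq hq6
    apply key
    have hle := Nat.le_of_dvd (by norm_num) hq6
    have hq2 := hq.two_le
    interval_cases q
    · decide
    · decide
    · norm_num at hq
    · norm_num at hq6
    · norm_num at hq

end

section

open MvPolynomial (eval)

variable {p : Fin 3 → Plane} (hp : Projectivization.Independent p)

/-! ### The hexagon in Cox coordinates -/

theorem coframe_frame {i j : Fin 3} (h : i ≠ j) : coframe p i ⬝ᵥ (p j).rep = 0 := by
  fin_cases i <;> fin_cases j <;>
    first
    | exact absurd rfl h
    | (simp [coframe, dotProduct, crossProduct, Fin.sum_univ_three]; ring)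

/-- Both sides describe the plane spanned by the two other frame vectors; the converse is Cramer's
expansion with its `i`-th term removed. -/
theorem mem_iSup_submodule_iff (hp : Projectivization.Independent p) (w : Fin 3 → ℂ) (i : Fin 3) :
    w ∈ ⨆ j ∈ ({i}ᶜ : Set (Fin 3)), (p j).submodule ↔ coframe p i ⬝ᵥ w = 0 := by
  constructor
  · intro h
    have hle : (⨆ j ∈ ({i}ᶜ : Set (Fin 3)), (p j).submodule) ≤
        LinearMap.ker (dotProductBilin ℂ ℂ (coframe p i)) := by
      refine iSup₂_le fun j hj => ?_
      rw [Projectivization.submodule_eq, Submodule.span_singleton_le_iff_mem, LinearMap.mem_ker]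
      exact coframe_frame (Ne.symm hj)
    exact hle h
  · intro h
    have key : frameDet p • w = (coframe p 0 ⬝ᵥ w) • (p 0).rep + (coframe p 1 ⬝ᵥ w) • (p 1).rep +
        (coframe p 2 ⬝ᵥ w) • (p 2).rep := by
      funext k
      fin_cases k <;>
        simp [coframe, frameDet, dotProduct, crossProduct, Fin.sum_univ_three] <;> ring
    rw [← Submodule.smul_mem_iff _ (frameDet_ne_zero hp), key]
    have hj : ∀ j, (coframe p j ⬝ᵥ w) • (p j).rep ∈
        ⨆ j ∈ ({i}ᶜ : Set (Fin 3)), (p j).submodule := by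
      intro j
      by_cases hij : j = i
      · rw [hij, h, zero_smul]
        exact zero_mem _
      · refine Submodule.smul_mem _ _ (Submodule.mem_iSup_of_mem j
          (Submodule.mem_iSup_of_mem hij ?_))
        rw [Projectivization.submodule_eq]
        exact Submodule.mem_span_singleton_self _
    exact add_mem (add_mem (hj 0) (hj 1)) (hj 2)

/-- The coordinates of E₁, E₂, E₃ are t, s, u. Each of them divides two of `Xsu`, `Ytu`, `Zst`, and
by the Cox condition this is the only way for those two to vanish. -/
theorem coxMap_mem_exceptionalCurve (i : Fin 3) (c : CoxSpace) :
    coxMap hp c ∈ exceptionalCurve p i ↔ c.1 (![4, 3, 5] i) = 0 := by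
  obtain ⟨κ, hκ, ⟨h0, h1, h2⟩, -⟩ := forms_coxMap hp c
  have hc : IsCox c.1 := c.2
  constructor
  · intro h
    have h' : (coxMap hp c).1 0 = p i := h
    have e : ∀ j, j ≠ i → ptForm p j (coxMap hp c) = 0 := fun j hj => by
      rw [ptForm, linForm, h', coframe_frame hj]
    have k0 := hκ 0
    unfold IsCox at hc
    fin_cases i <;> simp only [Fin.reduceFinMk, Fin.zero_eta, Fin.mk_one, Matrix.cons_val] <;>
      grind
  · intro h
    have e : ∀ a : ℂ, coxPoint p c = a • (p i).rep → coxMap hp c ∈ exceptionalCurve p i := by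
      intro a ha
      change Projectivization.mk ℂ (coxPoint p c) (coxPoint_ne hp c) = p i
      rw [← Projectivization.mk_rep (p i), Projectivization.mk_eq_mk_iff']
      exact ⟨a, ha.symm⟩
    fin_cases i <;> simp only [Fin.reduceFinMk, Fin.zero_eta, Fin.mk_one, Matrix.cons_val] at h
    · exact e (c.1 0 * c.1 3 * c.1 5) (by simp [coxPoint, h])
    · exact e (c.1 1 * c.1 4 * c.1 5) (by simp [coxPoint, h])
    · exact e (c.1 2 * c.1 3 * c.1 4) (by simp [coxPoint, h])

theorem coxMap_mem_line (i : Fin 3) (c : CoxSpace) :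
    (((coxMap hp c).1 0).submodule ≤ ⨆ j ∈ ({i}ᶜ : Set (Fin 3)), (p j).submodule) ∧
      (∀ j, (coxMap hp c).1 0 ≠ p j) ↔
      c.1 (![0, 1, 2] i) = 0 ∧ c.1 3 ≠ 0 ∧ c.1 4 ≠ 0 ∧ c.1 5 ≠ 0 := by
  obtain ⟨κ, hκ, ⟨h0, h1, h2⟩, -⟩ := forms_coxMap hp c
  rw [Projectivization.submodule_eq, Submodule.span_singleton_le_iff_mem,
    mem_iSup_submodule_iff hp]
  have e : ∀ j, (coxMap hp c).1 0 = p j ↔ c.1 (![4, 3, 5] j) = 0 := fun j =>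
    coxMap_mem_exceptionalCurve hp j c
  simp only [Fin.forall_fin_succ, Ne, e]
  change ptForm p i (coxMap hp c) = 0 ∧ _ ↔ _
  have k0 := hκ 0
  fin_cases i <;> simp [h0, h1, h2, k0] <;> tauto

/-- The condition is closed, since `coordOpen` is open. Conversely every neighbourhood of a point
with this coordinate zero contains a point at which it is the only zero, and that one lies on the
line away from the blown-up points. -/
theorem coxMap_mem_lineCurve (i : Fin 3) (c : CoxSpace) :
    coxMap hp c ∈ lineCurve p i ↔ c.1 (![0, 1, 2] i) = 0 := by
  rw [lineCurve, mem_closure_iff]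
  constructor
  · intro h
    by_contra hc
    obtain ⟨b, hb, hb'⟩ := h _ (coordOpen hp (![0, 1, 2] i)).2 ((mem_coordOpen hp).2 hc)
    obtain ⟨c', rfl⟩ := coxMap_surjective hp b
    exact (mem_coordOpen hp).1 hb ((coxMap_mem_line hp i c').1 hb').1
  · intro hc O hO hcO
    obtain ⟨K, hK, hKO⟩ := exists_eval_of_mem_open hp hO hcO
    obtain ⟨c', hc', hne, hKc'⟩ := exists_cox_eval_ne_zero (restrictZero_ne_zero hc hK)
    refine ⟨coxMap hp c', hKO _ hKc', (coxMap_mem_line hp i c').2 ⟨hc', hne _ ?_, hne _ ?_,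
      hne _ ?_⟩⟩ <;> clear * - <;> revert i <;> decide

theorem coxMap_mem_hexagon (k : Fin 6) (c : CoxSpace) :
    coxMap hp c ∈ hexagon p k ↔ c.1 (![0, 5, 1, 4, 2, 3] k) = 0 := by
  fin_cases k
  exacts [coxMap_mem_lineCurve hp 0 c, coxMap_mem_exceptionalCurve hp 2 c,
    coxMap_mem_lineCurve hp 1 c, coxMap_mem_exceptionalCurve hp 0 c,
    coxMap_mem_lineCurve hp 2 c, coxMap_mem_exceptionalCurve hp 1 c]

theorem shiftAut_preimage_hexagon (k : Fin 6) :
    (shiftAut hp : Equiv.Perm (BlowUp p)) ⁻¹' hexagon p k = hexagon p (k + 1) := by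
  ext b
  obtain ⟨c, rfl⟩ := coxMap_surjective hp b
  rw [Set.mem_preimage, shiftAut_coxMap, coxMap_mem_hexagon, coxMap_mem_hexagon, coxShift_apply]
  fin_cases k <;> rfl

end

section

open MvPolynomial (eval)

variable {p : Fin 3 → Plane} (hp : Projectivization.Independent p)

/-! ### The line bundle -/

/-- After clearing denominators this is a polynomial identity on a non-empty open set, hence
everywhere. -/
theorem RegAt.eq_of_dense {φ ψ : CoxSpace → ℂ} {c : CoxSpace} (hφ : RegAt φ c) (hψ : RegAt ψ c)
    {K H : MvPolynomial (Fin 6) ℂ} (hK : eval c.1 K ≠ 0) (hH : H ≠ 0)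
    (h : ∀ c' : CoxSpace, eval c'.1 K ≠ 0 → eval c'.1 H ≠ 0 → φ c' = ψ c') : φ c = ψ c := by
  obtain ⟨F, G, hG, hF⟩ := hφ
  obtain ⟨F', G', hG', hF'⟩ := hψ
  have ne : ∀ {P : MvPolynomial (Fin 6) ℂ}, eval c.1 P ≠ 0 → P ≠ 0 := fun hP h => hP (by simp [h])
  have h0 : F * G' - F' * G = 0 := by
    refine eq_zero_of_eval_eq_zero (K := K * H * (G * G'))
      (mul_ne_zero (mul_ne_zero (ne hK) hH) (mul_ne_zero (ne hG) (ne hG'))) fun c' hc' => ?_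
    simp only [map_mul, mul_ne_zero_iff] at hc'
    obtain ⟨⟨h1, h2⟩, h3, h4⟩ := hc'
    have := h c' h1 h2
    rw [hF c' h3, hF' c' h4, div_eq_div_iff h3 h4] at this
    simp only [map_sub, map_mul, this, sub_self]
  rw [hF c hG, hF' c hG', div_eq_div_iff hG hG']
  have := congrArg (eval c.1) h0
  simpa [sub_eq_zero] using this

/-- Functions on `ℂ⁶ ∖ W` that are invariant under the torus descend to the blow-up. -/
theorem descend_coxMap {φ : CoxSpace → ℂ}
    (hφ : ∀ {μ : Fin 6 → ℂ} (hμ : IsTorus μ) c, φ (torusAct hμ c) = φ c) (c : CoxSpace) :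
    φ (coxLift hp (coxMap hp c)) = φ c := by
  obtain ⟨μ, hμ, h⟩ := exists_torus_of_coxMap_eq hp (coxMap_coxLift hp (coxMap hp c)).symm
  rw [h, hφ]

theorem descend_mem_reg {φ : CoxSpace → ℂ}
    (hφ : ∀ {μ : Fin 6 → ℂ} (hμ : IsTorus μ) c, φ (torusAct hμ c) = φ c) {U : Opens (BlowUp p)}
    (h : ∀ c, coxMap hp c ∈ U → RegAt φ c) :
    (fun b : U => φ (coxLift hp b)) ∈ Variety.reg U :=
  reg_of_regAt hp (fun c _ => descend_coxMap hp hφ c) h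

/-- The local frames `X`, `Zt / u`, `Yt / s` of the pull-back of the line bundle. -/
def coxFrame (i : Fin 3) (c : CoxSpace) : ℂ :=
  ![c.1 0, c.1 2 * c.1 4 / c.1 5, c.1 1 * c.1 4 / c.1 3] i

/-- The open sets over which the frames do not vanish. -/
def bundleOpen : Fin 3 → Opens (BlowUp p) :=
  ![coordOpen hp 0, coordOpen hp 2 ⊓ coordOpen hp 4 ⊓ coordOpen hp 5,
    coordOpen hp 1 ⊓ coordOpen hp 4 ⊓ coordOpen hp 3]

theorem mem_bundleOpen {i : Fin 3} {c : CoxSpace} : coxMap hp c ∈ bundleOpen hp i ↔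
    ![c.1 0 ≠ 0, (c.1 2 ≠ 0 ∧ c.1 4 ≠ 0) ∧ c.1 5 ≠ 0, (c.1 1 ≠ 0 ∧ c.1 4 ≠ 0) ∧ c.1 3 ≠ 0] i := by
  have h := fun k => mem_coordOpen hp (k := k) (c := c)
  fin_cases i
  · exact h 0
  · exact and_congr (and_congr (h 2) (h 4)) (h 5)
  · exact and_congr (and_congr (h 1) (h 4)) (h 3)

theorem coxFrame_ne_zero {i : Fin 3} {c : CoxSpace} (h : coxMap hp c ∈ bundleOpen hp i) :
    coxFrame i c ≠ 0 := by
  rw [mem_bundleOpen] at h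
  fin_cases i
  · exact h
  · exact div_ne_zero (mul_ne_zero h.1.1 h.1.2) h.2
  · exact div_ne_zero (mul_ne_zero h.1.1 h.1.2) h.2

theorem regAt_coord (k : Fin 6) (c : CoxSpace) : RegAt (fun c => c.1 k) c := by
  simpa using regAt_eval (MvPolynomial.X k) c

theorem regAt_coxFrame {i : Fin 3} {c : CoxSpace} (h : coxMap hp c ∈ bundleOpen hp i) :
    RegAt (coxFrame i) c := by
  rw [mem_bundleOpen] at h
  fin_cases i
  · exact regAt_coord 0 c
  · exact ((regAt_coord 2 c).mul (regAt_coord 4 c)).div (regAt_coord 5 c) h.2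
  · exact ((regAt_coord 1 c).mul (regAt_coord 4 c)).div (regAt_coord 3 c) h.2

/-- The relations `xu` and `xs` give `Zt / u` and `Yt / s` the weight of `X`, so ratios of frames
descend to the blow-up. -/
theorem coxFrame_torusAct {μ : Fin 6 → ℂ} (hμ : IsTorus μ) (i : Fin 3) (c : CoxSpace) :
    coxFrame i (torusAct hμ c) = μ 0 * coxFrame i c := by
  have h5 := hμ.ne_zero 5
  have h3 := hμ.ne_zero 3
  have hxu := hμ.xu
  have hxs := hμ.xs
  fin_cases i
  · rfl
  · change (μ 2 * c.1 2) * (μ 4 * c.1 4) / (μ 5 * c.1 5) = μ 0 * (c.1 2 * c.1 4 / c.1 5)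
    rw [mul_mul_mul_comm, ← hxu, mul_div_mul_comm, mul_div_cancel_right₀ _ h5]
  · change (μ 1 * c.1 1) * (μ 4 * c.1 4) / (μ 3 * c.1 3) = μ 0 * (c.1 1 * c.1 4 / c.1 3)
    rw [mul_mul_mul_comm, ← hxs, mul_div_mul_comm, mul_div_cancel_right₀ _ h3]

theorem frameRatio_torusAct (i j : Fin 3) {μ : Fin 6 → ℂ} (hμ : IsTorus μ) (c : CoxSpace) :
    coxFrame j (torusAct hμ c) / coxFrame i (torusAct hμ c) = coxFrame j c / coxFrame i c := by
  rw [coxFrame_torusAct, coxFrame_torusAct, mul_div_mul_left _ _ (hμ.ne_zero 0)]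

/-- The line bundle `𝒪(L₁)`. -/
def coxBundle : LineBundle (BlowUp p) where
  ι := Fin 3
  U := bundleOpen hp
  cover b := by
    obtain ⟨c, rfl⟩ := coxMap_surjective hp b
    -- If X = 0, then Y, Z and t are non-zero and at most one of s and u vanishes.
    have hc : IsCox c.1 := c.2
    unfold IsCox at hc
    simp only [mem_bundleOpen, Fin.exists_fin_succ, Fin.succ_zero_eq_one, Matrix.cons_val,
      Fin.succ_one_eq_two]
    grind
  -- A section with pull-back `F` has local expressions `F / frame`, whence the frame of `j` over
  -- that of `i`.
  g i j b := coxFrame j (coxLift hp b) / coxFrame i (coxLift hp b)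
  g_reg i j := descend_mem_reg hp (φ := fun c => coxFrame j c / coxFrame i c)
    (fun hμ c => frameRatio_torusAct i j hμ c) fun _ hc =>
      (regAt_coxFrame hp (Opens.mem_inf.1 hc).2).div (regAt_coxFrame hp (Opens.mem_inf.1 hc).1)
        (coxFrame_ne_zero hp (Opens.mem_inf.1 hc).1)
  g_self i b := by
    obtain ⟨b, hb⟩ := b
    rw [Opens.mem_inf, ← coxMap_coxLift hp b] at hb
    exact div_self (coxFrame_ne_zero hp hb.1)
  g_mul i j k b hi hj hk := by
    rw [← coxMap_coxLift hp b] at hj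
    rw [mul_comm]
    exact div_mul_div_cancel₀ (coxFrame_ne_zero hp hj)

theorem coxBundle_g (i j : Fin 3) (c : CoxSpace)
    (h : coxMap hp c ∈ (coxBundle hp).U i ⊓ (coxBundle hp).U j) :
    (coxBundle hp).g i j ⟨coxMap hp c, h⟩ = coxFrame j c / coxFrame i c :=
  descend_coxMap hp (φ := fun c => coxFrame j c / coxFrame i c)
    (fun hμ c => frameRatio_torusAct i j hμ c) c

theorem RegAt.exists_opens {φ : CoxSpace → ℂ} {c : CoxSpace} (h : RegAt φ c)
    {K : MvPolynomial (Fin 6) ℂ} (hK : eval c.1 K ≠ 0) : ∃ O : Opens CoxSpace, c ∈ O ∧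
      (∀ c' ∈ O, eval c'.1 K ≠ 0) ∧ (fun c' : O => φ c') ∈ Variety.reg O := by
  obtain ⟨F, G, hG, h⟩ := h
  have mem : ∀ P : MvPolynomial (Fin 6) ℂ, (fun c : CoxSpace => eval c.1 P) ∈ coxForms ⟨⟩ :=
    fun P => ⟨P, by funext c; simp [MvPolynomial.aeval_eq_eval]⟩
  refine ⟨⟨{c' | eval c'.1 (G * K) ≠ 0}, isOpen_nonvanishing (mem (G * K))⟩, ?_, ?_, ?_⟩
  · change eval c.1 (G * K) ≠ 0
    rw [map_mul]
    exact mul_ne_zero hG hK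
  · intro c' hc'
    change eval c'.1 (G * K) ≠ 0 at hc'
    rw [map_mul] at hc'
    exact right_ne_zero_of_mul hc'
  · have hne : ∀ c' : CoxSpace, eval c'.1 (G * K) ≠ 0 → eval c'.1 G ≠ 0 := fun c' hc' => by
      rw [map_mul] at hc'
      exact left_ne_zero_of_mul hc'
    convert div_mem_reg (𝒜 := coxForms)
      (U := ⟨{c' | eval c'.1 (G * K) ≠ 0}, isOpen_nonvanishing (mem (G * K))⟩) (mem F) (mem G)
      (fun c' hc' => hne c' hc') using 1
    funext c'
    exact h c' (hne c' c'.2)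

/-- The trivialization of the pull-back of the line bundle to `ℂ⁶ ∖ W` given by the frames. -/
def coxTrivialization : CoxTrivialization hp (coxBundle hp) where
  e := coxFrame
  regular i c hc := by
    obtain ⟨K, hK, hKO⟩ := exists_eval_of_mem_open hp ((coxBundle hp).U i).2 hc
    obtain ⟨O, hcO, hO, hreg⟩ := (regAt_coxFrame hp hc).exists_opens hK
    exact ⟨O, hcO, fun c' hc' => hKO c' (hO c' hc'), hreg⟩
  ne_zero i c hc := coxFrame_ne_zero hp hc
  compat i j c hi hj := ((congrArg (· * coxFrame i c) (coxBundle_g hp i j c _)).trans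
    (div_mul_cancel₀ _ (coxFrame_ne_zero hp hi))).symm

end

section

open MvPolynomial (eval)

variable {p : Fin 3 → Plane} (hp : Projectivization.Independent p)

/-! ### The line bundle is `𝒪(L₁)` -/

/-- Rational functions on `ℂ⁶ ∖ W` can be composed with local sections of the quotient map. -/
theorem exists_reg_comp_section (b : BlowUp p) : ∃ c, coxMap hp c = b ∧
    ∀ ψ, RegAt ψ c → ∀ V : Opens (BlowUp p), b ∈ V → ∃ V' : Opens (BlowUp p), V' ≤ V ∧ b ∈ V' ∧
      ∃ s : V' → CoxSpace, (∀ b', coxMap hp (s b') = b') ∧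
        (fun b' => ψ (s b')) ∈ Variety.reg V' := by
  obtain ⟨U', hbU, s, hs, hreg⟩ := exists_local_section hp b
  refine ⟨s ⟨b, hbU⟩, hs _, ?_⟩
  rintro ψ ⟨F, G, hG, hFG⟩ V hbV
  have hF := eval_section_mem_reg hreg F
  have hG' := eval_section_mem_reg hreg G
  let O : Opens (BlowUp p) := ⟨_, isOpen_ne_zero_of_reg (𝒜 := blowUpForms p) hG'⟩
  have hO : O ⊓ V ≤ U' := fun b' hb' => hb'.1.choose
  have hGO : ∀ b' : (O ⊓ V : Opens (BlowUp p)), eval (s ⟨b', hO b'.2⟩).1 G ≠ 0 := fun b' =>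
    (b'.2.1 : ∃ h : (b' : BlowUp p) ∈ U', _).choose_spec
  refine ⟨O ⊓ V, inf_le_right, ⟨⟨hbU, hG⟩, hbV⟩, fun b' => s ⟨b', hO b'.2⟩, fun b' => hs _, ?_⟩
  convert mul_mem (Variety.res hO hF) (inv_mem_reg (𝒜 := blowUpForms p) (Variety.res hO hG') hGO)
    using 1
  funext b'
  rw [hFG _ (hGO b'), div_eq_mul_inv]
  rfl

theorem coordRatio_torusAct (i : Fin 3) {μ : Fin 6 → ℂ} (hμ : IsTorus μ) (c : CoxSpace) :
    (torusAct hμ c).1 0 / coxFrame i (torusAct hμ c) = c.1 0 / coxFrame i c := by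
  rw [coxFrame_torusAct]
  exact mul_div_mul_left _ _ (hμ.ne_zero 0)

/-- The section of the line bundle with pull-back `X`. -/
def divisorSection : H0 (coxBundle hp) :=
  ⟨fun i b => (coxLift hp b).1 0 / coxFrame i (coxLift hp b), fun i =>
    descend_mem_reg hp (φ := fun c => c.1 0 / coxFrame i c)
      (fun hμ c => coordRatio_torusAct i hμ c)
      fun c hc => (regAt_coord 0 c).div (regAt_coxFrame hp hc) (coxFrame_ne_zero hp hc),
    fun i j b hi hj => by
      rw [← coxMap_coxLift hp b] at hj
      rw [mul_comm]
      exact (div_mul_div_cancel₀ (coxFrame_ne_zero hp hj)).symm⟩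

theorem divisorSection_coxMap (i : Fin 3) (c : CoxSpace) (h : coxMap hp c ∈ (coxBundle hp).U i) :
    (divisorSection hp).1 i ⟨coxMap hp c, h⟩ = c.1 0 / coxFrame i c :=
  descend_coxMap hp (φ := fun c => c.1 0 / coxFrame i c)
    (fun hμ c => coordRatio_torusAct i hμ c) c

/-- Cancellation is clear where X does not vanish, and that set is dense. -/
theorem eq_of_mul_divisorSection_eq (i : Fin 3) {V : Opens (BlowUp p)}
    (hV : V ≤ (coxBundle hp).U i) {h h' : V → ℂ} (hh : h ∈ Variety.reg V)
    (hh' : h' ∈ Variety.reg V) (e : ∀ b : V, h b * (divisorSection hp).1 i ⟨b, hV b.2⟩ =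
      h' b * (divisorSection hp).1 i ⟨b, hV b.2⟩) : h = h' := by
  funext ⟨b, hb⟩
  obtain ⟨c, rfl⟩ := coxMap_surjective hp b
  obtain ⟨φ, hφ⟩ := exists_extension hp h
  obtain ⟨φ', hφ'⟩ := exists_extension hp h'
  obtain ⟨K, hK, hKV⟩ := exists_eval_of_mem_open hp V.2 hb
  rw [hφ, hφ']
  refine (regAt_of_reg hp hh hφ hb).eq_of_dense (regAt_of_reg hp hh' hφ' hb) hK
    (MvPolynomial.X_ne_zero 0) fun c' hc' h0 => ?_
  rw [MvPolynomial.eval_X] at h0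
  have := e ⟨coxMap hp c', hKV c' hc'⟩
  rw [hφ, hφ', divisorSection_coxMap] at this
  exact mul_right_cancel₀ (div_ne_zero h0 (coxFrame_ne_zero hp (hV (hKV c' hc')))) this

/-- Near a point of L₁ the pull-back of `f` is a fraction whose numerator vanishes on X = 0, so X
divides the numerator. Away from L₁ the section is invertible. -/
theorem exists_local_quotient (i : Fin 3) {V : Opens (BlowUp p)} (hV : V ≤ (coxBundle hp).U i)
    {f : V → ℂ} (hf : f ∈ Variety.reg V) (h0 : ∀ b : V, (b : BlowUp p) ∈ lineCurve p 0 → f b = 0)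
    (b : V) : ∃ (V' : Opens (BlowUp p)) (hV' : V' ≤ V), (b : BlowUp p) ∈ V' ∧
      ∃ h ∈ Variety.reg V', ∀ b' : V', f ⟨b', hV' b'.2⟩ =
        h b' * (divisorSection hp).1 i ⟨b', hV (hV' b'.2)⟩ := by
  obtain ⟨c, hc, H⟩ := exists_reg_comp_section hp (b : BlowUp p)
  have hcV : coxMap hp c ∈ V := hc ▸ b.2
  obtain ⟨φ, hφ⟩ := exists_extension hp f
  obtain ⟨K, hK, hKV⟩ := exists_eval_of_mem_open hp V.2 hcV
  have hφ0 : ∀ c', coxMap hp c' ∈ V → c'.1 0 = 0 → φ c' = 0 := fun c' hc' h => by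
    rw [← hφ c' hc']
    exact h0 _ ((coxMap_mem_lineCurve hp 0 c').2 h)
  suffices ∃ ψ, RegAt ψ c ∧ ∀ c', coxMap hp c' ∈ V → φ c' = ψ c' * (c'.1 0 / coxFrame i c') by
    obtain ⟨ψ, hψ, hψφ⟩ := this
    obtain ⟨V', hV', hbV', s, hs, hreg⟩ := H ψ hψ V b.2
    refine ⟨V', hV', hbV', _, hreg, fun b' => ?_⟩
    have hb' : coxMap hp (s b') ∈ V := by rw [hs]; exact hV' b'.2
    have h1 := hψφ (s b') hb'
    rw [← divisorSection_coxMap hp i _ (hV hb'), ← hφ _ hb'] at h1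
    have e : ∀ {W : Opens (BlowUp p)} (f : W → ℂ) {b₁ b₂ : BlowUp p} (h₁ : b₁ ∈ W) (h₂ : b₂ ∈ W),
        b₁ = b₂ → f ⟨b₁, h₁⟩ = f ⟨b₂, h₂⟩ := by
      rintro W f b₁ _ h₁ h₂ rfl
      rfl
    exact (e f _ _ (hs b').symm).trans (h1.trans (congrArg (ψ (s b') * ·)
      (e ((divisorSection hp).1 i) _ _ (hs b'))))
  have hreg := regAt_of_reg hp hf hφ hcV
  have hfr := regAt_coxFrame hp (hV hcV)
  by_cases hc0 : c.1 0 = 0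
  · obtain ⟨F, G, hG, hFG⟩ := hreg
    obtain ⟨F', rfl⟩ : MvPolynomial.X 0 ∣ F := by
      refine X_dvd_of_eval_eq_zero (c := c.1) (K := K * G) hc0
        (by rw [map_mul]; exact mul_ne_zero hK hG) fun c' hc' hKG => ?_
      rw [map_mul] at hKG
      have h1 := hFG c' (right_ne_zero_of_mul hKG)
      rw [hφ0 c' (hKV c' (left_ne_zero_of_mul hKG)) hc', eq_comm, div_eq_zero_iff] at h1
      exact h1.resolve_right (right_ne_zero_of_mul hKG)
    classical
    -- The honest quotient is used off X = 0. On X = 0 it is undefined, and the fraction with X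
    -- cancelled supplies the values that make `ψ` regular at `c`.
    refine ⟨fun c' => if c'.1 0 = 0 then eval c'.1 F' / eval c'.1 G * coxFrame i c'
      else φ c' * coxFrame i c' / c'.1 0, ?_, fun c' hc' => ?_⟩
    · refine RegAt.congr (φ := fun c' => eval c'.1 F' / eval c'.1 G * coxFrame i c')
        (((regAt_eval F' c).div (regAt_eval G c) hG).mul hfr) G hG fun c' hc' => ?_
      split_ifs with h
      · rfl
      · rw [hFG c' hc', map_mul, MvPolynomial.eval_X]
        field_simp
    · have := coxFrame_ne_zero hp (hV hc')
      beta_reduce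
      split_ifs with h
      · rw [h, hφ0 c' hc' h, zero_div, mul_zero]
      · field_simp
  · refine ⟨fun c' => φ c' * coxFrame i c' / c'.1 0, (hreg.mul hfr).div (regAt_coord 0 c) hc0,
      fun c' hc' => ?_⟩
    have := coxFrame_ne_zero hp (hV hc')
    by_cases h : c'.1 0 = 0
    · rw [h, hφ0 c' hc' h, zero_div, mul_zero]
    · field_simp

/-- Local quotients exist and are unique, so they agree on overlaps and glue. -/
theorem coxBundle_isOfDivisor : (coxBundle hp).IsOfDivisor (lineCurve p 0) := by
  refine ⟨divisorSection hp, fun i V hV => ⟨?_, fun f hf h0 => ?_⟩⟩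
  · rintro ⟨b, hb⟩ hC
    obtain ⟨c, rfl⟩ := coxMap_surjective hp b
    have hc : c.1 0 = 0 := (coxMap_mem_lineCurve hp 0 c).1 hC
    exact (divisorSection_coxMap hp i c _).trans (by rw [hc, zero_div])
  · choose W hWV hbW q hq hqf using exists_local_quotient hp i hV hf h0
    have agree : ∀ (b b' : V) (h : (b' : BlowUp p) ∈ W b), q b ⟨b', h⟩ = q b' ⟨b', hbW b'⟩ := by
      intro b b' h
      have hle : W b ⊓ W b' ≤ V := inf_le_left.trans (hWV b)
      have := eq_of_mul_divisorSection_eq hp i (hle.trans hV)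
        (Variety.res inf_le_left (hq b)) (Variety.res inf_le_right (hq b')) fun x =>
          (hqf b ⟨x, x.2.1⟩).symm.trans (hqf b' ⟨x, x.2.2⟩)
      exact congrFun this ⟨b', h, hbW b'⟩
    refine ⟨fun b => q b ⟨b, hbW b⟩, ⟨Variety.glue fun b => ⟨W b, hWV b, hbW b, ?_⟩,
      fun b => hqf b ⟨b, hbW b⟩⟩, ?_⟩
    · convert hq b using 1
      funext b'
      exact (agree b ⟨b', hWV b b'.2⟩ b'.2).symm
    · rintro h ⟨hh, hhf⟩
      have hreg : (fun b : V => q b ⟨b, hbW b⟩) ∈ Variety.reg V :=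
        Variety.glue fun b => ⟨W b, hWV b, hbW b, by
          convert hq b using 1
          funext b'
          exact (agree b ⟨b', hWV b b'.2⟩ b'.2).symm⟩
      exact eq_of_mul_divisorSection_eq hp i hV hh hreg fun b =>
        (hhf b).symm.trans (hqf b ⟨b, hbW b⟩)

end

section

open MvPolynomial (eval)

/-! ### Regular functions on `ℂ⁶ ∖ W` are polynomials -/

/-- As a polynomial in the `k`-th coordinate alone, `G` has no complex root: the points tested have
at most one zero coordinate and so lie in `CoxSpace`. Hence it is constant. -/
theorem eval_update_eq {G : MvPolynomial (Fin 6) ℂ} (hG : ∀ c : CoxSpace, eval c.1 G ≠ 0)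
    {c : Fin 6 → ℂ} (hc : ∀ j, c j ≠ 0) (k : Fin 6) (z : ℂ) :
    eval (Function.update c k z) G = eval c G := by
  let P : Polynomial ℂ := MvPolynomial.aeval
    (Function.update (fun j => Polynomial.C (c j)) k Polynomial.X) G
  have hP : ∀ z, P.eval z = eval (Function.update c k z) G := by
    intro z
    have h := MvPolynomial.comp_aeval_apply
      (Function.update (fun j => Polynomial.C (c j)) k Polynomial.X) (Polynomial.aeval z) G
    rw [Polynomial.coe_aeval_eq_eval] at h
    rw [show P.eval z = _ from h, MvPolynomial.aeval_eq_eval]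
    congr 2
    funext j
    by_cases hj : j = k
    · subst hj
      simp
    · simp [hj]
  have hdeg : P.degree ≤ 0 := by
    by_contra hd
    obtain ⟨z, hz⟩ := Complex.exists_root (not_le.1 hd)
    rw [Polynomial.IsRoot, hP] at hz
    refine hG ⟨Function.update c k z, isCox_of_ne_zero (k := k) fun j hj => ?_⟩ hz
    rw [Function.update_of_ne hj]
    exact hc j
  have h1 := hP z
  have h2 := hP (c k)
  rw [Polynomial.eq_C_of_degree_le_zero hdeg, Polynomial.eval_C] at h1 h2
  rw [← h1, h2, Function.update_eq_self]

/-- At a point without zero coordinates, replace the coordinates by 1 one at a time; such points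
suffice to separate polynomials. -/
theorem eq_C_of_eval_ne_zero {G : MvPolynomial (Fin 6) ℂ} (hG : ∀ c : CoxSpace, eval c.1 G ≠ 0) :
    G = MvPolynomial.C (eval 1 G) := by
  have key : ∀ c : Fin 6 → ℂ, (∀ j, c j ≠ 0) → ∀ s : Finset (Fin 6),
      eval (s.piecewise 1 c) G = eval c G := by
    intro c hc s
    induction s using Finset.induction_on with
    | empty => rw [Finset.piecewise_empty]
    | insert k s _ ih =>
      rw [Finset.piecewise_insert, eval_update_eq hG _ k, ih]
      intro j
      by_cases hj : j ∈ s
      · simp [hj]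
      · simpa [hj] using hc j
  by_contra h
  obtain ⟨c, hc, hne⟩ := exists_eval_ne_zero (sub_ne_zero.2 h)
  apply hne
  rw [map_sub, MvPolynomial.eval_C, ← key c hc Finset.univ, Finset.piecewise_univ, sub_self]

/-- A Hartogs argument. The reduced fraction at one point represents `φ` at every point, because by
coprimality its denominator divides every other local denominator. So the denominator has no zero on
`CoxSpace` and is constant. -/
theorem exists_polynomial_of_regAt {φ : CoxSpace → ℂ} (hφ : ∀ c, RegAt φ c) :
    ∃ F : MvPolynomial (Fin 6) ℂ, ∀ c, φ c = eval c.1 F := by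
  let c₀ : CoxSpace := ⟨1, isCox_of_ne_zero (k := 0) fun j _ => one_ne_zero⟩
  have ne : ∀ {P : MvPolynomial (Fin 6) ℂ} {c : CoxSpace}, eval c.1 P ≠ 0 → P ≠ 0 :=
    fun hP h => hP (by simp [h])
  obtain ⟨F₀, G₀, hG₀, h₀⟩ := hφ c₀
  obtain ⟨G, F, D, hrel, rfl, rfl⟩ :=
    UniqueFactorizationMonoid.exists_reduced_factors G₀ (ne hG₀) F₀
  have hcross : ∀ c, eval c.1 G ≠ 0 ∧ φ c = eval c.1 F / eval c.1 G := by
    intro c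
    obtain ⟨F₁, G₁, hG₁, h₁⟩ := hφ c
    have h : F * G₁ - F₁ * G = 0 := by
      refine eq_zero_of_eval_eq_zero (K := D * G * G₁) (mul_ne_zero (ne hG₀) (ne hG₁))
        fun c' hc' => ?_
      rw [map_mul] at hc'
      have e0 := h₀ c' (left_ne_zero_of_mul hc')
      have e1 := h₁ c' (right_ne_zero_of_mul hc')
      simp only [map_mul, mul_ne_zero_iff] at hc'
      rw [e1, map_mul, map_mul, mul_div_mul_left _ _ hc'.1.1,
        div_eq_div_iff hc'.2 hc'.1.2] at e0
      rw [map_sub, map_mul, map_mul, e0, sub_self]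
    have hdvd : G ∣ G₁ :=
      hrel.dvd_of_dvd_mul_left ⟨F₁, by rw [sub_eq_zero.1 h, mul_comm]⟩
    have hGc : eval c.1 G ≠ 0 := by
      obtain ⟨E, rfl⟩ := hdvd
      rw [map_mul] at hG₁
      exact left_ne_zero_of_mul hG₁
    refine ⟨hGc, ?_⟩
    have := congrArg (eval c.1) (sub_eq_zero.1 h)
    rw [map_mul, map_mul] at this
    rw [h₁ c hG₁, div_eq_div_iff hG₁ hGc, this]
  have hC := eq_C_of_eval_ne_zero fun c => (hcross c).1
  refine ⟨F * MvPolynomial.C (eval 1 G)⁻¹, fun c => ?_⟩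
  rw [(hcross c).2, map_mul, MvPolynomial.eval_C, div_eq_mul_inv]
  congr 2
  conv_lhs => rw [hC, MvPolynomial.eval_C]

/-! ### Exponents of equivariant polynomials -/

/-- The character of the torus by which it acts on the sections of the `n`-th twisted power. -/
def twistChar (n : ℕ) (μ : Fin 6 → ℂ) : ℂ := ∏ k : Fin n, μ ((shiftPerm ^ (k : ℕ)) 0)

/-- Polynomials on which the torus acts by the character `twistChar n`. -/
def IsTwistEquivariant (n : ℕ) (F : MvPolynomial (Fin 6) ℂ) : Prop :=
  ∀ {μ : Fin 6 → ℂ} (hμ : IsTorus μ) (c : CoxSpace),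
    eval (torusAct hμ c).1 F = twistChar n μ * eval c.1 F

/-- The torus scales each monomial separately, so comparing coefficients forces every monomial that
occurs to have the given character. -/
theorem IsTwistEquivariant.coeff {n : ℕ} {F : MvPolynomial (Fin 6) ℂ}
    (hF : IsTwistEquivariant n F) {m : Fin 6 →₀ ℕ} (hm : F.coeff m ≠ 0) {μ : Fin 6 → ℂ}
    (hμ : IsTorus μ) : ∏ j, μ j ^ m j = twistChar n μ := by
  let F' : MvPolynomial (Fin 6) ℂ :=
    ∑ d ∈ F.support, MvPolynomial.monomial d (F.coeff d * ∏ j, μ j ^ d j)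
  have hF' : F' - MvPolynomial.C (twistChar n μ) * F = 0 := by
    refine eq_zero_of_eval_eq_zero (K := 1) one_ne_zero fun c _ => ?_
    rw [map_sub, map_mul, MvPolynomial.eval_C, ← hF hμ c, sub_eq_zero, map_sum,
      MvPolynomial.eval_eq' (torusAct hμ c).1 F]
    refine Finset.sum_congr rfl fun d _ => ?_
    rw [MvPolynomial.eval_monomial, Finsupp.prod_fintype _ _ fun i => pow_zero _]
    simp only [torusAct, mul_pow, Finset.prod_mul_distrib, mul_assoc]
  have h := congrArg (MvPolynomial.coeff m) (sub_eq_zero.1 hF')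
  simp only [F', MvPolynomial.coeff_sum, MvPolynomial.coeff_monomial, MvPolynomial.coeff_C_mul] at h
  rw [Finset.sum_ite_eq' F.support m, if_pos (MvPolynomial.mem_support_iff.2 hm), mul_comm] at h
  exact mul_right_cancel₀ hm h

/-- Apply the character identity to the torus element `2 ^ w` and compare exponents of 2. -/
theorem IsTwistEquivariant.weight {n : ℕ} {F : MvPolynomial (Fin 6) ℂ}
    (hF : IsTwistEquivariant n F) {m : Fin 6 →₀ ℕ} (hm : F.coeff m ≠ 0) {w : Fin 6 → ℕ}
    (hxu : w 0 + w 5 = w 2 + w 4) (huy : w 1 + w 5 = w 2 + w 3) (hxs : w 0 + w 3 = w 1 + w 4) :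
    ∑ j, w j * m j = ∑ k ∈ Finset.range n, w ((shiftPerm ^ k) 0) := by
  have hμ : IsTorus fun j => (2 : ℂ) ^ w j :=
    ⟨fun k => pow_ne_zero _ two_ne_zero, by simp only [← pow_add, hxu],
      by simp only [← pow_add, huy], by simp only [← pow_add, hxs]⟩
  have h := hF.coeff hm hμ
  simp only [twistChar, ← pow_mul, Finset.prod_pow_eq_pow_sum] at h
  rw [← Fin.sum_univ_eq_sum_range (fun k => w ((shiftPerm ^ k) 0))]
  exact Nat.pow_right_injective le_rfl (by exact_mod_cast h)

/-- The orbit of X runs around the hexagon with period six. -/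
theorem shiftPerm_pow_zero (k : ℕ) :
    (shiftPerm ^ k) 0 = ![0, 5, 1, 4, 2, 3] ⟨k % 6, Nat.mod_lt _ (by norm_num)⟩ := by
  have h6 : shiftPerm ^ 6 = 1 := by decide
  rw [pow_eq_pow_mod k h6]
  have : ∀ r : Fin 6, (shiftPerm ^ (r : ℕ)) 0 = ![0, 5, 1, 4, 2, 3] r := by decide
  exact this ⟨k % 6, _⟩

/-- The exponents of the monomials in the degree of the `n`-th twisted power. -/
def IsTwistExponent (n : ℕ) (m : Fin 6 → ℕ) : Prop :=
  m 0 + m 4 = (n + 5) / 6 + (n + 2) / 6 ∧ m 2 + m 5 = (n + 4) / 6 + (n + 1) / 6 ∧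
    m 1 + m 3 = (n + 3) / 6 + n / 6 ∧ m 0 + m 1 + m 2 = (n + 5) / 6 + (n + 3) / 6 + (n + 1) / 6

/-- The quotient `(n + 5 - r) / 6` counts the `k < n` congruent to `r` modulo 6. -/
theorem sum_shiftPerm (w : Fin 6 → ℕ) (n : ℕ) :
    ∑ k ∈ Finset.range n, w ((shiftPerm ^ k) 0) =
      w 0 * ((n + 5) / 6) + w 5 * ((n + 4) / 6) + w 1 * ((n + 3) / 6) + w 4 * ((n + 2) / 6) +
        w 2 * ((n + 1) / 6) + w 3 * (n / 6) := by
  induction n with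
  | zero => simp
  | succ n ih =>
    rw [Finset.sum_range_succ, ih, shiftPerm_pow_zero]
    obtain ⟨q, r, hr, rfl⟩ : ∃ q r, r < 6 ∧ n = 6 * q + r :=
      ⟨n / 6, n % 6, Nat.mod_lt _ (by norm_num), (Nat.div_add_mod n 6).symm⟩
    simp only [Nat.mul_add_mod, Nat.mod_eq_of_lt hr, add_assoc, Nat.mul_add_div (by norm_num : 0 < 6)]
    interval_cases r <;> simp <;> ring

/-- Four independent one-parameter subgroups, as many as the dimension of the torus, yield the four
conditions. -/
theorem IsTwistEquivariant.isTwistExponent {n : ℕ} {F : MvPolynomial (Fin 6) ℂ}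
    (hF : IsTwistEquivariant n F) {m : Fin 6 →₀ ℕ} (hm : F.coeff m ≠ 0) :
    IsTwistExponent n m := by
  have key : ∀ w : Fin 6 → ℕ, w 0 + w 5 = w 2 + w 4 → w 1 + w 5 = w 2 + w 3 →
      w 0 + w 3 = w 1 + w 4 → _ := fun w h1 h2 h3 =>
    (hF.weight hm h1 h2 h3).trans (sum_shiftPerm w n)
  have h1 := key ![1, 0, 0, 0, 1, 0] rfl rfl rfl
  have h2 := key ![0, 0, 1, 0, 0, 1] rfl rfl rfl
  have h3 := key ![0, 1, 0, 1, 0, 0] rfl rfl rfl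
  have h4 := key ![1, 1, 1, 0, 0, 0] rfl rfl rfl
  simp [Fin.sum_univ_six] at h1 h2 h3 h4
  unfold IsTwistExponent
  omega

end

section

open MvPolynomial (eval)

variable {p : Fin 3 → Plane} (hp : Projectivization.Independent p)

/-! ### Sections of the twisted powers as polynomials -/

/-- The product of the frames of the first `n` twists. -/
def frameProd {n : ℕ} (I : Fin n → Fin 3) (c : CoxSpace) : ℂ :=
  ∏ k, coxFrame (I k) (coxShift^[(k : ℕ)] c)

theorem mem_twist_coxMap {n : ℕ} {I : Fin n → Fin 3} {c : CoxSpace} :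
    coxMap hp c ∈ ((coxBundle hp).twist (shiftAut hp) n).U I ↔
      ∀ k, coxMap hp (coxShift^[(k : ℕ)] c) ∈ bundleOpen hp (I k) := by
  refine mem_twist.trans (forall_congr' fun k => ?_)
  rw [shiftAut_pow_coxMap]
  rfl

theorem frameProd_ne_zero {n : ℕ} {I : Fin n → Fin 3} {c : CoxSpace}
    (h : coxMap hp c ∈ ((coxBundle hp).twist (shiftAut hp) n).U I) : frameProd I c ≠ 0 :=
  Finset.prod_ne_zero_iff.2 fun k _ => coxFrame_ne_zero hp ((mem_twist_coxMap hp).1 h k)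

theorem RegAt.shift_iterate {φ : CoxSpace → ℂ} {n : ℕ} {c : CoxSpace}
    (h : RegAt φ (coxShift^[n] c)) : RegAt (fun c => φ (coxShift^[n] c)) c := by
  induction n generalizing c with
  | zero => exact h
  | succ n ih => exact (ih h).shift

theorem regAt_frameProd {n : ℕ} {I : Fin n → Fin 3} {c : CoxSpace}
    (h : coxMap hp c ∈ ((coxBundle hp).twist (shiftAut hp) n).U I) : RegAt (frameProd I) c :=
  RegAt.prod fun k => (regAt_coxFrame hp ((mem_twist_coxMap hp).1 h k)).shift_iterate

theorem frameProd_torusAct {n : ℕ} (I : Fin n → Fin 3) {μ : Fin 6 → ℂ} (hμ : IsTorus μ)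
    (c : CoxSpace) : frameProd I (torusAct hμ c) = twistChar n μ * frameProd I c := by
  rw [frameProd, frameProd, twistChar, ← Finset.prod_mul_distrib]
  refine Finset.prod_congr rfl fun k _ => ?_
  rw [coxShift_torusAct, coxFrame_torusAct]
  rfl

theorem twistChar_ne_zero (n : ℕ) {μ : Fin 6 → ℂ} (hμ : IsTorus μ) : twistChar n μ ≠ 0 :=
  Finset.prod_ne_zero_iff.2 fun _ _ => hμ.ne_zero _

theorem twist_g_coxMap {n : ℕ} (I J : Fin n → Fin 3) (c : CoxSpace)
    (hI : coxMap hp c ∈ ((coxBundle hp).twist (shiftAut hp) n).U I)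
    (hJ : coxMap hp c ∈ ((coxBundle hp).twist (shiftAut hp) n).U J) :
    ((coxBundle hp).twist (shiftAut hp) n).g I J ⟨coxMap hp c, Opens.mem_inf.2 ⟨hI, hJ⟩⟩ =
      frameProd J c / frameProd I c := by
  refine (twist_g (L := coxBundle hp) (σ := shiftAut hp) I J _ hI hJ).trans ?_
  rw [frameProd, frameProd, ← Finset.prod_div_distrib]
  refine Finset.prod_congr rfl fun k _ => ?_
  have e : ∀ {b b' : BlowUp p} (h : b = b') (hb : b ∈ (coxBundle hp).U (I k) ⊓ (coxBundle hp).U (J k))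
      (hb' : b' ∈ (coxBundle hp).U (I k) ⊓ (coxBundle hp).U (J k)),
      (coxBundle hp).g (I k) (J k) ⟨b, hb⟩ = (coxBundle hp).g (I k) (J k) ⟨b', hb'⟩ := by
    rintro b _ rfl _ _
    rfl
  have hmem : coxMap hp (coxShift^[(k : ℕ)] c) ∈
      (coxBundle hp).U (I k) ⊓ (coxBundle hp).U (J k) :=
    Opens.mem_inf.2 ⟨(mem_twist_coxMap hp).1 hI k, (mem_twist_coxMap hp).1 hJ k⟩
  exact (e (shiftAut_pow_coxMap hp k c) _ hmem).trans (coxBundle_g hp _ _ _ hmem)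

theorem sectionRatio_torusAct {n : ℕ} {F : MvPolynomial (Fin 6) ℂ} (hF : IsTwistEquivariant n F)
    (I : Fin n → Fin 3) {μ : Fin 6 → ℂ} (hμ : IsTorus μ) (c : CoxSpace) :
    eval (torusAct hμ c).1 F / frameProd I (torusAct hμ c) = eval c.1 F / frameProd I c := by
  rw [hF hμ c, frameProd_torusAct, mul_div_mul_left _ _ (twistChar_ne_zero n hμ)]

/-- The section whose pull-back is a given equivariant polynomial. -/
def polySection {n : ℕ} {F : MvPolynomial (Fin 6) ℂ} (hF : IsTwistEquivariant n F) :
    TwistedPiece (coxBundle hp) (shiftAut hp) n :=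
  ⟨fun I b => eval (coxLift hp b).1 F / frameProd I (coxLift hp b), fun I =>
    descend_mem_reg hp (φ := fun c => eval c.1 F / frameProd I c)
      (fun hμ c => sectionRatio_torusAct hF I hμ c)
      fun c hc => (regAt_eval F c).div (regAt_frameProd hp hc) (frameProd_ne_zero hp hc),
    fun I J b hI hJ => by
      obtain ⟨c, rfl⟩ := coxMap_surjective hp b
      have e := fun I => descend_coxMap hp (φ := fun c => eval c.1 F / frameProd I c)
        (fun hμ c => sectionRatio_torusAct hF I hμ c) c
      refine (e I).trans (Eq.trans ?_ (congrArg₂ (· * ·) (twist_g_coxMap hp I J c hI hJ)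
        (e J)).symm)
      have hne := frameProd_ne_zero hp hJ
      rw [mul_comm, div_mul_div_cancel₀ hne]⟩

theorem polySection_represents {n : ℕ} {F : MvPolynomial (Fin 6) ℂ}
    (hF : IsTwistEquivariant n F) :
    (coxTrivialization hp).Represents (polySection hp hF) F := fun I c h =>
  (congrArg (· * frameProd I c) (descend_coxMap hp (φ := fun c => eval c.1 F / frameProd I c)
    (fun hμ c => sectionRatio_torusAct hF I hμ c) c)).trans
    (div_mul_cancel₀ _ (frameProd_ne_zero hp h))

section Represents

variable {hp} {n : ℕ}

theorem represents_ext {s t : TwistedPiece (coxBundle hp) (shiftAut hp) n}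
    {F : MvPolynomial (Fin 6) ℂ} (hs : (coxTrivialization hp).Represents s F)
    (ht : (coxTrivialization hp).Represents t F) : s = t := by
  refine Subtype.ext (funext fun I => funext fun ⟨b, hb⟩ => ?_)
  obtain ⟨c, rfl⟩ := coxMap_surjective hp b
  exact mul_right_cancel₀ (frameProd_ne_zero hp hb) ((hs I c hb).trans (ht I c hb).symm)

theorem exists_mem_twist (n : ℕ) (b : BlowUp p) :
    ∃ I, b ∈ ((coxBundle hp).twist (shiftAut hp) n).U I :=
  ((coxBundle hp).twist (shiftAut hp) n).cover b

theorem represents_unique {s : TwistedPiece (coxBundle hp) (shiftAut hp) n}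
    {F G : MvPolynomial (Fin 6) ℂ} (hF : (coxTrivialization hp).Represents s F)
    (hG : (coxTrivialization hp).Represents s G) : F = G := by
  refine sub_eq_zero.1 (eq_zero_of_eval_eq_zero (K := 1) one_ne_zero fun c _ => ?_)
  obtain ⟨I, hI⟩ := exists_mem_twist (hp := hp) n (coxMap hp c)
  rw [map_sub, ← hF I c hI, ← hG I c hI, sub_self]

theorem represents_add {s t : TwistedPiece (coxBundle hp) (shiftAut hp) n}
    {F G : MvPolynomial (Fin 6) ℂ} (hs : (coxTrivialization hp).Represents s F)
    (ht : (coxTrivialization hp).Represents t G) :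
    (coxTrivialization hp).Represents (s + t) (F + G) := fun I c h => by
  rw [map_add, ← hs I c h, ← ht I c h, ← add_mul]
  rfl

theorem represents_smul (a : ℂ) {s : TwistedPiece (coxBundle hp) (shiftAut hp) n}
    {F : MvPolynomial (Fin 6) ℂ} (hs : (coxTrivialization hp).Represents s F) :
    (coxTrivialization hp).Represents (a • s) (a • F) := fun I c h => by
  rw [MvPolynomial.smul_eval, ← hs I c h, ← mul_assoc]
  rfl

/-- `σ ^ m` is covered by the `m`-th iterate of `coxShift`, which acts on polynomials by renaming;
the last `n` frames are the frames of the second factor at the shifted point. -/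
theorem represents_mul {m : ℕ} {s : TwistedPiece (coxBundle hp) (shiftAut hp) m}
    {t : TwistedPiece (coxBundle hp) (shiftAut hp) n} {F G : MvPolynomial (Fin 6) ℂ}
    (hs : (coxTrivialization hp).Represents s F) (ht : (coxTrivialization hp).Represents t G) :
    (coxTrivialization hp).Represents (twistedMul s t)
      (F * MvPolynomial.rename (shiftPerm ^ m : Equiv.Perm (Fin 6)) G) := fun I c h => by
  have hr : coxMap hp (coxShift^[m] c) ∈
      ((coxBundle hp).twist (shiftAut hp) n).U fun k => I (Fin.natAdd m k) := by
    rw [← shiftAut_pow_coxMap]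
    exact twist_right h
  rw [map_mul, ← eval_coxShift_iterate, ← hs _ c (twist_left h), ← ht _ _ hr, twistedMul_apply,
    Fin.prod_univ_add, mul_mul_mul_comm]
  congr 2
  · exact H0_congr t rfl (shiftAut_pow_coxMap hp m c) _ _
  · refine Finset.prod_congr rfl fun k _ => ?_
    rw [Fin.val_natAdd, add_comm, Function.iterate_add_apply]

/-- Every section of the `n`-th twisted power is an equivariant polynomial. -/
theorem exists_represents (s : TwistedPiece (coxBundle hp) (shiftAut hp) n) :
    ∃ F, IsTwistEquivariant n F ∧ (coxTrivialization hp).Represents s F := by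
  choose I hI using fun c => exists_mem_twist (hp := hp) n (coxMap hp c)
  let φ : CoxSpace → ℂ := fun c => s.1 (I c) ⟨coxMap hp c, hI c⟩ * frameProd (I c) c
  -- The transition functions are ratios of frames, so the product of a local expression with its
  -- frame does not depend on the chart.
  have hφ : ∀ J c (h : coxMap hp c ∈ ((coxBundle hp).twist (shiftAut hp) n).U J),
      s.1 J ⟨coxMap hp c, h⟩ * frameProd J c = φ c := by
    intro J c h
    have h1 := s.2.2 J (I c) (coxMap hp c) h (hI c)
    have h2 := twist_g_coxMap hp J (I c) c h (hI c)
    refine (congrArg (· * frameProd J c) (h1.trans (congrArg (· * _) h2))).trans ?_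
    have hne := frameProd_ne_zero hp h
    simp only [φ]
    field_simp
  have hreg : ∀ c, RegAt φ c := by
    intro c
    obtain ⟨χ, hχ⟩ := exists_extension hp (s.1 (I c))
    obtain ⟨K, hK, hKU⟩ := exists_eval_of_mem_open hp
      (((coxBundle hp).twist (shiftAut hp) n).U (I c)).2 (hI c)
    refine ((regAt_of_reg hp (s.2.1 (I c)) hχ (hI c)).mul (regAt_frameProd hp (hI c))).congr K hK
      fun c' hc' => ?_
    rw [← hφ (I c) c' (hKU c' hc'), hχ]
  obtain ⟨F, hF⟩ := exists_polynomial_of_regAt hreg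
  refine ⟨F, fun {μ} hμ c => ?_, fun J c h => (hφ J c h).trans (hF c)⟩
  -- Along a torus orbit the point of the blow-up is fixed; only the frames change, by the
  -- character.
  have hmem : coxMap hp (torusAct hμ c) ∈ ((coxBundle hp).twist (shiftAut hp) n).U (I c) := by
    rw [coxMap_torusAct]
    exact hI c
  rw [← hF, ← hF]
  exact (hφ (I c) _ hmem).symm.trans ((congrArg₂ (· * ·)
    (H0_congr s rfl (coxMap_torusAct hp hμ c) hmem (hI c)) (frameProd_torusAct (I c) hμ c)).trans
    (mul_left_comm _ _ _))

end Represents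

theorem isTwistEquivariant_X : IsTwistEquivariant 1 (MvPolynomial.X 0) := fun {μ} hμ c => by
  simp [twistChar, torusAct]

/-- The character in degree two is the weight of `Xu`, which equals that of `Zt`. -/
theorem isTwistEquivariant_ZT :
    IsTwistEquivariant 2 (MvPolynomial.X 2 * MvPolynomial.X 4) := fun {μ} hμ c => by
  have h : shiftPerm 0 = 5 := rfl
  simp only [twistChar, torusAct, map_mul, MvPolynomial.eval_X, Fin.prod_univ_two, Fin.val_zero,
    Fin.val_one, pow_zero, pow_one, Equiv.Perm.one_apply, h, hμ.xu]
  ring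

end

section

open MvPolynomial (eval)

/-! ### Normal forms in the algebra `R` -/

/-- The exponents of the product of `x` and a monomial. -/
def xMul (m : Fin 6 → ℕ) : Fin 6 → ℕ := ![m 3 + 1, m 5, m 4, m 2, m 1, m 0]

/-- The exponents of the product of `y` and a monomial. -/
def yMul (m : Fin 6 → ℕ) : Fin 6 → ℕ := ![m 2, m 0, m 1 + 1, m 4, m 5 + 1, m 3]

/-- The exponents of the left quotient of a monomial by `x`. -/
def xDiv (m : Fin 6 → ℕ) : Fin 6 → ℕ := ![m 5, m 4, m 3, m 0 - 1, m 2, m 1]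

/-- The exponents of the left quotient of a monomial by `y`. -/
def yDiv (m : Fin 6 → ℕ) : Fin 6 → ℕ := ![m 1, m 2 - 1, m 0, m 5, m 3, m 4 - 1]

theorem xDiv_xMul (m : Fin 6 → ℕ) : xDiv (xMul m) = m := by
  funext j
  fin_cases j <;> rfl

theorem yDiv_yMul (m : Fin 6 → ℕ) : yDiv (yMul m) = m := by
  funext j
  fin_cases j <;> rfl

theorem xMul_xDiv {m : Fin 6 → ℕ} (h : m 0 ≠ 0) : xMul (xDiv m) = m := by
  funext j
  fin_cases j
  exacts [Nat.sub_add_cancel (Nat.pos_of_ne_zero h), rfl, rfl, rfl, rfl, rfl]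

theorem yMul_yDiv {m : Fin 6 → ℕ} (h2 : m 2 ≠ 0) (h4 : m 4 ≠ 0) : yMul (yDiv m) = m := by
  funext j
  fin_cases j
  exacts [rfl, rfl, Nat.sub_add_cancel (Nat.pos_of_ne_zero h2), rfl,
    Nat.sub_add_cancel (Nat.pos_of_ne_zero h4), rfl]

theorem yMul_yMul (m : Fin 6 → ℕ) : yMul (yMul m) = xMul (yMul (xMul m)) := by
  funext j
  fin_cases j <;> rfl

theorem yMul_xMul_yMul (m : Fin 6 → ℕ) :
    yMul (xMul (yMul m)) = xMul (xMul (xMul (xMul (xMul m)))) := by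
  funext j
  fin_cases j <;> rfl

namespace IsTwistExponent

variable {n : ℕ} {m : Fin 6 → ℕ}

theorem xMul (h : IsTwistExponent n m) : IsTwistExponent (n + 1) (xMul m) := by
  simp only [IsTwistExponent, DelPezzo.xMul, Matrix.cons_val] at *
  omega

theorem yMul (h : IsTwistExponent n m) : IsTwistExponent (n + 2) (yMul m) := by
  simp only [IsTwistExponent, DelPezzo.yMul, Matrix.cons_val] at *
  omega

theorem exists_xMul (h : IsTwistExponent n m) (h0 : m 0 ≠ 0) :
    ∃ k m', n = k + 1 ∧ IsTwistExponent k m' ∧ m = DelPezzo.xMul m' := by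
  obtain _ | k := n
  · unfold IsTwistExponent at h
    omega
  · refine ⟨k, xDiv m, rfl, ?_, (xMul_xDiv h0).symm⟩
    simp only [IsTwistExponent, xDiv, Matrix.cons_val] at *
    omega

theorem exists_yMul (h : IsTwistExponent n m) (h2 : m 2 ≠ 0) (h4 : m 4 ≠ 0) :
    ∃ k m', n = k + 2 ∧ IsTwistExponent k m' ∧ m = DelPezzo.yMul m' := by
  obtain _ | _ | k := n
  · unfold IsTwistExponent at h
    omega
  · unfold IsTwistExponent at h
    omega
  · refine ⟨k, yDiv m, rfl, ?_, (yMul_yDiv h2 h4).symm⟩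
    simp only [IsTwistExponent, yDiv, Matrix.cons_val] at *
    omega

/-- This is why x and y generate: a monomial of positive degree not divisible by X is divisible by
Zt, so y can be split off. -/
theorem ne_zero_of_eq_zero (h : IsTwistExponent n m) (hn : n ≠ 0) (h0 : m 0 = 0) :
    m 2 ≠ 0 ∧ m 4 ≠ 0 := by
  unfold IsTwistExponent at h
  omega

/-- Needed for the relation x⁵ = yxy: here the monomial is one obtained from a word that starts with
xy. -/
theorem ne_zero_of_ne_zero (h : IsTwistExponent n m) (h2 : m 2 ≠ 0) (h4 : m 4 = 0) :
    m 0 ≠ 0 ∧ m 3 ≠ 0 := by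
  unfold IsTwistExponent at h
  omega

theorem eq_zero (h : IsTwistExponent 0 m) : m = 0 := by
  unfold IsTwistExponent at h
  funext j
  fin_cases j <;> simp <;> omega

end IsTwistExponent

/-! ### Rewriting words by the relations -/

theorem gen_zero_pow : gen 0 ^ 5 = gen 1 * gen 0 * gen 1 := by
  have h := RingQuot.mkAlgHom_rel ℂ Rel.first
  rw [map_pow, map_mul, map_mul] at h
  exact h

theorem gen_one_sq : gen 1 ^ 2 = gen 0 * gen 1 * gen 0 := by
  have h := RingQuot.mkAlgHom_rel ℂ Rel.second
  rw [map_pow, map_mul, map_mul] at h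
  exact h

/-- The word with given exponents that starts with `x` whenever possible. -/
def normalWord : ℕ → (Fin 6 → ℕ) → AlgR
  | 0, _ => 1
  -- The only exponent in degree one is that of X.
  | 1, _ => gen 0
  | n + 2, m => if m 0 = 0 then gen 1 * normalWord n (yDiv m) else
      gen 0 * normalWord (n + 1) (xDiv m)

theorem normalWord_xMul (n : ℕ) (m : Fin 6 → ℕ) :
    normalWord (n + 1) (xMul m) = gen 0 * normalWord n m := by
  cases n with
  | zero => rw [normalWord, normalWord, mul_one]
  | succ n =>
    rw [normalWord, if_neg (show xMul m 0 ≠ 0 from Nat.succ_ne_zero _), xDiv_xMul]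

/-- If the product is not divisible by X, the normal word starts with y. Otherwise the monomial
itself comes from y, and y² = xyx brings x to the front, or it comes from xy, and yxy = x⁵ does.
Both cases recurse to smaller degree. -/
theorem normalWord_yMul (n : ℕ) {m : Fin 6 → ℕ} (hm : IsTwistExponent n m) :
    normalWord (n + 2) (yMul m) = gen 1 * normalWord n m := by
  induction n using Nat.strong_induction_on generalizing m with
  | _ n ih =>
    by_cases h2 : m 2 = 0
    · rw [normalWord, if_pos (show yMul m 0 = 0 from h2), yDiv_yMul]
    by_cases h4 : m 4 = 0
    · obtain ⟨h0, h3⟩ := hm.ne_zero_of_ne_zero h2 h4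
      obtain ⟨k, m', rfl, hm', rfl⟩ := hm.exists_xMul h0
      obtain ⟨k, m'', rfl, hm'', rfl⟩ := hm'.exists_yMul (show m' 2 ≠ 0 from h3)
        (show m' 4 ≠ 0 from h2)
      rw [yMul_xMul_yMul, normalWord_xMul, normalWord_xMul, normalWord_xMul, normalWord_xMul,
        normalWord_xMul, normalWord_xMul, ih k (by omega) hm'']
      simp only [← mul_assoc]
      rw [← gen_zero_pow]
      simp only [pow_succ, pow_zero, one_mul]
    · obtain ⟨k, m', rfl, hm', rfl⟩ := hm.exists_yMul h2 h4
      rw [yMul_yMul, normalWord_xMul, ih (k + 1) (by omega) hm'.xMul, normalWord_xMul,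
        ih k (by omega) hm']
      simp only [← mul_assoc]
      rw [← gen_one_sq, sq]

/-- The weight of a word. -/
def wordWeight (w : List (Fin 2)) : ℕ := (w.map ![1, 2]).sum

/-- The exponents of the monomial represented by a word. -/
def wordExp : List (Fin 2) → Fin 6 → ℕ
  | [] => 0
  | i :: w => (![xMul, yMul] i) (wordExp w)

theorem isTwistExponent_wordExp (w : List (Fin 2)) :
    IsTwistExponent (wordWeight w) (wordExp w) := by
  induction w with
  | nil => simp [IsTwistExponent, wordWeight, wordExp]
  | cons i w ih =>
    have hw : wordWeight (i :: w) = wordWeight w + ![1, 2] i := by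
      rw [wordWeight, List.map_cons, List.sum_cons, add_comm]
      rfl
    rw [hw]
    fin_cases i
    exacts [ih.xMul, ih.yMul]

/-- Prepending a letter to a normal word gives a normal word again, so in R a word depends only on
its weight and its monomial. -/
theorem prod_gen_eq_normalWord (w : List (Fin 2)) :
    (w.map gen).prod = normalWord (wordWeight w) (wordExp w) := by
  induction w with
  | nil => rfl
  | cons i w ih =>
    have hw : wordWeight (i :: w) = wordWeight w + ![1, 2] i := by
      rw [wordWeight, List.map_cons, List.sum_cons, add_comm]
      rfl
    rw [hw, List.map_cons, List.prod_cons, ih]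
    fin_cases i
    exacts [(normalWord_xMul _ _).symm, (normalWord_yMul _ (isTwistExponent_wordExp w)).symm]

/-- Split off x if X divides the monomial and y otherwise, and recurse. -/
theorem exists_word {n : ℕ} {m : Fin 6 → ℕ} (h : IsTwistExponent n m) :
    ∃ w, wordWeight w = n ∧ wordExp w = m := by
  induction n using Nat.strong_induction_on generalizing m with
  | _ n ih =>
    by_cases hn : n = 0
    · subst hn
      exact ⟨[], rfl, h.eq_zero.symm⟩
    by_cases h0 : m 0 = 0
    · obtain ⟨h2, h4⟩ := h.ne_zero_of_eq_zero hn h0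
      obtain ⟨k, m', rfl, hm', rfl⟩ := h.exists_yMul h2 h4
      obtain ⟨w, rfl, rfl⟩ := ih k (by omega) hm'
      exact ⟨1 :: w, by simp [wordWeight, add_comm], rfl⟩
    · obtain ⟨k, m', rfl, hm', rfl⟩ := h.exists_xMul h0
      obtain ⟨w, rfl, rfl⟩ := ih k (by omega) hm'
      exact ⟨0 :: w, by simp [wordWeight, add_comm], rfl⟩

theorem span_words : Submodule.span ℂ {r | ∃ w : List (Fin 2), r = (w.map gen).prod} = ⊤ := by
  have h1 : Algebra.adjoin ℂ (Set.range gen) = ⊤ := by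
    have h := congrArg (Subalgebra.map (RingQuot.mkAlgHom ℂ Rel))
      (FreeAlgebra.adjoin_range_ι (R := ℂ) (X := Fin 2))
    rw [AlgHom.map_adjoin, ← Set.range_comp, Algebra.map_top,
      (AlgHom.range_eq_top _).2 (RingQuot.mkAlgHom_surjective ℂ Rel)] at h
    exact h
  have h2 := Algebra.adjoin_eq_span (R := ℂ) (s := Set.range gen)
  rw [h1, Algebra.top_toSubmodule] at h2
  rw [eq_top_iff, h2]
  refine Submodule.span_mono fun r hr => ?_
  obtain ⟨l, hl, rfl⟩ := Submonoid.exists_list_of_mem_closure hr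
  obtain ⟨w, rfl⟩ : ∃ w : List (Fin 2), w.map gen = l := by
    rw [← Set.mem_range, Set.range_list_map]
    exact hl
  exact ⟨w, rfl⟩

/-! ### The isomorphism -/

/-- The monomial with given exponents. -/
def coxMonomial (m : Fin 6 → ℕ) : MvPolynomial (Fin 6) ℂ :=
  MvPolynomial.monomial (Finsupp.equivFunOnFinite.symm m) 1

theorem coxMonomial_eq_prod (m : Fin 6 → ℕ) :
    coxMonomial m = ∏ j, MvPolynomial.X j ^ m j := by
  rw [coxMonomial, MvPolynomial.monomial_eq, map_one, one_mul,
    Finsupp.prod_fintype _ _ fun i => pow_zero _]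
  rfl

theorem coxMonomial_xMul (m : Fin 6 → ℕ) : MvPolynomial.X 0 *
    MvPolynomial.rename (shiftPerm ^ 1 : Equiv.Perm (Fin 6)) (coxMonomial m) =
      coxMonomial (xMul m) := by
  simp only [coxMonomial_eq_prod, Fin.prod_univ_six, map_mul, map_pow, MvPolynomial.rename_X]
  rw [show (shiftPerm ^ 1) 0 = 5 from rfl, show (shiftPerm ^ 1) 1 = 4 from rfl,
    show (shiftPerm ^ 1) 2 = 3 from rfl, show (shiftPerm ^ 1) 3 = 0 from rfl,
    show (shiftPerm ^ 1) 4 = 2 from rfl, show (shiftPerm ^ 1) 5 = 1 from rfl]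
  simp only [xMul, Matrix.cons_val]
  ring

theorem coxMonomial_yMul (m : Fin 6 → ℕ) : MvPolynomial.X 2 * MvPolynomial.X 4 *
    MvPolynomial.rename (shiftPerm ^ 2 : Equiv.Perm (Fin 6)) (coxMonomial m) =
      coxMonomial (yMul m) := by
  simp only [coxMonomial_eq_prod, Fin.prod_univ_six, map_mul, map_pow, MvPolynomial.rename_X]
  rw [show (shiftPerm ^ 2) 0 = 1 from rfl, show (shiftPerm ^ 2) 1 = 2 from rfl,
    show (shiftPerm ^ 2) 2 = 0 from rfl, show (shiftPerm ^ 2) 3 = 5 from rfl,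
    show (shiftPerm ^ 2) 4 = 3 from rfl, show (shiftPerm ^ 2) 5 = 4 from rfl]
  simp only [yMul, Matrix.cons_val]
  ring

variable {p : Fin 3 → Plane} (hp : Projectivization.Independent p)

/-- The section that corresponds to `x`. -/
def sectionX : TwistedPiece (coxBundle hp) (shiftAut hp) 1 := polySection hp isTwistEquivariant_X

/-- The section that corresponds to `y`. -/
def sectionY : TwistedPiece (coxBundle hp) (shiftAut hp) 2 := polySection hp isTwistEquivariant_ZT

/-- The images of the generators in the twisted ring. -/
def twistedGen : Fin 2 → TwistedRing (coxBundle hp) (shiftAut hp) :=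
  ![DirectSum.of (TwistedPiece (coxBundle hp) (shiftAut hp)) 1 (sectionX hp),
    DirectSum.of (TwistedPiece (coxBundle hp) (shiftAut hp)) 2 (sectionY hp)]

theorem represents_one : (coxTrivialization hp).Represents
    (twistedScalar 1 : TwistedPiece (coxBundle hp) (shiftAut hp) 0) (coxMonomial 0) :=
  fun I c h => by
    have : coxMonomial 0 = 1 := by rw [coxMonomial_eq_prod]; simp
    rw [this, Fin.prod_univ_zero, mul_one]
    exact (map_one (eval c.1)).symm

theorem exists_word_section (w : List (Fin 2)) :
    ∃ s : TwistedPiece (coxBundle hp) (shiftAut hp) (wordWeight w),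
      (w.map (twistedGen hp)).prod =
        DirectSum.of (TwistedPiece (coxBundle hp) (shiftAut hp)) (wordWeight w) s ∧
      (coxTrivialization hp).Represents s (coxMonomial (wordExp w)) := by
  induction w with
  | nil => exact ⟨twistedScalar 1, rfl, represents_one hp⟩
  | cons i w ih =>
    obtain ⟨s, hs, hr⟩ := ih
    rw [List.map_cons, List.prod_cons, hs]
    -- The product lives in degree `k + wordWeight w`; this form lets the equality of degrees be
    -- substituted.
    have key : ∀ {k : ℕ} (t : TwistedPiece (coxBundle hp) (shiftAut hp) k)
        {F : MvPolynomial (Fin 6) ℂ}, (coxTrivialization hp).Represents t F →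
        k + wordWeight w = wordWeight (i :: w) →
        F * MvPolynomial.rename (shiftPerm ^ k : Equiv.Perm (Fin 6)) (coxMonomial (wordExp w)) =
          coxMonomial (wordExp (i :: w)) →
        ∃ s' : TwistedPiece (coxBundle hp) (shiftAut hp) (wordWeight (i :: w)),
          DirectSum.of (TwistedPiece (coxBundle hp) (shiftAut hp)) k t *
            DirectSum.of (TwistedPiece (coxBundle hp) (shiftAut hp)) (wordWeight w) s =
          DirectSum.of (TwistedPiece (coxBundle hp) (shiftAut hp)) (wordWeight (i :: w)) s' ∧
          (coxTrivialization hp).Represents s' (coxMonomial (wordExp (i :: w))) := by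
      intro k t F ht hk hF
      rw [← hk, ← hF]
      exact ⟨twistedMul t s, DirectSum.of_mul_of _ _, represents_mul ht hr⟩
    fin_cases i
    · exact key _ (polySection_represents hp isTwistEquivariant_X) rfl (coxMonomial_xMul _)
    · exact key _ (polySection_represents hp isTwistEquivariant_ZT) rfl (coxMonomial_yMul _)

/-- Both products are homogeneous of the same degree and represented by the same monomial, which
determines the section. The relations of R become a finite check on exponents. -/
theorem prod_twistedGen_eq {w w' : List (Fin 2)} (h : wordWeight w = wordWeight w')
    (h' : wordExp w = wordExp w') :
    (w.map (twistedGen hp)).prod = (w'.map (twistedGen hp)).prod := by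
  obtain ⟨s, hs, hr⟩ := exists_word_section hp w
  obtain ⟨s', hs', hr'⟩ := exists_word_section hp w'
  rw [hs, hs']
  rw [← h'] at hr'
  generalize wordWeight w' = n at h s'
  subst h
  rw [represents_ext hr hr']

theorem twistedGen_zero_pow :
    twistedGen hp 0 ^ 5 = twistedGen hp 1 * twistedGen hp 0 * twistedGen hp 1 := by
  have h := prod_twistedGen_eq hp (w := [0, 0, 0, 0, 0]) (w' := [1, 0, 1]) rfl
    (by decide)
  generalize twistedGen hp = f at h ⊢
  simp only [List.map_cons, List.map_nil, List.prod_cons, List.prod_nil, mul_one] at h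
  rw [mul_assoc, ← h]
  simp only [pow_succ, pow_zero, one_mul, mul_assoc]

theorem twistedGen_one_sq :
    twistedGen hp 1 ^ 2 = twistedGen hp 0 * twistedGen hp 1 * twistedGen hp 0 := by
  have h := prod_twistedGen_eq hp (w := [1, 1]) (w' := [0, 1, 0]) rfl (by decide)
  generalize twistedGen hp = f at h ⊢
  simp only [List.map_cons, List.map_nil, List.prod_cons, List.prod_nil, mul_one] at h
  rw [mul_assoc, ← h, sq]

/-- The homomorphism from `R` to the twisted ring. -/
def toTwisted : AlgR →ₐ[ℂ] TwistedRing (coxBundle hp) (shiftAut hp) :=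
  RingQuot.liftAlgHom ℂ ⟨FreeAlgebra.lift ℂ (twistedGen hp), by
    rintro _ _ (_ | _)
    · rw [map_pow, map_mul, map_mul, FreeAlgebra.lift_ι_apply, FreeAlgebra.lift_ι_apply]
      exact twistedGen_zero_pow hp
    · rw [map_pow, map_mul, map_mul, FreeAlgebra.lift_ι_apply, FreeAlgebra.lift_ι_apply]
      exact twistedGen_one_sq hp⟩

theorem toTwisted_gen (i : Fin 2) : toTwisted hp (gen i) = twistedGen hp i := by
  rw [toTwisted, gen, RingQuot.liftAlgHom_mkAlgHom_apply, FreeAlgebra.lift_ι_apply]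

theorem toTwisted_word (w : List (Fin 2)) :
    toTwisted hp (w.map gen).prod = (w.map (twistedGen hp)).prod := by
  rw [map_list_prod, List.map_map]
  congr 2
  funext i
  exact toTwisted_gen hp i

/-- The polynomial that represents a section. -/
def toPoly (n : ℕ) : TwistedPiece (coxBundle hp) (shiftAut hp) n →ₗ[ℂ] MvPolynomial (Fin 6) ℂ where
  toFun s := (exists_represents s).choose
  map_add' s t := represents_unique (exists_represents (s + t)).choose_spec.2
    (represents_add (exists_represents s).choose_spec.2 (exists_represents t).choose_spec.2)
  map_smul' a s := represents_unique (exists_represents (a • s)).choose_spec.2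
    (represents_smul a (exists_represents s).choose_spec.2)

theorem represents_toPoly {n : ℕ} (s : TwistedPiece (coxBundle hp) (shiftAut hp) n) :
    (coxTrivialization hp).Represents s (toPoly hp n s) :=
  (exists_represents s).choose_spec.2

theorem isTwistEquivariant_toPoly {n : ℕ} (s : TwistedPiece (coxBundle hp) (shiftAut hp) n) :
    IsTwistEquivariant n (toPoly hp n s) :=
  (exists_represents s).choose_spec.1

theorem toPoly_injective (n : ℕ) : Function.Injective (toPoly hp n) := fun s t h =>
  represents_ext (represents_toPoly hp s) (h ▸ represents_toPoly hp t)

/-- The linear inverse of `toTwisted`, through normal forms. -/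
def ofTwisted : TwistedRing (coxBundle hp) (shiftAut hp) →ₗ[ℂ] AlgR :=
  DirectSum.toModule ℂ ℕ AlgR fun n =>
    ((MvPolynomial.basisMonomials (Fin 6) ℂ).constr ℂ fun m => normalWord n m) ∘ₗ toPoly hp n

theorem ofTwisted_toTwisted (r : AlgR) : ofTwisted hp (toTwisted hp r) = r := by
  have h : ofTwisted hp ∘ₗ (toTwisted hp).toLinearMap = LinearMap.id := by
    -- On a word both maps are explicit: the word goes to its monomial, and the monomial to the
    -- normal word, which equals the word in R.
    refine LinearMap.ext_on span_words ?_
    rintro _ ⟨w, rfl⟩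
    obtain ⟨s, hs, hr⟩ := exists_word_section hp w
    have hpoly : toPoly hp _ s = coxMonomial (wordExp w) :=
      represents_unique (represents_toPoly hp s) hr
    have hb : coxMonomial (wordExp w) = MvPolynomial.basisMonomials (Fin 6) ℂ
        (Finsupp.equivFunOnFinite.symm (wordExp w)) := by
      rw [MvPolynomial.coe_basisMonomials]
      rfl
    rw [LinearMap.comp_apply, AlgHom.toLinearMap_apply, toTwisted_word, hs, ofTwisted,
      ← DirectSum.lof_eq_of ℂ, DirectSum.toModule_lof, LinearMap.comp_apply, hpoly, hb,
      Module.Basis.constr_basis, LinearMap.id_apply, prod_gen_eq_normalWord]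
    rfl
  exact LinearMap.congr_fun h r

/-- Every monomial in the polynomial of `s` has an admissible exponent and so comes from a word of
weight `n`. Thus `s` is a linear combination of images of words. -/
theorem of_mem_map_component {n : ℕ} (s : TwistedPiece (coxBundle hp) (shiftAut hp) n) :
    DirectSum.of (TwistedPiece (coxBundle hp) (shiftAut hp)) n s ∈
      (component n).map (toTwisted hp).toLinearMap := by
  have key : ∀ m : Fin 6 →₀ ℕ, (toPoly hp n s).coeff m ≠ 0 →
      ∃ t : TwistedPiece (coxBundle hp) (shiftAut hp) n,
        toPoly hp n t = MvPolynomial.monomial m 1 ∧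
        DirectSum.of (TwistedPiece (coxBundle hp) (shiftAut hp)) n t ∈
          (component n).map (toTwisted hp).toLinearMap := by
    intro m hm
    obtain ⟨w, rfl, hw⟩ := exists_word (IsTwistEquivariant.isTwistExponent (isTwistEquivariant_toPoly hp s) hm)
    obtain ⟨t, ht, hr⟩ := exists_word_section hp w
    refine ⟨t, (represents_unique (represents_toPoly hp t) hr).trans ?_, ?_⟩
    · rw [hw, coxMonomial]
      exact congrArg (fun m => MvPolynomial.monomial m 1)
        (Finsupp.equivFunOnFinite.symm_apply_apply m)
    · rw [← ht, ← toTwisted_word]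
      exact Submodule.mem_map_of_mem (Submodule.subset_span ⟨w, rfl, rfl⟩)
  choose! t ht hmem using key
  have hs : s = ∑ m ∈ (toPoly hp n s).support, (toPoly hp n s).coeff m • t m := by
    apply toPoly_injective hp n
    rw [map_sum]
    conv_lhs => rw [(toPoly hp n s).as_sum]
    refine Finset.sum_congr rfl fun m hm => ?_
    rw [map_smul, ht m (MvPolynomial.mem_support_iff.1 hm), MvPolynomial.smul_monomial,
      smul_eq_mul, mul_one]
  rw [hs, ← DirectSum.lof_eq_of ℂ, map_sum]
  refine Submodule.sum_mem _ fun m hm => ?_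
  rw [map_smul]
  exact Submodule.smul_mem _ _ (hmem m (MvPolynomial.mem_support_iff.1 hm))

theorem map_component (n : ℕ) : (component n).map (toTwisted hp).toLinearMap =
    LinearMap.range (DirectSum.lof ℂ ℕ (TwistedPiece (coxBundle hp) (shiftAut hp)) n) := by
  refine le_antisymm ?_ ?_
  · rw [component, Submodule.map_span, Submodule.span_le]
    rintro _ ⟨_, ⟨w, rfl, rfl⟩, rfl⟩
    obtain ⟨s, hs, -⟩ := exists_word_section hp w
    rw [AlgHom.toLinearMap_apply, toTwisted_word, hs]
    exact ⟨s, rfl⟩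
  · rintro _ ⟨s, rfl⟩
    exact of_mem_map_component hp s

theorem toTwisted_bijective : Function.Bijective (toTwisted hp) := by
  refine ⟨Function.LeftInverse.injective (ofTwisted_toTwisted hp), fun z => ?_⟩
  induction z using DirectSum.induction_on with
  | zero => exact ⟨0, map_zero _⟩
  | of n s =>
    obtain ⟨r, -, hr⟩ := of_mem_map_component hp s
    exact ⟨r, hr⟩
  | add a b ha hb =>
    obtain ⟨r, rfl⟩ := ha
    obtain ⟨r', rfl⟩ := hb
    exact ⟨r + r', map_add _ _ _⟩

end

end DelPezzo

end

theorem theorem1p2 (p : Fin 3 → Plane) (hp : Projectivization.Independent p) :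
    ∃ (σ : VAut (BlowUp p)) (L : LineBundle (BlowUp p)),
      orderOf σ = 6 ∧
      (∀ c, (σ : Equiv.Perm (BlowUp p)) (coxMap hp c) = coxMap hp (coxShift c)) ∧
      (∀ k, (σ : Equiv.Perm (BlowUp p)) ⁻¹' hexagon p k = hexagon p (k + 1)) ∧
      L.IsOfDivisor (lineCurve p 0) ∧
      ∃ (T : CoxTrivialization hp L) (x : TwistedPiece L σ 1) (y : TwistedPiece L σ 2)
        (Φ : AlgR ≃ₐ[ℂ] TwistedRing L σ),
        T.Represents x (MvPolynomial.X 0) ∧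
        T.Represents y (MvPolynomial.X 2 * MvPolynomial.X 4) ∧
        Φ (gen 0) = DirectSum.of (TwistedPiece L σ) 1 x ∧
        Φ (gen 1) = DirectSum.of (TwistedPiece L σ) 2 y ∧
        ∀ n, (component n).map Φ.toLinearMap =
          LinearMap.range (DirectSum.lof ℂ ℕ (TwistedPiece L σ) n) := by
  exact ⟨shiftAut hp, coxBundle hp, orderOf_shiftAut hp, shiftAut_coxMap hp,
    shiftAut_preimage_hexagon hp, coxBundle_isOfDivisor hp, coxTrivialization hp, sectionX hp,
    sectionY hp, AlgEquiv.ofBijective (toTwisted hp) (toTwisted_bijective hp),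
    polySection_represents hp isTwistEquivariant_X,
    polySection_represents hp isTwistEquivariant_ZT, toTwisted_gen hp 0, toTwisted_gen hp 1,
    map_component hp⟩
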